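/- An $\omega$-PDA is a tuple $\mathcal A=(\Sigma,\Gamma,Q,Q_0,Q_F,\delta)$ with finite input alphabet $\Sigma$, finite stack alphabet $\Gamma$, finite set of states $Q$, initial states $Q_0\subseteq Q$, accepting states $Q_F\subseteq Q$, and a finite transition relation $\delta\subseteq Q\times\Sigma\times(\Gamma\cup\{\bot\})\times Q\times\Gamma^*$. A configuration is a triple $(q,a,\bot u)$ with $q\in Q$, $a\in\Sigma\cup\{\epsilon\}$, $u\in\Gamma^*$ (top of the stack on the right). A run is an infinite sequence $\pi=\pi[0]\pi[1]\dots$ of configurations with $\pi[0]=(q_0,\epsilon,\bot)$, $q_0\in Q_0$, such that for consecutive configurations $(q,a,\bot u)$, $(q',a',\bot u')$ there is $(q,a',x,q',y)\in\delta$ with either $x=\bot$, $u=\epsilon$, $u'=y$, or $x\in\Gamma$, $u=vx$, $u'=vy$ for some $v$. A run is accepting if it visits $Q_F$ infinitely often; it gives the infinite word formed by its letters, and $\mathcal L(\mathcal A)$ is the set of words given by accepting runs. A stack pricing is a function $\mathbf c:\Gamma\to\mathbb N$; the cost of a configuration is the sum of the prices of its stack symbols other than $\bot$. Put $$\mathsf{IASC}(\pi,\mathbf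 c)=\liminf_{k\to\infty}\frac1k\sum_{i=0}^{k-1}\mathbf c(\pi[i]),\qquad \mathsf{SASC}(\pi,\mathbf c)=\limsup_{k\to\infty}\frac1k\sum_{i=0}^{k-1}\mathbf c(\pi[i]),$$ with values in $[0,\infty]$. For a letter-cost function $\mathbf{lc}:\Sigma\to\mathbb Q$ and an infinite word $w=w_1w_2\dots$ put $$\mathsf{avgInf}_{\mathbf{lc}}(w)=\liminf_{k\to\infty}\frac1k\sum_{i=1}^{k}\mathbf{lc}(w_i),\qquad \mathsf{avgSup}_{\mathbf{lc}}(w)=\limsup_{k\to\infty}\frac1k\sum_{i=1}^{k}\mathbf{lc}(w_i).$$ For $\bowtie\in\{<,\le\}$ consider the following decision problems. * $\mathsf{IASC}^{\bowtie}$ (resp. $\mathsf{SASC}^{\bowtie}$): given an $\omega$-PDA $\mathcal A$, a stack pricing $\mathbf c$ and a threshold $\lambda\in\mathbb Q$, with the prices and the threshold encoded in unary, is there an accepting run $\pi$ of $\mathcal A$ with $\mathsf{IASC}(\pi,\mathbf c)\bowtie\lambda$ (resp. $\mathsf{SASC}(\pi,\mathbf c)\bowtie\lambda$)? * $\mathsf{avgInfLC}^{\bowtie}$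 (resp. $\mathsf{avgSupLC}^{\bowtie}$): given an $\omega$-PDA $\mathcal A$, a letter-cost function $\mathbf{lc}$ and a threshold $\lambda\in\mathbb Q$, with the letter costs and the threshold encoded in binary, is there a word $w\in\mathcal L(\mathcal A)$ with $\mathsf{avgInf}_{\mathbf{lc}}(w)\bowtie\lambda$ (resp. $\mathsf{avgSup}_{\mathbf{lc}}(w)\bowtie\lambda$)? Here a rational number is encoded as the pair of its numerator and denominator. **Theorem.** For each $\bowtie\in\{<,\le\}$ there is a polynomial-time many-one reduction from $\mathsf{IASC}^{\bowtie}$ to $\mathsf{avgInfLC}^{\bowtie}$, and there is a polynomial-time many-one reduction from $\mathsf{SASC}^{\bowtie}$ to $\mathsf{avgSupLC}^{\bowtie}$. -/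

import Mathlib

open Filter

namespace StackCost

/-! ### Büchi pushdown automata -/

/-- An `ω`-PDA with input alphabet `A`, stack alphabet `G` and set of states `Q`.
A transition is a tuple `(q, a, x, q', y)`, where `x : Option G` is the top of the stack
(`none` is the bottom symbol `⊥`) and `y` is the word that replaces it. -/
structure OmegaPDA (A G Q : Type) where
  /-- initial states -/
  init : Finset Q
  /-- accepting states -/
  acc : Finset Q
  /-- transition relation -/
  trans : Finset (Q × A × Option G × Q × List G)

/-- A configuration `(q, a, u)`. The letter `none` is the empty word. The stack is listed from
bottom to top, and its first symbol `⊥`, which occurs nowhere else, is left implicit: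
`stack = u` stands for the stack content `⊥u`. -/
structure Config (A G Q : Type) where
  /-- current state -/
  state : Q
  /-- letter read on entering the configuration -/
  letter : Option A
  /-- stack content above `⊥` -/
  stack : List G

variable {A G Q : Type}

/-- `M.Step C D`: the configuration `D` is a successor of `C`. -/
def OmegaPDA.Step (M : OmegaPDA A G Q) (C D : Config A G Q) : Prop :=
  ∃ (a : A) (x : Option G) (y : List G),
    D.letter = some a ∧ (C.state, a, x, D.state, y) ∈ M.trans ∧
      ((x = none ∧ C.stack = [] ∧ D.stack = y) ∨
        ∃ (g : G) (us : List G), x = some g ∧ C.stack = us ++ [g] ∧ D.stack = us ++ y)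

/-- Infinite runs. -/
structure OmegaPDA.IsRun (M : OmegaPDA A G Q) (π : ℕ → Config A G Q) : Prop where
  init_state : (π 0).state ∈ M.init
  init_letter : (π 0).letter = none
  init_stack : (π 0).stack = []
  step : ∀ i, M.Step (π i) (π (i + 1))

/-- Büchi acceptance: the run visits accepting states infinitely often. (Every transition reads
a letter, so every infinite run gives an infinite word.) -/
def OmegaPDA.IsAcceptingRun (M : OmegaPDA A G Q) (π : ℕ → Config A G Q) : Prop :=
  M.IsRun π ∧ ∃ᶠ i in atTop, (π i).state ∈ M.acc

/-- The run `π` gives the infinite word `w`; the letter of `π 0` is empty, so the `i`-th letter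
of `w` (counted from `0`) is that of `π (i + 1)`. -/
def Gives (π : ℕ → Config A G Q) (w : ℕ → A) : Prop :=
  ∀ i, (π (i + 1)).letter = some (w i)

/-- The language of infinite words recognized by an `ω`-PDA. -/
def OmegaPDA.language (M : OmegaPDA A G Q) : Set (ℕ → A) :=
  {w | ∃ π, M.IsAcceptingRun π ∧ Gives π w}

/-! ### Average stack cost and average letter cost -/

/-- The cost of a configuration under the stack pricing `c` (the price of `⊥` is `0`). -/
def configCost (c : G → ℕ) (C : Config A G Q) : ℕ :=
  (C.stack.map c).sum

/-- Average stack cost of the prefix of length `k`. -/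
noncomputable def ASC (c : G → ℕ) (π : ℕ → Config A G Q) (k : ℕ) : ℝ :=
  (1 / (k : ℝ)) * ∑ i ∈ Finset.range k, (configCost c (π i) : ℝ)

/-- Infimum-average stack cost of a run, a possibly infinite value. -/
noncomputable def IASC (c : G → ℕ) (π : ℕ → Config A G Q) : EReal :=
  liminf (fun k : ℕ => (ASC c π k : EReal)) atTop

/-- Supremum-average stack cost of a run, a possibly infinite value. -/
noncomputable def SASC (c : G → ℕ) (π : ℕ → Config A G Q) : EReal :=
  limsup (fun k : ℕ => (ASC c π k : EReal)) atTop

/-- Average letter cost of the prefix of length `k` of an infinite word. -/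
noncomputable def avgLC (lc : A → ℚ) (w : ℕ → A) (k : ℕ) : ℝ :=
  (∑ i ∈ Finset.range k, (lc (w i) : ℝ)) / (k : ℝ)

/-- Average low letter cost of an infinite word. -/
noncomputable def avgInfLC (lc : A → ℚ) (w : ℕ → A) : EReal :=
  liminf (fun k : ℕ => (avgLC lc w k : EReal)) atTop

/-- Average high letter cost of an infinite word. -/
noncomputable def avgSupLC (lc : A → ℚ) (w : ℕ → A) : EReal :=
  limsup (fun k : ℕ => (avgLC lc w k : EReal)) atTop

/-! ### Instances of the decision problems -/

/-- A finite presentation of an `ω`-PDA, with letters, stack symbols and states numbered from `0`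
and the three finite sets given by lists. -/
structure PDACode where
  /-- number of input letters -/
  numLetters : ℕ
  /-- number of stack symbols -/
  numSymbols : ℕ
  /-- number of states -/
  numStates : ℕ
  /-- initial states -/
  init : List (Fin numStates)
  /-- accepting states -/
  acc : List (Fin numStates)
  /-- transitions -/
  trans : List (Fin numStates × Fin numLetters × Option (Fin numSymbols) ×
    Fin numStates × List (Fin numSymbols))

/-- The presented automaton. -/
def PDACode.toPDA (M : PDACode) :
    OmegaPDA (Fin M.numLetters) (Fin M.numSymbols) (Fin M.numStates) where
  init := M.init.toFinset
  acc := M.acc.toFinset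
  trans := M.trans.toFinset

/-- Instances of the average stack cost problem: an `ω`-PDA, a stack pricing, a threshold. -/
structure StackCostInstance where
  /-- the automaton -/
  pda : PDACode
  /-- stack pricing -/
  price : Fin pda.numSymbols → ℕ
  /-- threshold -/
  threshold : ℚ

/-- Instances of the average letter cost problem: an `ω`-PDA, a letter-cost function,
a threshold. -/
structure LetterCostInstance where
  /-- the automaton -/
  pda : PDACode
  /-- letter-cost function -/
  lc : Fin pda.numLetters → ℚ
  /-- threshold -/
  threshold : ℚ

/-- The two comparisons `<` and `≤`. -/
inductive Comparison
  | lt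
  | le

/-- `r.Holds x l` is `x < l` or `x ≤ l`, according to `r`. -/
def Comparison.Holds : Comparison → EReal → ℚ → Prop
  | lt, x, l => x < ((l : ℝ) : EReal)
  | le, x, l => x ≤ ((l : ℝ) : EReal)

/-- The `IASC` problem with comparison `r`. -/
def IASCProblem (r : Comparison) (I : StackCostInstance) : Prop :=
  ∃ π, I.pda.toPDA.IsAcceptingRun π ∧ r.Holds (IASC I.price π) I.threshold

/-- The `SASC` problem with comparison `r`. -/
def SASCProblem (r : Comparison) (I : StackCostInstance) : Prop :=
  ∃ π, I.pda.toPDA.IsAcceptingRun π ∧ r.Holds (SASC I.price π) I.threshold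

/-- The `avgInf` letter cost problem with comparison `r`. -/
def AvgInfLCProblem (r : Comparison) (I : LetterCostInstance) : Prop :=
  ∃ w ∈ I.pda.toPDA.language, r.Holds (avgInfLC I.lc w) I.threshold

/-- The `avgSup` letter cost problem with comparison `r`. -/
def AvgSupLCProblem (r : Comparison) (I : LetterCostInstance) : Prop :=
  ∃ w ∈ I.pda.toPDA.language, r.Holds (avgSupLC I.lc w) I.threshold

/-! ### Encodings of instances as binary strings

All codes are self-delimiting, so that codes can be concatenated. -/

/-- Unary code of a natural number. -/
def encUnary (n : ℕ) : List Bool :=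
  List.replicate n true ++ [false]

/-- Code of a list: `true` before each entry, `false` at the end. -/
def encList {α : Type} (e : α → List Bool) : List α → List Bool
  | [] => [false]
  | a :: l => true :: (e a ++ encList e l)

/-- Code of an optional entry. -/
def encOption {α : Type} (e : α → List Bool) : Option α → List Bool
  | none => [false]
  | some a => true :: e a

/-- Binary code of a natural number: the list of its binary digits, least significant first. -/
def encBinary (n : ℕ) : List Bool :=
  encList (fun b => [b]) n.bits

/-- Code of a rational number, as sign, numerator and denominator in lowest terms, where `e` is
the code of natural numbers. -/
def encRat (e : ℕ → List Bool) (q : ℚ) : List Bool :=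
  decide (q.num < 0) :: (e q.num.natAbs ++ e q.den)

/-- Code of a letter, stack symbol or state, by its number. -/
def encFin {n : ℕ} (i : Fin n) : List Bool :=
  encUnary i

/-- Code of a transition. -/
def encTrans {a g q : ℕ} (t : Fin q × Fin a × Option (Fin g) × Fin q × List (Fin g)) :
    List Bool :=
  encFin t.1 ++ (encFin t.2.1 ++ (encOption encFin t.2.2.1 ++
    (encFin t.2.2.2.1 ++ encList encFin t.2.2.2.2)))

/-- Code of an automaton. -/
def encPDA (M : PDACode) : List Bool :=
  encUnary M.numLetters ++ (encUnary M.numSymbols ++ (encUnary M.numStates ++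
    (encList encFin M.init ++ (encList encFin M.acc ++ encList encTrans M.trans))))

/-- Code of an instance of the average stack cost problem, with all numbers in unary. -/
def StackCostInstance.encode (I : StackCostInstance) : List Bool :=
  encPDA I.pda ++ (encList encUnary (List.ofFn I.price) ++ encRat encUnary I.threshold)

/-- Code of an instance of the average letter cost problem, with letter costs and threshold in
binary. -/
def LetterCostInstance.encode (I : LetterCostInstance) : List Bool :=
  encPDA I.pda ++ (encList (encRat encBinary) (List.ofFn I.lc) ++ encRat encBinary I.threshold)

/-! The codes determine the instances. -/

/-- `e` is uniquely decodable from the front of a string. -/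
def SelfDelimiting {α : Type} (e : α → List Bool) : Prop :=
  ∀ a b s t, e a ++ s = e b ++ t → a = b ∧ s = t

theorem selfDelimiting_unary : SelfDelimiting encUnary := by
  intro a
  induction a with
  | zero => intro b s t h; cases b <;> simp_all [encUnary, List.replicate_succ]
  | succ n ih =>
    intro b s t h
    cases b with
    | zero => simp [encUnary, List.replicate_succ] at h
    | succ m =>
      have := ih m s t (by simpa [encUnary, List.replicate_succ] using h)
      simpa using this

theorem SelfDelimiting.list {α : Type} {e : α → List Bool} (he : SelfDelimiting e) :
    SelfDelimiting (encList e) := by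
  intro a
  induction a with
  | nil => intro b s t h; cases b <;> simp_all [encList]
  | cons x l ih =>
    intro b s t h
    cases b with
    | nil => simp [encList] at h
    | cons y m =>
      simp only [encList, List.cons_append, List.append_assoc, List.cons.injEq, true_and] at h
      obtain ⟨rfl, h2⟩ := he _ _ _ _ h
      obtain ⟨rfl, h3⟩ := ih _ _ _ h2
      exact ⟨rfl, h3⟩

theorem SelfDelimiting.option {α : Type} {e : α → List Bool} (he : SelfDelimiting e) :
    SelfDelimiting (encOption e) := by
  rintro (_ | x) (_ | y) s t h
  · simpa [encOption] using h
  · simp [encOption] at h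
  · simp [encOption] at h
  · simp only [encOption, List.cons_append, List.cons.injEq, true_and] at h
    obtain ⟨rfl, h2⟩ := he _ _ _ _ h
    exact ⟨rfl, h2⟩

theorem selfDelimiting_binary : SelfDelimiting encBinary := by
  intro a b s t h
  have hb : SelfDelimiting (fun b : Bool => [b]) := by
    intro a b s t h
    simpa using h
  obtain ⟨h1, h2⟩ := hb.list _ _ _ _ h
  refine ⟨?_, h2⟩
  refine Nat.eq_of_testBit_eq fun i => ?_
  rw [Nat.testBit_eq_inth, Nat.testBit_eq_inth, h1]

theorem SelfDelimiting.rat {e : ℕ → List Bool} (he : SelfDelimiting e) :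
    SelfDelimiting (encRat e) := by
  intro a b s t h
  simp only [encRat, List.cons_append, List.append_assoc, List.cons.injEq] at h
  obtain ⟨h1, h2⟩ := h
  obtain ⟨h3, h4⟩ := he _ _ _ _ h2
  obtain ⟨h5, h6⟩ := he _ _ _ _ h4
  have h7 := decide_eq_decide.mp h1
  exact ⟨Rat.ext (by omega) h5, h6⟩

theorem selfDelimiting_fin {n : ℕ} : SelfDelimiting (encFin (n := n)) := by
  intro a b s t h
  obtain ⟨h1, h2⟩ := selfDelimiting_unary _ _ _ _ h
  exact ⟨Fin.ext h1, h2⟩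

theorem selfDelimiting_trans {a g q : ℕ} :
    SelfDelimiting (encTrans (a := a) (g := g) (q := q)) := by
  rintro ⟨a1, a2, a3, a4, a5⟩ ⟨b1, b2, b3, b4, b5⟩ s t h
  simp only [encTrans, List.append_assoc] at h
  obtain ⟨rfl, h1⟩ := selfDelimiting_fin _ _ _ _ h
  obtain ⟨rfl, h2⟩ := selfDelimiting_fin _ _ _ _ h1
  obtain ⟨rfl, h3⟩ := selfDelimiting_fin.option _ _ _ _ h2
  obtain ⟨rfl, h4⟩ := selfDelimiting_fin _ _ _ _ h3
  obtain ⟨rfl, h5⟩ := selfDelimiting_fin.list _ _ _ _ h4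
  exact ⟨rfl, h5⟩

theorem selfDelimiting_PDA : SelfDelimiting encPDA := by
  rintro ⟨a1, a2, a3, a4, a5, a6⟩ ⟨b1, b2, b3, b4, b5, b6⟩ s t h
  simp only [encPDA, List.append_assoc] at h
  obtain ⟨rfl, h1⟩ := selfDelimiting_unary _ _ _ _ h
  obtain ⟨rfl, h2⟩ := selfDelimiting_unary _ _ _ _ h1
  obtain ⟨rfl, h3⟩ := selfDelimiting_unary _ _ _ _ h2
  obtain ⟨rfl, h4⟩ := selfDelimiting_fin.list _ _ _ _ h3
  obtain ⟨rfl, h5⟩ := selfDelimiting_fin.list _ _ _ _ h4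
  obtain ⟨rfl, h6⟩ := selfDelimiting_trans.list _ _ _ _ h5
  exact ⟨rfl, h6⟩

theorem StackCostInstance.encode_injective : Function.Injective StackCostInstance.encode := by
  rintro ⟨a1, a2, a3⟩ ⟨b1, b2, b3⟩ h
  simp only [StackCostInstance.encode] at h
  obtain ⟨rfl, h1⟩ := selfDelimiting_PDA _ _ _ _ h
  obtain ⟨e2, h2⟩ := selfDelimiting_unary.list _ _ _ _ h1
  obtain ⟨rfl, -⟩ := selfDelimiting_unary.rat a3 b3 [] [] (by simpa using h2)
  rw [List.ofFn_injective e2]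

theorem LetterCostInstance.encode_injective : Function.Injective LetterCostInstance.encode := by
  rintro ⟨a1, a2, a3⟩ ⟨b1, b2, b3⟩ h
  simp only [LetterCostInstance.encode] at h
  obtain ⟨rfl, h1⟩ := selfDelimiting_PDA _ _ _ _ h
  obtain ⟨e2, h2⟩ := selfDelimiting_binary.rat.list _ _ _ _ h1
  obtain ⟨rfl, -⟩ := selfDelimiting_binary.rat a3 b3 [] [] (by simpa using h2)
  rw [List.ofFn_injective e2]

/-! ### Polynomial-time reductions -/

/-- There is a polynomial-time (many-one) reduction from the decision problem `P`, with instances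
encoded by `ea`, to the decision problem `R`, with instances encoded by `eb`: a function computed
by a (multi-stack) Turing machine in polynomially many steps that preserves and reflects
positive instances. -/
def PolyTimeReducible {α β : Type} (ea : α → List Bool) (eb : β → List Bool)
    (P : α → Prop) (R : β → Prop) : Prop :=
  ∃ f : α → β, Nonempty (Turing.TM2ComputableInPolyTime ea eb f) ∧ ∀ a, P a ↔ R (f a)

end StackCost

/-!
A reduction could make the stack cost a letter cost if the stack cost took finitely many values:
an automaton can keep a number below a fixed bound in its state, and read it as a letter. So the
point is that runs of polynomially bounded stack cost suffice.

Let `Λ` exceed the threshold and let a run have average cost below `Λ` (in the limit inferior, which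
is below the limit superior). Then the cost is below `Λ` infinitely often, and these moments divide
the run into excursions, paths that cost at least `Λ` except at their ends. If the cost is very high
at a moment `t` of an excursion, then there are many nested levels around `t`: a level with base `u`
begins with the stack `u` and one more symbol, and ends when the stack is `u` for the first time
after that. Two of them agree in state and top symbol at their starts, in the state at their ends,
and in whether they contain a fixed visit to an accepting state. Replacing the outer one by the
inner one (`IsExcursion.cut`) keeps the visit, does not raise the remaining costs, and deletes only
configurations that cost at least `Λ`, which cannot raise an average below `Λ`. Cutting as long as
possible bounds the cost by `costBound`, linear in the number of types of levels
(`IsExcursion.exists_bounded`), and the shortened excursions form a run with averages that are no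
larger (`OmegaPDA.IsAcceptingRun.exists_bounded`, `Dominates.IASC_le`, `Dominates.SASC_le`).

Prices and threshold are coded in unary, so `costBound` is polynomial in the length of the code, and
`PDACode.track` gives an automaton of polynomial size whose words are sequences of stack costs of
accepting runs of the given automaton (`track_sound`), among them those of all accepting runs with
small stack costs (`track_complete`). A transition sees only the top of the stack, but its letter is
the whole stack cost; therefore `PDACode.track` has a copy of each transition for each cost of the
rest of the stack. With the letters as their own costs and the same threshold this is the reduction
(`IASCProblem_iff`, `SASCProblem_iff`).

To see that the reduction is computable in polynomial time, a small imperative language on stacks of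
bits is given a semantics with step counts (`Exec`) and compiled to Turing machines with several
stacks (`Prog.nonempty_computable`). The program `reduce` reads the code of an instance twice, once
to find the table of prices, and once to write the automaton, with numbers in unary held on stacks.
Its running time is at most a constant times the 32nd power of the length of the code
(`nonempty_computable_toLetterCost`).
-/

namespace StackCost

/-! ### Levels of the stack and the cutting of runs -/

/-- The total price of a stack content. -/
def wordCost {G : Type} (c : G → ℕ) (u : List G) : ℕ :=
  (u.map c).sum

section Cut

variable {A G Q : Type}

theorem configCost_eq_wordCost (c : G → ℕ) (C : Config A G Q) :
    configCost c C = wordCost c C.stack := rfl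

theorem wordCost_append (c : G → ℕ) (u v : List G) :
    wordCost c (u ++ v) = wordCost c u + wordCost c v := by
  simp [wordCost]

theorem wordCost_singleton (c : G → ℕ) (g : G) : wordCost c [g] = c g := by
  simp [wordCost]

theorem wordCost_nil (c : G → ℕ) : wordCost c [] = 0 := rfl

theorem wordCost_le_of_prefix (c : G → ℕ) {u v : List G} (h : u <+: v) :
    wordCost c u ≤ wordCost c v := by
  obtain ⟨r, rfl⟩ := h
  simp [wordCost_append]

/-- A step does not touch a part of the stack that lies strictly below the top. -/
theorem OmegaPDA.Step.prefix_of_lt {M : OmegaPDA A G Q} {C D : Config A G Q} (h : M.Step C D)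
    {u : List G} (hu : u <+: C.stack) (hlt : u.length < C.stack.length) : u <+: D.stack := by
  obtain ⟨a, x, y, -, -, ⟨-, h1, h2⟩ | ⟨g, us, -, h1, h2⟩⟩ := h
  · simp [h1] at hlt
  · rw [h1] at hu hlt
    rw [h2]
    have : u <+: us := by
      rw [List.prefix_concat_iff] at hu
      rcases hu with rfl | hu
      · simp at hlt
      · exact hu
    exact this.trans (List.prefix_append _ _)

/-- The part of the stack strictly below the top may be exchanged in a step. -/
theorem OmegaPDA.Step.replace_prefix {M : OmegaPDA A G Q} {C D C' D' : Config A G Q}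
    (h : M.Step C D) {u u' r : List G} (hr : r ≠ []) (hC : C.stack = u ++ r)
    (hC' : C'.stack = u' ++ r) (hs : C'.state = C.state) (hDs : D'.state = D.state)
    (hDl : D'.letter = D.letter) (hD' : D'.stack = u' ++ D.stack.drop u.length) :
    M.Step C' D' := by
  obtain ⟨a, x, y, h1, h2, ⟨h3, h4, h5⟩ | ⟨g, us, h3, h4, h5⟩⟩ := h
  · rw [h4] at hC
    exact absurd (List.append_eq_nil_iff.1 hC.symm).2 hr
  · refine ⟨a, x, y, by rw [hDl, h1], by rw [hs, hDs]; exact h2, Or.inr ?_⟩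
    obtain ⟨r', g', rfl⟩ : ∃ r' g', r = r' ++ [g'] :=
      ⟨r.dropLast, r.getLast hr, (List.dropLast_append_getLast hr).symm⟩
    rw [hC, ← List.append_assoc] at h4
    obtain ⟨rfl, h6⟩ := List.append_inj' h4 rfl
    obtain rfl : g' = g := by simpa using h6
    refine ⟨g', u' ++ r', h3, by rw [hC']; simp, ?_⟩
    rw [hD', h5]
    simp

/-- `IsLevel p s e u`: at time `s` the stack of the path `p` is `u` with one symbol on top, and
`e` is the first later time at which the stack is `u`; in between `u` stays strictly below the
top. -/
structure IsLevel (p : ℕ → Config A G Q) (s e : ℕ) (u : List G) : Prop where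
  lt : s < e
  start : ∃ x, (p s).stack = u ++ [x]
  below : ∀ i, s ≤ i → i < e → u <+: (p i).stack ∧ u.length < (p i).stack.length
  finish : (p e).stack = u

theorem IsLevel.lt_start_of_length_lt {p : ℕ → Config A G Q} {s e s' e' t : ℕ} {u u' : List G}
    (h : IsLevel p s e u) (h' : IsLevel p s' e' u') (ht : s ≤ t) (ht' : t < e')
    (hl : u.length < u'.length) : s < s' := by
  by_contra hs
  obtain ⟨x, hx⟩ := h.start
  have := (h'.below s (by omega) (by omega)).2
  rw [hx] at this
  simp at this
  omega

theorem IsLevel.finish_lt_of_length_lt {p : ℕ → Config A G Q} {s e s' e' t : ℕ} {u u' : List G}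
    (h : IsLevel p s e u) (h' : IsLevel p s' e' u') (ht : t < e) (ht' : s' ≤ t)
    (hl : u.length < u'.length) : e' < e := by
  by_contra he
  rcases Nat.lt_or_ge e e' with hlt | hge
  · have := (h'.below e (by omega) hlt).2
    rw [h.finish] at this
    omega
  · obtain rfl : e = e' := by omega
    have := h.finish
    rw [h'.finish] at this
    rw [this] at hl
    omega

/-- Data common to the paths that are shortened: a finite path of length `n` whose two ends have
cost below `Λ` and whose inner configurations have cost at least `Λ`. -/
structure IsExcursion (M : OmegaPDA A G Q) (c : G → ℕ) (Λ : ℕ) (p : ℕ → Config A G Q) (n : ℕ) :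
    Prop where
  step : ∀ i < n, M.Step (p i) (p (i + 1))
  left : configCost c (p 0) < Λ
  right : configCost c (p n) < Λ
  inner : ∀ i, 0 < i → i < n → Λ ≤ configCost c (p i)

section Levels

variable {M : OmegaPDA A G Q} {c : G → ℕ} {Λ P n : ℕ} {p : ℕ → Config A G Q}

/-- If the path stays above height `h` then the lowest `h` symbols do not change. -/
theorem prefix_of_forall_lt (hstep : ∀ i < n, M.Step (p i) (p (i + 1))) {u : List G} {i j : ℕ}
    (hij : i ≤ j) (hjn : j ≤ n) (hu : u <+: (p i).stack)
    (hl : ∀ k, i ≤ k → k < j → u.length < (p k).stack.length) : u <+: (p j).stack := by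
  induction j, hij using Nat.le_induction with
  | base => exact hu
  | succ j hij ih =>
    exact (hstep j (by omega)).prefix_of_lt
      (ih (by omega) fun k h1 h2 => hl k h1 (by omega)) (hl j hij (by omega))

/-- Every sufficiently expensive prefix of the stack at time `t` contains the base of a level
around `t`, up to one transition's worth of price. -/
theorem IsExcursion.exists_level (hp : IsExcursion M c Λ p n) (hΛ : 0 < Λ)
    (hg : ∀ g, c g ≤ P) (hy : ∀ t ∈ M.trans, wordCost c t.2.2.2.2 ≤ P)
    {t : ℕ} (htn : t ≤ n) {w : List G} (hw : w <+: (p t).stack) (hcost : Λ + P ≤ wordCost c w) :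
    ∃ s e u, IsLevel p s e u ∧ s ≤ t ∧ t < e ∧ e < n ∧ u <+: (p t).stack ∧
      wordCost c u ≤ wordCost c w ∧ wordCost c w ≤ wordCost c u + P := by
  classical
  have hex : ∃ i ≤ t, (p i).stack.length ≤ w.length := by
    by_contra hno
    push Not at hno
    have h0 : w <+: (p 0).stack := by
      obtain ⟨r, hr⟩ : (p 0).stack.take w.length <+: (p t).stack :=
        prefix_of_forall_lt hp.step (Nat.zero_le t) htn (List.take_prefix _ _) (fun k _ hk => by
          have := hno k (by omega)
          simp; omega)
      have hl := hno 0 (Nat.zero_le t)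
      have : w = (p 0).stack.take w.length := by
        refine (List.prefix_of_prefix_length_le hw ⟨r, hr⟩ (by simp; omega)).eq_of_length
          (by simp; omega)
      rw [this]
      exact List.take_prefix _ _
    have := wordCost_le_of_prefix c h0
    have := hp.left
    rw [configCost_eq_wordCost] at this
    omega
  -- `s` is the last time up to `t` at which the stack is no higher than `w`
  set s := Nat.findGreatest (fun i => (p i).stack.length ≤ w.length) t with hs
  have hst : s ≤ t := Nat.findGreatest_le t
  have hsl : (p s).stack.length ≤ w.length := by
    obtain ⟨i, hi, hi'⟩ := hex
    exact Nat.findGreatest_spec (P := fun i => (p i).stack.length ≤ w.length) hi hi'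
  have hgt : ∀ k, s < k → k ≤ t → w.length < (p k).stack.length := fun k h1 h2 => by
    have := Nat.findGreatest_is_greatest (P := fun i => (p i).stack.length ≤ w.length) h1 h2
    omega
  obtain ⟨u, x, hux, huw, hcu⟩ : ∃ u x, (p s).stack = u ++ [x] ∧ u <+: w ∧
      wordCost c w ≤ wordCost c u + P := by
    rcases hst.eq_or_lt with hst | hst
    · have hww : (p s).stack = w := by
        rw [← hst] at hw
        exact (hw.eq_of_length (by have := hw.length_le; omega)).symm
      have hne : w ≠ [] := by
        rintro rfl
        simp [wordCost_nil] at hcost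
        omega
      refine ⟨w.dropLast, w.getLast hne, ?_, List.dropLast_prefix _, ?_⟩
      · rw [hww, List.dropLast_append_getLast]
      · conv_lhs => rw [← List.dropLast_append_getLast hne]
        rw [wordCost_append, wordCost_singleton]
        have := hg (w.getLast hne)
        omega
    · have hw1 : w <+: (p (s + 1)).stack := by
        obtain ⟨r, hr⟩ : (p (s + 1)).stack.take w.length <+: (p t).stack :=
          prefix_of_forall_lt hp.step (by omega : s + 1 ≤ t) htn (List.take_prefix _ _)
            (fun k hk hk' => by
              have := hgt k (by omega) (by omega)
              simp; omega)
        have hl := hgt (s + 1) (by omega) (by omega)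
        have : w = (p (s + 1)).stack.take w.length := by
          refine (List.prefix_of_prefix_length_le hw ⟨r, hr⟩ (by simp; omega)).eq_of_length
            (by simp; omega)
        rw [this]
        exact List.take_prefix _ _
      obtain ⟨a, x, y, -, h2, ⟨-, h4, h5⟩ | ⟨g, us, -, h4, h5⟩⟩ := hp.step s (by omega)
      · have h6 := hy _ h2
        have h7 := wordCost_le_of_prefix c hw1
        rw [h5] at h7
        simp only at h6
        omega
      · have hlen : us.length ≤ w.length := by
          rw [h4] at hsl
          simp at hsl
          omega
        rw [h5] at hw1
        refine ⟨us, g, h4, List.prefix_of_prefix_length_le (List.prefix_append _ _) hw1 hlen, ?_⟩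
        have h6 := hy _ h2
        have h7 := wordCost_le_of_prefix c hw1
        rw [wordCost_append] at h7
        simp only at h6
        omega
  have hΛu : Λ ≤ wordCost c u := by omega
  have hult : u.length < w.length := by
    rw [hux] at hsl
    simp at hsl
    omega
  have hut : u <+: (p t).stack := huw.trans hw
  have hwt : w.length ≤ (p t).stack.length := hw.length_le
  have hex2 : ∃ i, t < i ∧ i ≤ n ∧ (p i).stack.length ≤ u.length := by
    by_contra hno
    push Not at hno
    have h0 : u <+: (p n).stack := prefix_of_forall_lt hp.step htn le_rfl hut (fun k hk hk' => by
      rcases hk.eq_or_lt with rfl | hk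
      · omega
      · exact hno k hk hk'.le)
    have := wordCost_le_of_prefix c h0
    have := hp.right
    rw [configCost_eq_wordCost] at this
    omega
  -- `e` is the first time after `t` at which the stack is no higher than `u`
  obtain ⟨hte, hen, hel⟩ := Nat.find_spec hex2
  have hmin := fun k => Nat.find_min hex2 (m := k)
  set e := Nat.find hex2
  have habove : ∀ i, s ≤ i → i < e → u.length < (p i).stack.length := by
    intro i h1 h2
    rcases h1.eq_or_lt with rfl | h1
    · rw [hux]; simp
    · rcases Nat.lt_or_ge t i with h3 | h3
      · have := hmin i h2
        push Not at this
        exact this h3 (by omega)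
      · have := hgt i h1 h3
        omega
  have hpre : ∀ i, s ≤ i → i ≤ e → u <+: (p i).stack := fun i h1 h2 =>
    prefix_of_forall_lt hp.step h1 (by omega) (by rw [hux]; exact List.prefix_append _ _)
      (fun k h3 h4 => habove k h3 (by omega))
  have hbase : (p e).stack = u :=
    ((hpre e (by omega) le_rfl).eq_of_length
      (by have := (hpre e (by omega) le_rfl).length_le; omega)).symm
  refine ⟨s, e, u, ⟨by omega, ⟨x, hux⟩, fun i h1 h2 => ⟨hpre i h1 h2.le, habove i h1 h2⟩, hbase⟩,
    hst, hte, ?_, hut, wordCost_le_of_prefix c huw, hcu⟩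
  rcases hen.eq_or_lt with h | h
  · exfalso
    have := hp.right
    rw [configCost_eq_wordCost, ← h, hbase] at this
    omega
  · exact h

end Levels

end Cut

section CutPath

variable {A G Q : Type} {M : OmegaPDA A G Q} {c : G → ℕ} {Λ P n : ℕ} {p : ℕ → Config A G Q}

/-- Deleting `a` consecutive summands that are all at least `Λ`. -/
theorem sum_cut {f f' : ℕ → ℕ} {k a m n : ℕ} (hn : n = m + a) (hk : k ≤ m)
    (h1 : ∀ i < k, f' i ≤ f i) (h2 : ∀ i, k ≤ i → i < m → f' i ≤ f (i + a))
    (h3 : ∀ i, k ≤ i → i < k + a → Λ ≤ f i) :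
    ∑ i ∈ Finset.range m, f' i + Λ * a ≤ ∑ i ∈ Finset.range n, f i := by
  obtain ⟨r, rfl⟩ := Nat.exists_eq_add_of_le hk
  obtain rfl : n = k + (a + r) := by omega
  rw [Finset.sum_range_add, Finset.sum_range_add _ k, Finset.sum_range_add _ a]
  have e1 : ∑ i ∈ Finset.range k, f' i ≤ ∑ i ∈ Finset.range k, f i :=
    Finset.sum_le_sum fun i hi => h1 i (Finset.mem_range.1 hi)
  have e2 : ∑ i ∈ Finset.range r, f' (k + i) ≤ ∑ i ∈ Finset.range r, f (k + (a + i)) :=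
    Finset.sum_le_sum fun i hi => by
      have := h2 (k + i) (by omega) (by have := Finset.mem_range.1 hi; omega)
      rwa [show k + i + a = k + (a + i) by omega] at this
  have e3 : Λ * a ≤ ∑ i ∈ Finset.range a, f (k + i) := by
    calc Λ * a = ∑ i ∈ Finset.range a, Λ := by simp [mul_comm]
      _ ≤ _ := Finset.sum_le_sum fun i hi =>
        h3 (k + i) (by omega) (by have := Finset.mem_range.1 hi; omega)
  omega

/-- The result of shortening the excursion `p` of length `n` to `p'` of length `n'`: the ends stay
the same, a visit to an accepting state is kept, and the deleted steps had average cost at least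
`Λ`. -/
structure Shortens (M : OmegaPDA A G Q) (c : G → ℕ) (Λ : ℕ) (p p' : ℕ → Config A G Q)
    (n n' : ℕ) : Prop where
  pos : 0 < n'
  le : n' ≤ n
  left : p' 0 = p 0
  right : p' n' = p n
  acc : (∃ m, 0 < m ∧ m ≤ n ∧ (p m).state ∈ M.acc) → ∃ m, 0 < m ∧ m ≤ n' ∧ (p' m).state ∈ M.acc
  sum : ∑ i ∈ Finset.range n', configCost c (p' i) + Λ * (n - n') ≤
    ∑ i ∈ Finset.range n, configCost c (p i)

theorem Shortens.trans {p p' p'' : ℕ → Config A G Q} {n n' n'' : ℕ}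
    (h : Shortens M c Λ p p' n n') (h' : Shortens M c Λ p' p'' n' n'') :
    Shortens M c Λ p p'' n n'' where
  pos := h'.pos
  le := h'.le.trans h.le
  left := h'.left.trans h.left
  right := h'.right.trans h.right
  acc := fun H => h'.acc (h.acc H)
  sum := by
    have e1 := h.sum
    have e2 := h'.sum
    have : n - n'' = (n - n') + (n' - n'') := by have := h.le; have := h'.le; omega
    rw [this, mul_add]
    omega

/-- Two nested levels with the same state and top at the start and the same state at the end: the
inner one can take the place of the outer one. -/
theorem IsExcursion.cut (hp : IsExcursion M c Λ p n) {s e s' e' : ℕ} {u u' : List G} {x : G}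
    (hss : s < s') (hse : s' < e') (hee : e' < e) (hen : e < n)
    (h : IsLevel p s e u) (h' : IsLevel p s' e' u') (huu : u <+: u') (hu : Λ ≤ wordCost c u)
    (hx : (p s).stack = u ++ [x]) (hx' : (p s').stack = u' ++ [x])
    (hst : (p s).state = (p s').state) (hst' : (p e).state = (p e').state)
    (hacc : (∃ m, 0 < m ∧ m ≤ n ∧ (p m).state ∈ M.acc) →
      ∃ m, 0 < m ∧ m ≤ n ∧ (p m).state ∈ M.acc ∧ (s < m ∧ m ≤ e ↔ s' < m ∧ m ≤ e')) :
    ∃ p' n', n' < n ∧ IsExcursion M c Λ p' n' ∧ Shortens M c Λ p p' n n' := by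
  obtain ⟨a, rfl⟩ := Nat.exists_eq_add_of_lt hss
  obtain ⟨l, rfl⟩ := Nat.exists_eq_add_of_lt hse
  obtain ⟨b, rfl⟩ := Nat.exists_eq_add_of_lt hee
  obtain ⟨r, rfl⟩ := Nat.exists_eq_add_of_lt hen
  -- the middle part of the path, with `u` in place of `u'`
  let q : ℕ → Config A G Q := fun i =>
    ⟨(p i).state, (p i).letter, u ++ (p i).stack.drop u'.length⟩
  let p' : ℕ → Config A G Q := fun i =>
    if i ≤ s then p i else if i ≤ s + l + 1 then q (i + (a + 1)) else p (i + (a + 1) + (b + 1))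
  have hp1 : ∀ i ≤ s, p' i = p i := fun i hi => by simp [p', hi]
  have hp2 : ∀ i, s < i → i ≤ s + l + 1 → p' i = q (i + (a + 1)) := fun i hi hi' => by
    simp [p', hi', Nat.not_le.2 hi]
  have hp3 : ∀ i, s + l + 1 < i → p' i = p (i + (a + 1) + (b + 1)) := fun i hi => by
    have h1 : ¬ i ≤ s := by omega
    have h2 : ¬ i ≤ s + l + 1 := by omega
    simp [p', h1, h2]
  have hcu : wordCost c u ≤ wordCost c u' := wordCost_le_of_prefix c huu
  have hhigh : ∀ i, s ≤ i → i ≤ s + a + 1 + l + 1 + b + 1 → Λ ≤ configCost c (p i) := by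
    intro i h1 h2
    rw [configCost_eq_wordCost]
    rcases h2.eq_or_lt with rfl | h2
    · rw [h.finish]; exact hu
    · exact hu.trans (wordCost_le_of_prefix c (h.below i h1 h2).1)
  have hs0 : 0 < s := by
    rcases Nat.eq_zero_or_pos s with rfl | h0
    · have := hhigh 0 le_rfl (by omega)
      have := hp.left
      omega
    · exact h0
  have hq : ∀ i, s + a + 1 ≤ i → i ≤ s + a + 1 + l + 1 →
      Λ ≤ configCost c (q i) ∧ configCost c (q i) ≤ configCost c (p i) := by
    intro i h1 h2
    have hpre : u' <+: (p i).stack := by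
      rcases h2.eq_or_lt with rfl | h2
      · rw [h'.finish]
      · exact (h'.below i h1 h2).1
    obtain ⟨r, hr⟩ := hpre
    have e1 : configCost c (q i) = wordCost c u + wordCost c r := by
      rw [configCost_eq_wordCost, ← wordCost_append]
      simp [q, ← hr]
    have e2 : configCost c (p i) = wordCost c u' + wordCost c r := by
      rw [configCost_eq_wordCost, ← wordCost_append, hr]
    omega
  refine ⟨p', s + l + 1 + r + 1, by omega, ⟨?_, ?_, ?_, ?_⟩, by omega, by omega, ?_, ?_, ?_, ?_⟩
  · intro i hi
    rcases Nat.lt_trichotomy i s with h1 | rfl | h1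
    · rw [hp1 i h1.le, hp1 (i + 1) h1]
      exact hp.step i (by omega)
    · rw [hp1 i le_rfl, hp2 (i + 1) (by omega) (by omega)]
      refine (hp.step (i + a + 1) (by omega)).replace_prefix (r := [x]) (by simp) hx' hx hst
        ?_ ?_ ?_
      all_goals simp only [q]; rw [show i + 1 + (a + 1) = i + a + 1 + 1 by omega]
    · rcases Nat.lt_trichotomy i (s + l + 1) with h2 | rfl | h2
      · rw [hp2 i h1 h2.le, hp2 (i + 1) (by omega) (by omega)]
        obtain ⟨⟨r', hr'⟩, hlt⟩ := h'.below (i + (a + 1)) (by omega) (by omega)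
        refine (hp.step (i + (a + 1)) (by omega)).replace_prefix (u := u') (u' := u) (r := r') ?_
          hr'.symm ?_ rfl ?_ ?_ ?_
        · rintro rfl
          rw [← hr'] at hlt
          simp at hlt
        · simp [q, ← hr']
        all_goals simp only [q]; rw [show i + 1 + (a + 1) = i + (a + 1) + 1 by omega]
      · rw [hp2 _ h1 le_rfl, hp3 _ (by omega)]
        obtain ⟨a', x', y, h3, h4, h5⟩ := hp.step (s + a + 1 + l + 1 + b + 1) (by omega)
        have hidx : s + l + 1 + 1 + (a + 1) + (b + 1) = s + a + 1 + l + 1 + b + 1 + 1 := by omega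
        rw [hidx]
        have hidx2 : s + l + 1 + (a + 1) = s + a + 1 + l + 1 := by omega
        refine ⟨a', x', y, h3, ?_, ?_⟩
        · simp only [q]; rw [hidx2, ← hst']; exact h4
        · have : (q (s + l + 1 + (a + 1))).stack = (p (s + a + 1 + l + 1 + b + 1)).stack := by
            simp only [q]; rw [hidx2, h'.finish, h.finish]; simp
          rw [this]; exact h5
      · rw [hp3 i h2, hp3 (i + 1) (by omega),
          show i + 1 + (a + 1) + (b + 1) = i + (a + 1) + (b + 1) + 1 by omega]
        exact hp.step _ (by omega)
  · rw [hp1 0 (by omega)]; exact hp.left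
  · rw [hp3 _ (by omega)]
    convert hp.right using 3
    omega
  · intro i h1 h2
    rcases Nat.lt_or_ge s i with h3 | h3
    · rcases Nat.lt_or_ge (s + l + 1) i with h4 | h4
      · rw [hp3 i h4]; exact hp.inner _ (by omega) (by omega)
      · rw [hp2 i h3 h4]; exact (hq _ (by omega) (by omega)).1
    · rw [hp1 i h3]; exact hp.inner _ (by omega) (by omega)
  · rw [hp1 0 (by omega)]
  · rw [hp3 _ (by omega)]
    congr 1
    omega
  · intro H
    obtain ⟨m, hm0, hmn, hm, hiff⟩ := hacc H
    rcases Nat.lt_or_ge s m with h1 | h1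
    · rcases Nat.lt_or_ge (s + a + 1 + l + 1 + b + 1) m with h2 | h2
      · refine ⟨m - (a + 1) - (b + 1), by omega, by omega, ?_⟩
        rw [hp3 _ (by omega), show m - (a + 1) - (b + 1) + (a + 1) + (b + 1) = m by omega]
        exact hm
      · obtain ⟨h3, h4⟩ := hiff.1 ⟨h1, h2⟩
        refine ⟨m - (a + 1), by omega, by omega, ?_⟩
        rw [hp2 _ (by omega) (by omega), show m - (a + 1) + (a + 1) = m by omega]
        exact hm
    · exact ⟨m, hm0, by omega, by rw [hp1 m h1]; exact hm⟩
  · -- first the part from `e'` to `e` is deleted, then the part from `s` to `s'`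
    have key1 := sum_cut (Λ := Λ) (f := fun i => configCost c (p i))
      (f' := fun i => if i ≤ s + a + 1 + l + 1 then configCost c (p i)
        else configCost c (p (i + (b + 1))))
      (k := s + a + 1 + l + 1 + 1) (a := b + 1) (m := s + a + 1 + l + 1 + r + 1)
      (n := s + a + 1 + l + 1 + b + 1 + r + 1)
      (by omega) (by omega) (fun i hi => by simp [Nat.lt_succ_iff.1 hi])
      (fun i hi hi' => by simp [Nat.not_le.2 hi])
      (fun i hi hi' => hhigh i (by omega) (by omega))
    have key2 := sum_cut (Λ := Λ) (f' := fun i => configCost c (p' i))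
      (f := fun i => if i ≤ s + a + 1 + l + 1 then configCost c (p i)
        else configCost c (p (i + (b + 1))))
      (k := s + 1) (a := a + 1) (m := s + l + 1 + r + 1) (n := s + a + 1 + l + 1 + r + 1)
      (by omega) (by omega)
      (fun i hi => by
        have : i ≤ s + a + 1 + l + 1 := by omega
        simp only [this, if_true]; rw [hp1 i (by omega)])
      (fun i hi hi' => by
        rcases Nat.lt_or_ge (s + l + 1) i with h4 | h4
        · have : ¬ i + (a + 1) ≤ s + a + 1 + l + 1 := by omega
          simp only [this, if_false]; rw [hp3 i h4]
        · have : i + (a + 1) ≤ s + a + 1 + l + 1 := by omega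
          simp only [this, if_true]; rw [hp2 i (by omega) h4]
          exact (hq _ (by omega) (by omega)).2)
      (fun i hi hi' => by
        have : i ≤ s + a + 1 + l + 1 := by omega
        simp only [this, if_true]
        exact hhigh i (by omega) (by omega))
    have : s + a + 1 + l + 1 + b + 1 + r + 1 - (s + l + 1 + r + 1) = (a + 1) + (b + 1) := by omega
    rw [this, mul_add]
    omega

end CutPath

/-! ### Excursions of bounded cost -/

theorem exists_prefix_wordCost {G : Type} {c : G → ℕ} {P : ℕ} (hg : ∀ g, c g ≤ P)
    (w : List G) {θ : ℕ} (h : θ ≤ wordCost c w) :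
    ∃ v, v <+: w ∧ θ ≤ wordCost c v ∧ wordCost c v ≤ θ + P := by
  induction w using List.reverseRecOn with
  | nil => exact ⟨[], List.prefix_refl _, h, by simp [wordCost_nil]⟩
  | append_singleton w g ih =>
    by_cases hw : θ ≤ wordCost c w
    · obtain ⟨v, h1, h2⟩ := ih hw
      exact ⟨v, h1.trans (List.prefix_append _ _), h2⟩
    · refine ⟨_, List.prefix_refl _, h, ?_⟩
      have := hg g
      rw [wordCost_append, wordCost_singleton]
      omega

section Bounded

variable {A G Q : Type} [Fintype G] [Fintype Q] {M : OmegaPDA A G Q} {c : G → ℕ} {Λ P n : ℕ}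
  {p : ℕ → Config A G Q}

/-- The number of possible types of a level: the state and top at its start, the state at its
end, and whether it contains a marked position. -/
def levelTypes (G Q : Type) [Fintype G] [Fintype Q] : ℕ :=
  Fintype.card (Q × G × Q × Bool)

/-- A bound on the cost of the configurations that are needed in optimal runs. -/
def costBound (G Q : Type) [Fintype G] [Fintype Q] (Λ P : ℕ) : ℕ :=
  Λ + P + levelTypes G Q * (2 * P + 1)

/-- If some cost exceeds `costBound` at time `t`, then there are more levels around `t`, with bases
of pairwise different cost, than there are types of levels, and two levels of the same type can be
cut. -/
theorem IsExcursion.exists_shorter (hp : IsExcursion M c Λ p n) (hΛ : 0 < Λ)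
    (hg : ∀ g, c g ≤ P) (hy : ∀ t ∈ M.trans, wordCost c t.2.2.2.2 ≤ P)
    {t : ℕ} (htn : t ≤ n) (ht : costBound G Q Λ P < configCost c (p t)) :
    ∃ p' n', n' < n ∧ IsExcursion M c Λ p' n' ∧ Shortens M c Λ p p' n n' := by
  classical
  have hlev : ∀ j : Fin (levelTypes G Q + 1), ∃ s e u, IsLevel p s e u ∧ s ≤ t ∧ t < e ∧ e < n ∧
      u <+: (p t).stack ∧ Λ + j * (2 * P + 1) ≤ wordCost c u ∧
      wordCost c u < Λ + (j + 1) * (2 * P + 1) := by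
    intro j
    have h1 : Λ + P + j * (2 * P + 1) ≤ wordCost c (p t).stack := by
      rw [configCost_eq_wordCost, costBound] at ht
      have : (j : ℕ) * (2 * P + 1) ≤ levelTypes G Q * (2 * P + 1) :=
        Nat.mul_le_mul_right _ (by omega)
      omega
    obtain ⟨w, hw, hw1, hw2⟩ := exists_prefix_wordCost hg _ h1
    obtain ⟨s, e, u, hl, h2, h3, h4, h5, h6, h7⟩ := hp.exists_level hΛ hg hy htn hw (by omega)
    refine ⟨s, e, u, hl, h2, h3, h4, h5, by omega, ?_⟩
    rw [add_mul]
    omega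
  choose s e u hl hs he hen hu hu1 hu2 using hlev
  choose x hx using fun j => (hl j).start
  -- the marked position is a visit to an accepting state, if there is one
  obtain ⟨m, hm⟩ : ∃ m, (∃ m, 0 < m ∧ m ≤ n ∧ (p m).state ∈ M.acc) →
      0 < m ∧ m ≤ n ∧ (p m).state ∈ M.acc := by
    by_cases h : ∃ m, 0 < m ∧ m ≤ n ∧ (p m).state ∈ M.acc
    · exact ⟨h.choose, fun _ => h.choose_spec⟩
    · exact ⟨0, fun h' => absurd h' h⟩
  obtain ⟨j, j', hne, hkey⟩ := Fintype.exists_ne_map_eq_of_card_lt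
    (fun j : Fin (levelTypes G Q + 1) =>
      (((p (s j)).state, x j, (p (e j)).state, decide (s j < m ∧ m ≤ e j)) : Q × G × Q × Bool))
    (by rw [Fintype.card_fin]; exact Nat.lt_succ_self _)
  wlog hjj : j < j' generalizing j j'
  · exact this j' j hne.symm hkey.symm (lt_of_le_of_ne (not_lt.1 hjj) hne.symm)
  simp only [Prod.mk.injEq, decide_eq_decide] at hkey
  obtain ⟨k1, k2, k3, k4⟩ := hkey
  have hcost : wordCost c (u j) < wordCost c (u j') := by
    have h1 := hu2 j
    have h2 := hu1 j'
    have : ((j : ℕ) + 1) * (2 * P + 1) ≤ j' * (2 * P + 1) :=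
      Nat.mul_le_mul_right _ (Nat.succ_le_of_lt hjj)
    omega
  have hlen : (u j).length < (u j').length := by
    by_contra hge
    have := wordCost_le_of_prefix c
      (List.prefix_of_prefix_length_le (hu j') (hu j) (not_lt.1 hge))
    omega
  refine hp.cut ((hl j).lt_start_of_length_lt (hl j') (hs j) (he j') hlen) (hl j').lt
    ((hl j).finish_lt_of_length_lt (hl j') (he j) (hs j') hlen) (hen j) (hl j) (hl j')
    (List.prefix_of_prefix_length_le (hu j) (hu j') hlen.le) ((Nat.le_add_right _ _).trans (hu1 j))
    (hx j) (by rw [k2]; exact hx j') k1 k3 fun H => ⟨m, (hm H).1, (hm H).2.1, (hm H).2.2, k4⟩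

/-- Cutting as long as possible makes every cost small. -/
theorem IsExcursion.exists_bounded (hp : IsExcursion M c Λ p n) (hn : 0 < n) (hΛ : 0 < Λ)
    (hg : ∀ g, c g ≤ P) (hy : ∀ t ∈ M.trans, wordCost c t.2.2.2.2 ≤ P) :
    ∃ p' n', IsExcursion M c Λ p' n' ∧ Shortens M c Λ p p' n n' ∧
      ∀ i ≤ n', configCost c (p' i) ≤ costBound G Q Λ P := by
  induction n using Nat.strong_induction_on generalizing p with
  | _ n ih =>
    by_cases h : ∃ t ≤ n, costBound G Q Λ P < configCost c (p t)
    · obtain ⟨t, htn, ht⟩ := h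
      obtain ⟨p', n', h1, h2, h3⟩ := hp.exists_shorter hΛ hg hy htn ht
      obtain ⟨p'', n'', h4, h5, h6⟩ := ih n' h1 h2 h3.pos
      exact ⟨p'', n'', h4, h3.trans h5, h6⟩
    · push Not at h
      exact ⟨p, n, hp, ⟨hn, le_rfl, rfl, rfl, id, by simp⟩, h⟩

end Bounded

/-! ### Concatenation of shortened excursions -/

theorem exists_mem_block {t : ℕ → ℕ} (ht : StrictMono t) (h0 : t 0 = 0) (m : ℕ) :
    ∃ n, t n ≤ m ∧ m < t (n + 1) := by
  induction m with
  | zero => exact ⟨0, h0.le, by have := ht (Nat.lt_add_one 0); omega⟩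
  | succ m ih =>
    obtain ⟨n, h1, h2⟩ := ih
    rcases (Nat.succ_le_of_lt h2).eq_or_lt with h | h
    · exact ⟨n + 1, h.ge, h.trans_lt (ht (Nat.lt_add_one _))⟩
    · exact ⟨n, by omega, h⟩

theorem exists_mem_block_right {t : ℕ → ℕ} (ht : StrictMono t) (h0 : t 0 = 0) {m : ℕ}
    (hm : 0 < m) : ∃ n, t n < m ∧ m ≤ t (n + 1) := by
  obtain ⟨n, h1, h2⟩ := exists_mem_block ht h0 (m - 1)
  exact ⟨n, by omega, by omega⟩

/-- Finite sequences `q n` of length `t (n + 1) - t n` whose ends match can be concatenated. -/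
theorem exists_concat {α : Type} {t : ℕ → ℕ} (ht : StrictMono t) (h0 : t 0 = 0) (q : ℕ → ℕ → α)
    (hq : ∀ n, q n (t (n + 1) - t n) = q (n + 1) 0) :
    ∃ π : ℕ → α, ∀ n j, j ≤ t (n + 1) - t n → π (t n + j) = q n j := by
  choose N hN1 hN2 using exists_mem_block ht h0
  have key : ∀ n j, j < t (n + 1) - t n → q (N (t n + j)) (t n + j - t (N (t n + j))) = q n j := by
    intro n j hj
    have h1 : N (t n + j) < n + 1 := ht.lt_iff_lt.1 ((hN1 (t n + j)).trans_lt (by omega))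
    have h2 : n < N (t n + j) + 1 :=
      ht.lt_iff_lt.1 ((Nat.le_add_right _ j).trans_lt (hN2 (t n + j)))
    have h3 : N (t n + j) = n := by omega
    rw [h3, Nat.add_sub_cancel_left]
  refine ⟨fun k => q (N k) (k - t (N k)), fun n j hj => ?_⟩
  rcases hj.eq_or_lt with rfl | hj
  · have h1 := ht (Nat.lt_add_one n)
    have h2 := key (n + 1) 0 (by have := ht (Nat.lt_add_one (n + 1)); omega)
    rw [hq, ← h2]
    simp only [Nat.add_zero, Nat.add_sub_cancel' h1.le]
  · exact key n j hj

section Runs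

variable {A G Q : Type}

/-- `Dominates c Λ π π' t t'`: the times `t n` cut `π` and the times `t' n` cut `π'` into blocks
whose ends agree and whose inner configurations have cost at least `Λ`, and up to `t' n` the run
`π'` arises from `π` by making configurations cheaper and deleting some of average cost at least
`Λ`. -/
structure Dominates (c : G → ℕ) (Λ : ℕ) (π π' : ℕ → Config A G Q) (t t' : ℕ → ℕ) : Prop where
  mono : StrictMono t
  mono' : StrictMono t'
  zero : t 0 = 0
  zero' : t' 0 = 0
  high : ∀ n i, t n < i → i < t (n + 1) → Λ ≤ configCost c (π i)
  high' : ∀ n i, t' n < i → i < t' (n + 1) → Λ ≤ configCost c (π' i)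
  eq : ∀ n, π' (t' n) = π (t n)
  le : ∀ n, t' n ≤ t n
  sum : ∀ n, ∑ i ∈ Finset.range (t' n), configCost c (π' i) + Λ * (t n - t' n) ≤
    ∑ i ∈ Finset.range (t n), configCost c (π i)

/-- An accepting run with infinitely many configurations of cost below `Λ` is dominated by an
accepting run with bounded cost. -/
theorem OmegaPDA.IsAcceptingRun.exists_bounded [Fintype G] [Fintype Q] {M : OmegaPDA A G Q}
    {c : G → ℕ} {Λ P : ℕ} (hΛ : 0 < Λ) (hg : ∀ g, c g ≤ P)
    (hy : ∀ t ∈ M.trans, wordCost c t.2.2.2.2 ≤ P) {π : ℕ → Config A G Q}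
    (hπ : M.IsAcceptingRun π) (hlow : ∃ᶠ i in atTop, configCost c (π i) < Λ) :
    ∃ π' t t', M.IsAcceptingRun π' ∧ (∀ i, configCost c (π' i) ≤ costBound G Q Λ P) ∧
      Dominates c Λ π π' t t' := by
  classical
  -- `t n` is the `n`-th time at which the cost is below `Λ`
  have hinf : {i | configCost c (π i) < Λ}.Infinite := Nat.frequently_atTop_iff_infinite.1 hlow
  set t := Nat.nth (fun i => configCost c (π i) < Λ) with ht
  have hmono : StrictMono t := Nat.nth_strictMono hinf
  have hlt : ∀ n, configCost c (π (t n)) < Λ := Nat.nth_mem_of_infinite hinf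
  have hzero : t 0 = 0 := Nat.nth_zero_of_zero (by
    simp [configCost, hπ.1.init_stack, hΛ])
  have hhigh : ∀ n i, t n < i → i < t (n + 1) → Λ ≤ configCost c (π i) := by
    intro n i h1 h2
    by_contra h
    exact absurd (Nat.le_nth_of_lt_nth_succ h2 (not_le.1 h)) (not_le.2 h1)
  have hex : ∀ n, IsExcursion M c Λ (fun i => π (t n + i)) (t (n + 1) - t n) := fun n => by
    have hn := hmono (Nat.lt_add_one n)
    exact ⟨fun i _ => hπ.1.step _, hlt n, by
      simpa only [Nat.add_sub_cancel' hn.le] using hlt (n + 1),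
      fun i h1 h2 => hhigh n _ (by omega) (by omega)⟩
  choose q l hq hs hb using fun n => (hex n).exists_bounded
    (by have := hmono (Nat.lt_add_one n); omega) hΛ hg hy
  set t' : ℕ → ℕ := fun n => ∑ i ∈ Finset.range n, l i with ht'
  have hsucc : ∀ n, t' (n + 1) = t' n + l n := fun n => Finset.sum_range_succ _ _
  have hmono' : StrictMono t' := strictMono_nat_of_lt_succ fun n => by
    have := (hs n).pos
    rw [hsucc]; omega
  have hzero' : t' 0 = 0 := rfl
  have hsub : ∀ n, t' (n + 1) - t' n = l n := fun n => by rw [hsucc]; omega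
  have hq0 : ∀ n, q n 0 = π (t n) := fun n => (hs n).left
  have hql : ∀ n, q n (l n) = π (t (n + 1)) := fun n => by
    have hn := hmono (Nat.lt_add_one n)
    simpa only [Nat.add_sub_cancel' hn.le] using (hs n).right
  obtain ⟨π', hπ'⟩ := exists_concat hmono' hzero' q (fun n => by rw [hsub, hql, hq0])
  replace hπ' : ∀ n j, j ≤ l n → π' (t' n + j) = q n j := fun n j hj =>
    hπ' n j (by rw [hsub]; exact hj)
  have heq : ∀ n, π' (t' n) = π (t n) := fun n => by
    rw [← hq0]; exact hπ' n 0 (Nat.zero_le _)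
  have hsplit : ∀ k, ∃ n j, j < l n ∧ k = t' n + j := fun k => by
    obtain ⟨n, h1, h2⟩ := exists_mem_block hmono' hzero' k
    rw [hsucc] at h2
    exact ⟨n, k - t' n, by omega, by omega⟩
  have h00 : π' 0 = π 0 := by
    have := heq 0
    rwa [hzero, hzero'] at this
  refine ⟨π', t, t', ⟨⟨?_, ?_, ?_, ?_⟩, ?_⟩, ?_, hmono, hmono', hzero, hzero', hhigh, ?_,
    heq, ?_, ?_⟩
  · rw [h00]; exact hπ.1.init_state
  · rw [h00]; exact hπ.1.init_letter
  · rw [h00]; exact hπ.1.init_stack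
  · intro k
    obtain ⟨n, j, hj, rfl⟩ := hsplit k
    rw [hπ' n j hj.le, add_assoc, hπ' n (j + 1) hj]
    exact (hq n).step j hj
  · rw [frequently_atTop]
    intro N
    obtain ⟨m, hm, hacc⟩ := frequently_atTop.1 hπ.2 (t N + 1)
    obtain ⟨n, h1, h2⟩ := exists_mem_block_right hmono hzero (m := m) (by omega)
    have hNn : N < n + 1 := hmono.lt_iff_lt.1 (by omega)
    obtain ⟨m', h3, h4, h5⟩ := (hs n).acc ⟨m - t n, by omega, by omega, by
      rw [Nat.add_sub_cancel' h1.le]; exact hacc⟩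
    refine ⟨t' n + m', ?_, by rw [hπ' n m' h4]; exact h5⟩
    have := hmono'.id_le n
    simp only [id] at this
    omega
  · intro k
    obtain ⟨n, j, hj, rfl⟩ := hsplit k
    rw [hπ' n j hj.le]
    exact hb n j hj.le
  · intro n i h1 h2
    rw [hsucc] at h2
    have := (hq n).inner (i - t' n) (by omega) (by omega)
    rwa [← hπ' n _ (by omega), Nat.add_sub_cancel' h1.le] at this
  · intro n
    induction n with
    | zero => rw [hzero, hzero']
    | succ n ih =>
      have h1 := (hs n).le
      have h2 := hmono (Nat.lt_add_one n)
      rw [hsucc]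
      omega
  · intro n
    induction n with
    | zero => rw [hzero, hzero']; simp
    | succ n ih =>
      have h1 := (hs n).le
      have h2 := hmono (Nat.lt_add_one n)
      have h3 := (hs n).sum
      have hle : t' n ≤ t n := by
        clear ih h1 h2 h3
        induction n with
        | zero => rw [hzero, hzero']
        | succ n ih =>
          have h1 := (hs n).le
          have h2 := hmono (Nat.lt_add_one n)
          rw [hsucc]
          omega
      obtain ⟨d, hd⟩ := Nat.exists_eq_add_of_lt h2
      rw [hsucc, hd]
      rw [hd, show t n + d + 1 - t n = d + 1 by omega] at h1 h3
      rw [add_assoc (t n), Finset.sum_range_add, Finset.sum_range_add,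
        Finset.sum_congr rfl (fun j hj => by rw [hπ' n j (Finset.mem_range.1 hj).le] :
          ∀ j ∈ Finset.range (l n), configCost c (π' (t' n + j)) = configCost c (q n j)),
        show t n + (d + 1) - (t' n + l n) = (t n - t' n) + (d + 1 - l n) by omega, mul_add]
      omega

/-! ### Averages along dominated runs -/

variable {c : G → ℕ} {Λ : ℕ} {π π' : ℕ → Config A G Q} {t t' : ℕ → ℕ}

theorem ASC_lt_iff {k : ℕ} (hk : 0 < k) {x : ℝ} :
    ASC c π k < x ↔ ∑ i ∈ Finset.range k, (configCost c (π i) : ℝ) < x * k := by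
  have : (0 : ℝ) < k := by exact_mod_cast hk
  rw [ASC, one_div, inv_mul_lt_iff₀ this, mul_comm]

theorem sum_add_le_of_high {x : ℝ} (hx : x ≤ Λ) {j k : ℕ} (hjk : j ≤ k)
    (h : ∀ i, j ≤ i → i < k → Λ ≤ configCost c (π i)) :
    ∑ i ∈ Finset.range j, (configCost c (π i) : ℝ) + x * (k - j) ≤
      ∑ i ∈ Finset.range k, (configCost c (π i) : ℝ) := by
  induction k, hjk using Nat.le_induction with
  | base => simp
  | succ k hjk ih =>
    have h1 := ih fun i h1 h2 => h i h1 (by omega)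
    have h2 : (Λ : ℝ) ≤ configCost c (π k) := by exact_mod_cast h k hjk (by omega)
    rw [Finset.sum_range_succ]
    push_cast
    linarith

theorem Dominates.sum_le (h : Dominates c Λ π π' t t') {x : ℝ} (hx : x ≤ Λ) (n : ℕ) :
    ∑ i ∈ Finset.range (t' n), (configCost c (π' i) : ℝ) + x * (t n - t' n) ≤
      ∑ i ∈ Finset.range (t n), (configCost c (π i) : ℝ) := by
  have h1 := h.sum n
  have h2 := h.le n
  have h3 : (∑ i ∈ Finset.range (t' n), (configCost c (π' i) : ℝ)) + Λ * (t n - t' n : ℝ) ≤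
      ∑ i ∈ Finset.range (t n), (configCost c (π i) : ℝ) := by
    rw [← Nat.cast_sub h2]
    exact_mod_cast h1
  have h4 : (t' n : ℝ) ≤ t n := by exact_mod_cast h2
  nlinarith

/-- To bound an extended real by `a < L`, it is enough to compare it with reals below `L`. -/
theorem EReal_le_of_forall_lt {a b : EReal} {L : ℝ} (ha : a < (L : EReal))
    (h : ∀ x : ℝ, x ≤ L → a < (x : EReal) → b ≤ x) : b ≤ a := by
  refine EReal.le_of_forall_lt_iff_le.1 fun x hx => ?_
  rcases le_total x L with hxL | hxL
  · exact h x hxL hx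
  · exact (h L le_rfl ha).trans (by exact_mod_cast hxL)

theorem frequently_ASC_lt {x : ℝ} (h : IASC c π < (x : EReal)) : ∃ᶠ k in atTop, ASC c π k < x :=
  (frequently_lt_of_liminf_lt (by isBoundedDefault) h).mono fun k hk => by exact_mod_cast hk

/-- A run of low average cost has infinitely many cheap configurations. -/
theorem frequently_low (hΛ : IASC c π < ((Λ : ℝ) : EReal)) :
    ∃ᶠ i in atTop, configCost c (π i) < Λ := by
  obtain ⟨x, hx1, hx2⟩ := EReal.lt_iff_exists_real_btwn.1 hΛ
  replace hx2 : x < Λ := by exact_mod_cast hx2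
  by_contra hno
  rw [not_frequently] at hno
  obtain ⟨N, hN⟩ := eventually_atTop.1 hno
  obtain ⟨R, hR⟩ := exists_nat_gt (Λ * N / (Λ - x))
  obtain ⟨k, hk, hlt⟩ := frequently_atTop.1 (frequently_ASC_lt hx1) (N + R + 1)
  rw [ASC_lt_iff (by omega)] at hlt
  have h1 := sum_add_le_of_high (c := c) (π := π) (x := Λ) le_rfl (by omega : N ≤ k)
    fun i h1 _ => not_lt.1 (hN i h1)
  have h2 : (0 : ℝ) ≤ ∑ i ∈ Finset.range N, (configCost c (π i) : ℝ) :=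
    Finset.sum_nonneg fun _ _ => Nat.cast_nonneg _
  rw [div_lt_iff₀ (by linarith)] at hR
  have h3 : (R : ℝ) ≤ k := by exact_mod_cast (by omega : R ≤ k)
  nlinarith

/-- The average up to a time between `t n` and `t (n + 1)` is compared with that up to `t n`: the
configurations in between are expensive. -/
theorem Dominates.IASC_le (h : Dominates c Λ π π' t t') (hΛ : IASC c π < ((Λ : ℝ) : EReal)) :
    IASC c π' ≤ IASC c π := by
  refine EReal_le_of_forall_lt hΛ fun x hxΛ hx => liminf_le_of_frequently_le' ?_
  rw [frequently_atTop]
  intro N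
  obtain ⟨k, hk, hlt⟩ := frequently_atTop.1 (frequently_ASC_lt hx) (t N + 1)
  rw [ASC_lt_iff (by omega)] at hlt
  obtain ⟨n, h1, h2⟩ := exists_mem_block_right h.mono h.zero (m := k) (by omega)
  have hNn : N < n + 1 := h.mono.lt_iff_lt.1 (by omega)
  -- since the configurations from `t n + 1` to `k` cost at least `Λ`, the average up to `t n` is
  -- below `x` as well
  have h3 := sum_add_le_of_high (π := π) hxΛ (by omega : t n + 1 ≤ k)
    fun i hi hi' => h.high n i (by omega) (by omega)
  have h4 := h.sum_le hxΛ n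
  refine ⟨t' n + 1, ?_, ?_⟩
  · have := h.mono'.id_le n
    simp only [id] at this
    omega
  · refine le_of_lt (EReal.coe_lt_coe_iff.2 ((ASC_lt_iff (by omega)).2 ?_))
    rw [Finset.sum_range_succ] at h3 ⊢
    rw [h.eq]
    push_cast at h3 ⊢
    linarith

/-- The average up to a time between `t' n` and `t' (n + 1)` is compared with that up to
`t' (n + 1)`: the configurations in between are expensive. -/
theorem Dominates.SASC_le (h : Dominates c Λ π π' t t') (hΛ : SASC c π < ((Λ : ℝ) : EReal)) :
    SASC c π' ≤ SASC c π := by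
  refine EReal_le_of_forall_lt hΛ fun x hxΛ hx => limsup_le_of_le (by isBoundedDefault) ?_
  obtain ⟨N, hN⟩ := eventually_atTop.1 (eventually_lt_of_limsup_lt hx)
  rw [eventually_atTop]
  refine ⟨t' N + 1, fun k hk => ?_⟩
  obtain ⟨n, h1, h2⟩ := exists_mem_block_right h.mono' h.zero' (m := k) (by omega)
  have hNn : N < n + 1 := h.mono'.lt_iff_lt.1 (by omega)
  have hid := h.mono.id_le (n + 1)
  simp only [id] at hid
  have hlt : ASC c π (t (n + 1)) < x := by exact_mod_cast hN (t (n + 1)) (by omega)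
  rw [ASC_lt_iff (by omega)] at hlt
  -- since the configurations from `k` to `t' (n + 1)` cost at least `Λ`, the average up to `k` is
  -- below `x` as well
  have h3 := sum_add_le_of_high (π := π') hxΛ h2
    fun i hi hi' => h.high' n i (by omega) (by omega)
  have h4 := h.sum_le hxΛ (n + 1)
  refine le_of_lt (EReal.coe_lt_coe_iff.2 ((ASC_lt_iff (by omega)).2 ?_))
  linarith

theorem IASC_le_SASC : IASC c π ≤ SASC c π :=
  liminf_le_limsup

end Runs

/-! ### The automaton that reads its own stack cost -/

/-- The residue of `n` as an element of `Fin W`. -/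
def clip {W : ℕ} (hW : 0 < W) (n : ℕ) : Fin W :=
  ⟨n % W, Nat.mod_lt _ hW⟩

theorem val_clip {W : ℕ} (hW : 0 < W) {n : ℕ} (h : n < W) : (clip hW n : ℕ) = n :=
  Nat.mod_eq_of_lt h

/-- The price of the top of the stack, where `⊥` is free. -/
def topCost {G : Type} (c : G → ℕ) (x : Option G) : ℕ :=
  x.elim 0 c

/-- The state `(q, n)` that remembers the stack cost `n`. -/
def costState {nQ W : ℕ} (hW : 0 < W) (q : Fin nQ) (n : ℕ) : Fin (nQ * W) :=
  finProdFinEquiv (q, clip hW n)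

theorem val_costState {nQ W : ℕ} (hW : 0 < W) (q : Fin nQ) {n : ℕ} (h : n < W) :
    (costState hW q n : ℕ) = q * W + n := by
  simp only [costState, finProdFinEquiv_apply_val, val_clip hW h]
  ring

/-- The transition of the cost-tracking automaton over the transition `t` that is taken when the
stack below the top has cost `d`. Its letter is the stack cost before the transition. -/
def costTransition {nL nS nQ W : ℕ} (hW : 0 < W) (c : Fin nS → ℕ)
    (t : Fin nQ × Fin nL × Option (Fin nS) × Fin nQ × List (Fin nS)) (d : ℕ) :
    Fin (nQ * W) × Fin W × Option (Fin nS) × Fin (nQ * W) × List (Fin nS) :=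
  (costState hW t.1 (topCost c t.2.2.1 + d), clip hW (topCost c t.2.2.1 + d), t.2.2.1,
    costState hW t.2.2.2.1 (wordCost c t.2.2.2.2 + d), t.2.2.2.2)

/-- The automaton that simulates `M` while the cost of the stack below the top stays below `D`.
It keeps the stack cost in its state and reads it as a letter. -/
def PDACode.track (M : PDACode) (c : Fin M.numSymbols → ℕ) (D : ℕ) {W : ℕ} (hW : 0 < W) :
    PDACode where
  numLetters := W
  numSymbols := M.numSymbols
  numStates := M.numStates * W
  init := M.init.map fun q => costState hW q 0
  acc := M.acc.flatMap fun q => (List.range W).map fun n => costState hW q n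
  trans := M.trans.flatMap fun t => (List.range D).map fun d => costTransition hW c t d

/-- The automaton presented by `PDACode.track`, with its alphabets in explicit form. -/
def PDACode.trackPDA (M : PDACode) (c : Fin M.numSymbols → ℕ) (D : ℕ) {W : ℕ} (hW : 0 < W) :
    OmegaPDA (Fin W) (Fin M.numSymbols) (Fin (M.numStates * W)) :=
  (M.track c D hW).toPDA

section Track

variable {M : PDACode} {c : Fin M.numSymbols → ℕ} {D W : ℕ} {hW : 0 < W}

theorem mem_track_trans {s : Fin (M.numStates * W) × Fin W × Option (Fin M.numSymbols) ×
      Fin (M.numStates * W) × List (Fin M.numSymbols)} :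
    s ∈ (M.trackPDA c D hW).trans ↔ ∃ t ∈ M.trans, ∃ d < D, costTransition hW c t d = s :=
  List.mem_toFinset.trans
    (by simp only [PDACode.track, List.mem_flatMap, List.mem_map, List.mem_range])

theorem mem_track_acc {s : Fin (M.numStates * W)} :
    s ∈ (M.trackPDA c D hW).acc ↔ ∃ q ∈ M.acc, ∃ n < W, costState hW q n = s :=
  List.mem_toFinset.trans
    (by simp only [PDACode.track, List.mem_flatMap, List.mem_map, List.mem_range])

theorem mem_track_init {s : Fin (M.numStates * W)} :
    s ∈ (M.trackPDA c D hW).init ↔ ∃ q ∈ M.init, costState hW q 0 = s :=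
  List.mem_toFinset.trans (by simp only [PDACode.track, List.mem_map])

theorem costState_symm (q : Fin M.numStates) (n : ℕ) :
    finProdFinEquiv.symm (costState hW q n) = (q, clip hW n) := by
  simp [costState]

/-- Every word read by the cost-tracking automaton lists the stack costs of an accepting run. -/
theorem track_sound (hx : ∀ t ∈ M.trans, topCost c t.2.2.1 + D ≤ W)
    (hy : ∀ t ∈ M.trans, wordCost c t.2.2.2.2 + D ≤ W) {w : ℕ → Fin W}
    (hw : w ∈ (M.trackPDA c D hW).language) :
    ∃ π, M.toPDA.IsAcceptingRun π ∧ ∀ i, (w i : ℕ) = configCost c (π i) := by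
  obtain ⟨ρ, ⟨⟨h0, -, h2, h3⟩, hacc⟩, hgives⟩ := hw
  have hstep : ∀ i, ∃ t ∈ M.trans, ∃ d < D,
      (ρ i).state = costState hW t.1 (topCost c t.2.2.1 + d) ∧
      w i = clip hW (topCost c t.2.2.1 + d) ∧
      (ρ (i + 1)).state = costState hW t.2.2.2.1 (wordCost c t.2.2.2.2 + d) ∧
      ((t.2.2.1 = none ∧ (ρ i).stack = [] ∧ (ρ (i + 1)).stack = t.2.2.2.2) ∨
        ∃ g us, t.2.2.1 = some g ∧ (ρ i).stack = us ++ [g] ∧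
          (ρ (i + 1)).stack = us ++ t.2.2.2.2) := by
    intro i
    obtain ⟨a, x, y, h4, h5, h6⟩ := h3 i
    obtain ⟨t, ht, d, hd, heq⟩ := mem_track_trans.1 h5
    have hl := (hgives i).symm.trans h4
    simp only [costTransition, Prod.mk.injEq] at heq
    obtain ⟨e1, e2, rfl, e4, rfl⟩ := heq
    exact ⟨t, ht, d, hd, e1.symm, by rw [e2]; exact Option.some.inj hl, e4.symm, h6⟩
  choose t ht d hd hs hl hs' hst using hstep
  -- the number in the state is the stack cost
  have hinv : ∀ i, ((finProdFinEquiv.symm (ρ i).state).2 : ℕ) = wordCost c (ρ i).stack ∧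
      topCost c (t i).2.2.1 + d i = wordCost c (ρ i).stack := by
    intro i
    have hval : ∀ i, ((finProdFinEquiv.symm (ρ i).state).2 : ℕ) = topCost c (t i).2.2.1 + d i := by
      intro i
      rw [hs i, costState_symm, val_clip]
      have := hx _ (ht i); have := hd i; omega
    induction i with
    | zero =>
      obtain ⟨q, -, hq⟩ := mem_track_init.1 h0
      have : ((finProdFinEquiv.symm (ρ 0).state).2 : ℕ) = wordCost c (ρ 0).stack := by
        rw [← hq, costState_symm, val_clip hW hW, h2, wordCost_nil]
      exact ⟨this, by rw [← hval]; exact this⟩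
    | succ i ih =>
      have : ((finProdFinEquiv.symm (ρ (i + 1)).state).2 : ℕ) = wordCost c (ρ (i + 1)).stack := by
        rw [hs' i, costState_symm, val_clip hW (by have := hy _ (ht i); have := hd i; omega)]
        have h7 := ih.2
        rcases hst i with ⟨h4, h5, h6⟩ | ⟨g, us, h4, h5, h6⟩
        · rw [h4, h5] at h7
          simp [topCost, wordCost_nil] at h7
          rw [h6, h7, Nat.add_zero]
        · rw [h4, h5, wordCost_append, wordCost_singleton] at h7
          simp [topCost] at h7
          rw [h6, wordCost_append]
          omega
      exact ⟨this, by rw [← hval]; exact this⟩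
  have hstate : ∀ i, (finProdFinEquiv.symm (ρ i).state).1 = (t i).1 := fun i => by
    rw [hs i, costState_symm]
  have hstate' : ∀ i, (finProdFinEquiv.symm (ρ (i + 1)).state).1 = (t i).2.2.2.1 := fun i => by
    rw [hs' i, costState_symm]
  refine ⟨fun i => ⟨(finProdFinEquiv.symm (ρ i).state).1,
    Nat.casesOn i none (fun j => some (t j).2.1), (ρ i).stack⟩,
    ⟨⟨?_, rfl, h2, fun i => ⟨(t i).2.1, (t i).2.2.1, (t i).2.2.2.2, rfl, ?_, hst i⟩⟩, ?_⟩, ?_⟩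
  · obtain ⟨q, hq, hq'⟩ := mem_track_init.1 h0
    simp only
    rw [← hq', costState_symm]
    simpa [PDACode.toPDA] using hq
  · simp only [PDACode.toPDA, List.mem_toFinset]
    rw [hstate, hstate']
    exact ht i
  · refine hacc.mono fun i hi => ?_
    obtain ⟨q, hq, n, -, hq'⟩ := mem_track_acc.1 hi
    simp only
    rw [← hq', costState_symm]
    simpa [PDACode.toPDA] using hq
  · intro i
    rw [hl i, val_clip hW (by have := hx _ (ht i); have := hd i; omega), (hinv i).2]
    rfl

/-- The stack costs of an accepting run of small cost form a word read by the cost-tracking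
automaton. -/
theorem track_complete (hDW : D ≤ W) {π : ℕ → Config (Fin M.numLetters) (Fin M.numSymbols)
      (Fin M.numStates)} (hπ : M.toPDA.IsAcceptingRun π) (hcost : ∀ i, configCost c (π i) < D) :
    ∃ w ∈ (M.trackPDA c D hW).language, ∀ i, (w i : ℕ) = configCost c (π i) := by
  obtain ⟨⟨h0, h1, h2, h3⟩, hacc⟩ := hπ
  have hlt : ∀ i, configCost c (π i) < W := fun i => (hcost i).trans_le hDW
  refine ⟨fun i => clip hW (configCost c (π i)),
    ⟨fun i => ⟨costState hW (π i).state (configCost c (π i)),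
      Nat.casesOn i none (fun j => some (clip hW (configCost c (π j)))), (π i).stack⟩,
      ⟨⟨?_, rfl, h2, fun i => ?_⟩, ?_⟩, fun i => rfl⟩, fun i => val_clip hW (hlt i)⟩
  · refine mem_track_init.2 ⟨(π 0).state, by simpa [PDACode.toPDA] using h0, ?_⟩
    simp only
    rw [configCost_eq_wordCost, h2, wordCost_nil]
  · obtain ⟨a, x, y, h4, h5, h6⟩ := h3 i
    refine ⟨_, x, y, rfl, mem_track_trans.2 ⟨(_, a, x, _, y),
      by simpa [PDACode.toPDA] using h5, ?_⟩, h6⟩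
    have hci := hcost i
    rw [configCost_eq_wordCost] at hci
    rcases h6 with ⟨rfl, h7, h8⟩ | ⟨g, us, rfl, h7, h8⟩
    · refine ⟨0, by omega, ?_⟩
      simp only [costTransition, configCost_eq_wordCost]
      rw [h7, h8, wordCost_nil]
      rfl
    · rw [h7, wordCost_append] at hci
      refine ⟨wordCost c us, by omega, ?_⟩
      simp only [costTransition, configCost_eq_wordCost]
      rw [h7, h8, wordCost_append, wordCost_append, wordCost_singleton, add_comm (wordCost c us),
        add_comm (wordCost c us)]
      rfl
  · refine hacc.mono fun i hi => mem_track_acc.2 ⟨(π i).state, ?_, _, hlt i, rfl⟩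
    simpa [PDACode.toPDA] using hi

end Track

/-! ### The reduction -/

/-- The cost of the stack below the top that the reduction allows for. The bound `costBound` on the
costs of optimal runs is of the order of the fifth power of the length of the code. -/
def StackCostInstance.depth (I : StackCostInstance) : ℕ :=
  I.encode.length ^ 6

/-- The number of stack costs that the reduction distinguishes; it leaves room for the price of a
pushed word above a stack of cost less than `depth`. -/
def StackCostInstance.width (I : StackCostInstance) : ℕ :=
  I.encode.length ^ 7

section Size

variable (I : StackCostInstance)

theorem length_encUnary (n : ℕ) : (encUnary n).length = n + 1 := by
  simp [encUnary]

theorem length_le_length_encList {α : Type} (e : α → List Bool) (l : List α) :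
    l.length < (encList e l).length := by
  induction l with
  | nil => simp [encList]
  | cons a l ih => simp [encList]; omega

theorem length_lt_length_encList_of_mem {α : Type} (e : α → List Bool) {l : List α} {a : α}
    (h : a ∈ l) : (e a).length < (encList e l).length := by
  induction l with
  | nil => simp at h
  | cons b l ih =>
    rcases List.mem_cons.1 h with rfl | h
    · simp [encList]
    · have := ih h
      simp [encList]; omega

theorem StackCostInstance.length_encode : I.encode.length =
    (encUnary I.pda.numLetters).length + (encUnary I.pda.numSymbols).length +
    (encUnary I.pda.numStates).length + (encList encFin I.pda.init).length +
    (encList encFin I.pda.acc).length + (encList encTrans I.pda.trans).length +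
    (encList encUnary (List.ofFn I.price)).length + (1 + (encUnary I.threshold.num.natAbs).length +
    (encUnary I.threshold.den).length) := by
  simp only [encode, encPDA, encRat, List.length_append, List.length_cons]
  omega

theorem StackCostInstance.size_bounds : I.pda.numSymbols + I.pda.numStates +
    I.threshold.num.natAbs + 10 ≤ I.encode.length := by
  have := I.length_encode
  have h1 := length_le_length_encList encFin I.pda.init
  have h2 := length_le_length_encList encFin I.pda.acc
  have h3 := length_le_length_encList encTrans I.pda.trans
  have h4 := length_le_length_encList encUnary (List.ofFn I.price)
  simp only [length_encUnary] at this
  have := I.threshold.den_pos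
  omega

theorem StackCostInstance.price_le (g : Fin I.pda.numSymbols) : I.price g ≤ I.encode.length := by
  have h1 := I.length_encode
  have h2 := length_lt_length_encList_of_mem encUnary (List.mem_ofFn.2 ⟨g, rfl⟩ :
    I.price g ∈ List.ofFn I.price)
  rw [length_encUnary] at h2
  omega

theorem wordCost_le_mul {G : Type} {c : G → ℕ} {b : ℕ} (hc : ∀ g, c g ≤ b) (u : List G) :
    wordCost c u ≤ u.length * b := by
  induction u with
  | nil => simp [wordCost]
  | cons g u ih =>
    have := hc g
    simp only [wordCost, List.map_cons, List.sum_cons, List.length_cons] at ih ⊢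
    rw [add_mul]
    omega

theorem StackCostInstance.wordCost_le {t} (ht : t ∈ I.pda.trans) :
    wordCost I.price t.2.2.2.2 ≤ I.encode.length ^ 2 := by
  refine (wordCost_le_mul I.price_le _).trans ?_
  rw [sq]
  refine Nat.mul_le_mul_right _ ?_
  have h1 := I.length_encode
  have h2 := length_lt_length_encList_of_mem encTrans ht
  have h3 := length_le_length_encList encFin t.2.2.2.2
  simp only [encTrans, List.length_append] at h2
  omega

theorem StackCostInstance.topCost_le (x) : topCost I.price x ≤ I.encode.length ^ 2 := by
  cases x with
  | none => simp [topCost]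
  | some g =>
    refine (I.price_le g).trans ?_
    nlinarith [I.size_bounds]

theorem StackCostInstance.width_pos : 0 < I.width :=
  Nat.pow_pos (by have := I.size_bounds; omega)

theorem StackCostInstance.add_depth_le_width : I.encode.length ^ 2 + I.depth ≤ I.width := by
  have h1 : 10 ≤ I.encode.length := by have := I.size_bounds; omega
  have h2 : I.encode.length ^ 2 ≤ I.encode.length ^ 6 := Nat.pow_le_pow_right (by omega) (by omega)
  have h3 : 2 * I.encode.length ^ 6 ≤ I.encode.length * I.encode.length ^ 6 :=
    Nat.mul_le_mul_right _ (by omega)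
  rw [depth, width, pow_succ' _ 6]
  omega

theorem StackCostInstance.costBound_lt_depth :
    costBound (Fin I.pda.numSymbols) (Fin I.pda.numStates) (I.threshold.num.natAbs + 1)
      (I.encode.length ^ 2) < I.depth := by
  have h := I.size_bounds
  simp only [costBound, levelTypes, depth, Fintype.card_prod, Fintype.card_fin, Fintype.card_bool]
  generalize I.encode.length = l at *
  generalize I.pda.numSymbols = s at *
  generalize I.pda.numStates = q at *
  generalize I.threshold.num.natAbs = m at *
  have hs : s ≤ l := by omega
  have hq : q ≤ l := by omega
  calc m + 1 + l ^ 2 + q * (s * (q * 2)) * (2 * l ^ 2 + 1)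
      ≤ l + l ^ 2 + l * (l * (l * 2)) * (2 * l ^ 2 + 1) := by gcongr; omega
    _ = l ^ 1 + l ^ 2 + 2 * l ^ 3 + 4 * l ^ 5 := by ring
    _ ≤ l ^ 5 + l ^ 5 + 2 * l ^ 5 + 4 * l ^ 5 := by gcongr <;> omega
    _ = 8 * l ^ 5 := by ring
    _ < l * l ^ 5 := by
        have : 0 < l ^ 5 := Nat.pow_pos (by omega)
        exact Nat.mul_lt_mul_of_pos_right (by omega) this
    _ = l ^ 6 := by ring

end Size

/-- The instance of the letter cost problem that the reduction makes of `I`. -/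
def StackCostInstance.toLetterCost (I : StackCostInstance) : LetterCostInstance where
  pda := I.pda.track I.price I.depth I.width_pos
  lc := fun j => ((j : ℕ) : ℚ)
  threshold := I.threshold

section Correct

variable (I : StackCostInstance)

theorem avgLC_eq_ASC {A G Q : Type} {c : G → ℕ} {π : ℕ → Config A G Q} {W : ℕ} {w : ℕ → Fin W}
    (h : ∀ i, (w i : ℕ) = configCost c (π i)) :
    avgLC (fun j : Fin W => ((j : ℕ) : ℚ)) w = ASC c π := by
  funext k
  simp only [avgLC, ASC, Rat.cast_natCast, h]
  ring

theorem threshold_lt (q : ℚ) : (((q : ℝ) : EReal)) < (((q.num.natAbs + 1 : ℕ) : ℝ) : EReal) := by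
  rw [EReal.coe_lt_coe_iff]
  have h1 : q < ((q.num.natAbs + 1 : ℕ) : ℚ) := by
    rw [Nat.cast_add, Nat.cast_natAbs, Nat.cast_one]
    have h2 : q ≤ |q| := le_abs_self q
    have h3 : |q| ≤ |(q.num : ℚ)| := by
      conv_lhs => rw [← Rat.num_div_den q]
      rw [abs_div]
      refine div_le_self (abs_nonneg _) ?_
      rw [Nat.abs_cast]
      exact_mod_cast q.den_pos
    push_cast
    linarith
  exact_mod_cast h1

theorem Comparison.Holds.lt {r : Comparison} {x : EReal} {q : ℚ} (h : r.Holds x q) :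
    x < (((q.num.natAbs + 1 : ℕ) : ℝ) : EReal) := by
  cases r
  · exact lt_trans h (threshold_lt q)
  · exact lt_of_le_of_lt h (threshold_lt q)

theorem Comparison.Holds.of_le {r : Comparison} {x y : EReal} {q : ℚ} (h : r.Holds x q)
    (hy : y ≤ x) : r.Holds y q := by
  cases r
  · exact lt_of_le_of_lt hy h
  · exact le_trans hy h

/-- Soundness of the reduction: letter costs of words are stack costs of runs. -/
theorem StackCostInstance.exists_run_of_mem {w : ℕ → Fin I.width}
    (hw : w ∈ I.toLetterCost.pda.toPDA.language) :
    ∃ π, I.pda.toPDA.IsAcceptingRun π ∧ avgLC I.toLetterCost.lc w = ASC I.price π := by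
  have hd := I.add_depth_le_width
  obtain ⟨π, h1, h2⟩ := track_sound
    (fun t _ => (Nat.add_le_add_right (I.topCost_le _) _).trans hd)
    (fun t ht => (Nat.add_le_add_right (I.wordCost_le ht) _).trans hd) hw
  exact ⟨π, h1, avgLC_eq_ASC h2⟩

/-- Completeness of the reduction: a run of low average cost is dominated by a run whose stack costs
form a word of the cost-tracking automaton. -/
theorem StackCostInstance.exists_word {π} (hπ : I.pda.toPDA.IsAcceptingRun π)
    (hlow : IASC I.price π < (((I.threshold.num.natAbs + 1 : ℕ) : ℝ) : EReal)) :
    ∃ w ∈ I.toLetterCost.pda.toPDA.language, ∃ π' t t',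
      Dominates I.price (I.threshold.num.natAbs + 1) π π' t t' ∧
      avgLC I.toLetterCost.lc w = ASC I.price π' := by
  obtain ⟨π', t, t', h1, h2, h3⟩ := hπ.exists_bounded (Nat.succ_pos _)
    (fun g => I.topCost_le (some g)) (fun t ht => I.wordCost_le (List.mem_toFinset.1 ht))
    (frequently_low hlow)
  obtain ⟨w, hw, h4⟩ := track_complete (hW := I.width_pos)
    ((Nat.le_add_left _ _).trans I.add_depth_le_width) h1
    (fun i => (h2 i).trans_lt I.costBound_lt_depth)
  exact ⟨w, hw, π', t, t', h3, avgLC_eq_ASC h4⟩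

theorem IASCProblem_iff (r : Comparison) :
    IASCProblem r I ↔ AvgInfLCProblem r I.toLetterCost := by
  constructor
  · rintro ⟨π, hπ, h⟩
    obtain ⟨w, hw, π', t, t', h1, h2⟩ := I.exists_word hπ h.lt
    refine ⟨w, hw, ?_⟩
    rw [avgInfLC, h2]
    exact h.of_le (h1.IASC_le h.lt)
  · rintro ⟨w, hw, h⟩
    obtain ⟨π, h1, h2⟩ := I.exists_run_of_mem hw
    rw [avgInfLC, h2] at h
    exact ⟨π, h1, h⟩

theorem SASCProblem_iff (r : Comparison) :
    SASCProblem r I ↔ AvgSupLCProblem r I.toLetterCost := by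
  constructor
  · rintro ⟨π, hπ, h⟩
    obtain ⟨w, hw, π', t, t', h1, h2⟩ := I.exists_word hπ (IASC_le_SASC.trans_lt h.lt)
    refine ⟨w, hw, ?_⟩
    rw [avgSupLC, h2]
    exact h.of_le (h1.SASC_le h.lt)
  · rintro ⟨w, hw, h⟩
    obtain ⟨π, h1, h2⟩ := I.exists_run_of_mem hw
    rw [avgSupLC, h2] at h
    exact ⟨π, h1, h⟩

end Correct

/-! ### A structured language for stack machines -/

/-- Structured programs on stacks of bits indexed by `K`. -/
inductive Prog (K : Type) : Type
  /-- do nothing -/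
  | skip : Prog K
  /-- push the bit `b` on the stack `k` -/
  | push (k : K) (b : Bool) : Prog K
  /-- run `p`, then `q` -/
  | seq (p q : Prog K) : Prog K
  /-- pop the stack `k`; run `p` if the result is `true`, and `q` if it is `false` or if the
  stack was empty -/
  | ifTrue (k : K) (p q : Prog K) : Prog K
  /-- pop the stack `k` and run `p`, as long as the result is `true`; the last pop, of `false` or
  of the empty stack, ends the loop -/
  | whileTrue (k : K) (p : Prog K) : Prog K
  /-- pop the stack `k` until it is empty, running `p` for each `true` and `q` for each `false` -/
  | drain (k : K) (p q : Prog K) : Prog K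

section Semantics

variable {K : Type} [DecidableEq K]

open Function

/-- `Exec p S S' n`: the program `p` leads from the stacks `S` to the stacks `S'` in `n` steps. -/
inductive Exec : Prog K → (K → List Bool) → (K → List Bool) → ℕ → Prop
  | skip (S) : Exec .skip S S 1
  | push (S k b) : Exec (.push k b) S (update S k (b :: S k)) 1
  | seq {p q S S₁ S₂ m n} : Exec p S S₁ m → Exec q S₁ S₂ n → Exec (.seq p q) S S₂ (m + n)
  | ifTrue_true {k p q S S' l n} : S k = true :: l → Exec p (update S k l) S' n →
      Exec (.ifTrue k p q) S S' (1 + n)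
  | ifTrue_false {k p q S S' l n} : S k = false :: l → Exec q (update S k l) S' n →
      Exec (.ifTrue k p q) S S' (1 + n)
  | ifTrue_nil {k p q S S' n} : S k = [] → Exec q S S' n → Exec (.ifTrue k p q) S S' (1 + n)
  | whileTrue_true {k p S S₁ S₂ l m n} : S k = true :: l → Exec p (update S k l) S₁ m →
      Exec (.whileTrue k p) S₁ S₂ n → Exec (.whileTrue k p) S S₂ (1 + m + n)
  | whileTrue_false {k p S l} : S k = false :: l → Exec (.whileTrue k p) S (update S k l) 1
  | whileTrue_nil {k p S} : S k = [] → Exec (.whileTrue k p) S S 1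
  | drain_true {k p q S S₁ S₂ l m n} : S k = true :: l → Exec p (update S k l) S₁ m →
      Exec (.drain k p q) S₁ S₂ n → Exec (.drain k p q) S S₂ (1 + m + n)
  | drain_false {k p q S S₁ S₂ l m n} : S k = false :: l → Exec q (update S k l) S₁ m →
      Exec (.drain k p q) S₁ S₂ n → Exec (.drain k p q) S S₂ (1 + m + n)
  | drain_nil {k p q S} : S k = [] → Exec (.drain k p q) S S 1

/-! ### Compilation to stack Turing machines -/

/-- The labels of the compiled program: one for each atomic instruction and one for each test. -/
def Prog.Label : Prog K → Type
  | .skip => Unit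
  | .push _ _ => Unit
  | .seq p q => p.Label ⊕ q.Label
  | .ifTrue _ p q => Option (p.Label ⊕ q.Label)
  | .whileTrue _ p => Option p.Label
  | .drain _ p q => Option (p.Label ⊕ q.Label)

/-- There are finitely many labels. -/
@[reducible]
def Prog.fintypeLabel : (p : Prog K) → Fintype p.Label
  | .skip => inferInstanceAs (Fintype Unit)
  | .push _ _ => inferInstanceAs (Fintype Unit)
  | .seq p q =>
    letI := p.fintypeLabel; letI := q.fintypeLabel; inferInstanceAs (Fintype (p.Label ⊕ q.Label))
  | .ifTrue _ p q =>
    letI := p.fintypeLabel; letI := q.fintypeLabel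
    inferInstanceAs (Fintype (Option (p.Label ⊕ q.Label)))
  | .whileTrue _ p => letI := p.fintypeLabel; inferInstanceAs (Fintype (Option p.Label))
  | .drain _ p q =>
    letI := p.fintypeLabel; letI := q.fintypeLabel
    inferInstanceAs (Fintype (Option (p.Label ⊕ q.Label)))

/-- The label at which the compiled program starts. -/
def Prog.entry : (p : Prog K) → p.Label
  | .skip => ()
  | .push _ _ => ()
  | .seq p _ => .inl p.entry
  | .ifTrue _ _ _ => none
  | .whileTrue _ _ => none
  | .drain _ _ _ => none

/-- Pop the stack `k` and go to the label given by the result. -/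
def popGoto {L : Type} (k : K) (f : Option Bool → L) :
    Turing.TM2.Stmt (fun _ : K => Bool) L (Option Bool) :=
  .pop k (fun _ o => o) (.goto f)

/-- The code of a program whose labels are embedded in `L` by `emb`, and which goes to the label
`ex` at its end. The internal state of the machine is the result of the last pop. -/
def Prog.code {L : Type} : (p : Prog K) → (emb : p.Label → L) → (ex : L) → p.Label →
    Turing.TM2.Stmt (fun _ : K => Bool) L (Option Bool)
  | .skip, _, ex, _ => .goto fun _ => ex
  | .push k b, _, ex, _ => .push k (fun _ => b) (.goto fun _ => ex)
  | .seq p q, emb, ex, l => match l with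
    | .inl l => p.code (fun l => emb (.inl l)) (emb (.inr q.entry)) l
    | .inr l => q.code (fun l => emb (.inr l)) ex l
  | .ifTrue k p q, emb, ex, l => match l with
    | none => popGoto k fun o =>
      if o = some true then emb (some (.inl p.entry)) else emb (some (.inr q.entry))
    | some (.inl l) => p.code (fun l => emb (some (.inl l))) ex l
    | some (.inr l) => q.code (fun l => emb (some (.inr l))) ex l
  | .whileTrue k p, emb, ex, l => match l with
    | none => popGoto k fun o => if o = some true then emb (some p.entry) else ex
    | some l => p.code (fun l => emb (some l)) (emb none) l
  | .drain k p q, emb, ex, l => match l with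
    | none => popGoto k fun o => o.elim ex fun b =>
      if b then emb (some (.inl p.entry)) else emb (some (.inr q.entry))
    | some (.inl l) => p.code (fun l => emb (some (.inl l))) (emb none) l
    | some (.inr l) => q.code (fun l => emb (some (.inr l))) (emb none) l

/-- The machine `m` goes from label `l` and stacks `S` to label `l'` and stacks `S'` in exactly
`n` steps, whatever its internal state. -/
def StepsTo {L : Type} (m : L → Turing.TM2.Stmt (fun _ : K => Bool) L (Option Bool)) (l l' : L)
    (S S' : K → List Bool) (n : ℕ) : Prop :=
  ∀ v, ∃ v', (flip Bind.bind (Turing.TM2.step m))^[n] (some ⟨some l, v, S⟩) = some ⟨some l', v', S'⟩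

section Compile

variable {L : Type} {m : L → Turing.TM2.Stmt (fun _ : K => Bool) L (Option Bool)}

theorem StepsTo.trans {l l' l'' : L} {S S' S'' : K → List Bool} {n n' : ℕ}
    (h : StepsTo m l l' S S' n) (h' : StepsTo m l' l'' S' S'' n') :
    StepsTo m l l'' S S'' (n + n') := by
  intro v
  obtain ⟨v', hv'⟩ := h v
  obtain ⟨v'', hv''⟩ := h' v'
  exact ⟨v'', by rw [add_comm, Function.iterate_add_apply, hv', hv'']⟩

theorem StepsTo.of_step {l l' : L} {S S' : K → List Bool} (h : ∀ v, ∃ v',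
    Turing.TM2.step m ⟨some l, v, S⟩ = some ⟨some l', v', S'⟩) : StepsTo m l l' S S' 1 :=
  h

theorem StepsTo.popGoto {l : L} {k : K} {f : Option Bool → L} (h : m l = popGoto k f)
    (S : K → List Bool) : StepsTo m l (f (S k).head?) S (update S k (S k).tail) 1 := by
  refine .of_step fun v => ⟨(S k).head?, ?_⟩
  rw [Turing.TM2.step, h]
  rfl

theorem StepsTo.popGoto_cons {l : L} {k : K} {f : Option Bool → L} (h : m l = StackCost.popGoto k f)
    {S : K → List Bool} {b : Bool} {t : List Bool} (hk : S k = b :: t) :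
    StepsTo m l (f (some b)) S (update S k t) 1 := by
  have h0 := StepsTo.popGoto h S
  rwa [hk] at h0

theorem StepsTo.popGoto_nil {l : L} {k : K} {f : Option Bool → L} (h : m l = StackCost.popGoto k f)
    {S : K → List Bool} (hk : S k = []) : StepsTo m l (f none) S S 1 := by
  have h0 := StepsTo.popGoto h S
  have h1 : update S k (S k).tail = S := by rw [update_eq_self_iff, hk, List.tail_nil]
  rwa [h1, hk] at h0

/-- Compiled programs make the steps prescribed by the semantics; the time is the same, since every
atomic instruction and every test is one machine step. -/
theorem Exec.stepsTo {p : Prog K} {S S' : K → List Bool} {n : ℕ} (h : Exec p S S' n) :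
    ∀ (emb : p.Label → L) (ex : L), (∀ l, m (emb l) = p.code emb ex l) →
      StepsTo m (emb p.entry) ex S S' n := by
  induction h with
  | skip S =>
    intro emb ex hm
    refine .of_step fun v => ⟨v, ?_⟩
    rw [Turing.TM2.step, hm]
    rfl
  | push S k b =>
    intro emb ex hm
    refine .of_step fun v => ⟨v, ?_⟩
    rw [Turing.TM2.step, hm]
    rfl
  | seq h1 h2 ih1 ih2 =>
    intro emb ex hm
    exact (ih1 _ _ fun l => hm (.inl l)).trans (ih2 _ _ fun l => hm (.inr l))
  | ifTrue_true hk h1 ih1 =>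
    intro emb ex hm
    have h0 := StepsTo.popGoto_cons (hm none) hk
    exact h0.trans (ih1 _ _ fun l => hm (some (.inl l)))
  | ifTrue_false hk h1 ih1 =>
    intro emb ex hm
    have h0 := StepsTo.popGoto_cons (hm none) hk
    exact h0.trans (ih1 _ _ fun l => hm (some (.inr l)))
  | ifTrue_nil hk h1 ih1 =>
    intro emb ex hm
    have h0 := StepsTo.popGoto_nil (hm none) hk
    exact h0.trans (ih1 _ _ fun l => hm (some (.inr l)))
  | whileTrue_true hk h1 h2 ih1 ih2 =>
    intro emb ex hm
    have h0 := StepsTo.popGoto_cons (hm none) hk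
    exact (h0.trans (ih1 _ _ fun l => hm (some l))).trans (ih2 _ _ hm)
  | whileTrue_false hk =>
    intro emb ex hm
    have h0 := StepsTo.popGoto_cons (hm none) hk
    exact h0
  | whileTrue_nil hk =>
    intro emb ex hm
    have h0 := StepsTo.popGoto_nil (hm none) hk
    exact h0
  | drain_true hk h1 h2 ih1 ih2 =>
    intro emb ex hm
    have h0 := StepsTo.popGoto_cons (hm none) hk
    exact (h0.trans (ih1 _ _ fun l => hm (some (.inl l)))).trans (ih2 _ _ hm)
  | drain_false hk h1 h2 ih1 ih2 =>
    intro emb ex hm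
    have h0 := StepsTo.popGoto_cons (hm none) hk
    exact (h0.trans (ih1 _ _ fun l => hm (some (.inr l)))).trans (ih2 _ _ hm)
  | drain_nil hk =>
    intro emb ex hm
    have h0 := StepsTo.popGoto_nil (hm none) hk
    exact h0

end Compile

/-- The code of `p` with the additional label `none`, which resets the internal state and halts. -/
def Prog.program (p : Prog K) (l : Option p.Label) :
    Turing.TM2.Stmt (fun _ : K => Bool) (Option p.Label) (Option Bool) :=
  l.elim (.load (fun _ => none) .halt) (p.code some none)

/-- The Turing machine that runs `p` with input stack `i` and output stack `o`. -/
def Prog.machine [Fintype K] (p : Prog K) (i o : K) : Turing.FinTM2 :=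
  letI := p.fintypeLabel
  { K := K
    k₀ := i
    k₁ := o
    Γ := fun _ => Bool
    Λ := Option p.Label
    main := some p.entry
    σ := Option Bool
    initialState := none
    Γk₀Fin := inferInstanceAs (Fintype Bool)
    m := p.program }

theorem Prog.initList_machine [Fintype K] (p : Prog K) (i o : K) (l : List Bool) :
    Turing.initList (p.machine i o) l =
      (⟨some (some p.entry), none, update (fun _ => []) i l⟩ :
        Turing.TM2.Cfg (fun _ : K => Bool) (Option p.Label) (Option Bool)) := by
  unfold Turing.initList
  congr 1
  refine funext fun k : K => ?_
  by_cases hk : k = i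
  · subst hk
    exact (dif_pos rfl).trans (update_self k l (fun _ : K => ([] : List Bool))).symm
  · have e : update (fun _ : K => ([] : List Bool)) i l k = [] := update_of_ne hk _ _
    exact (dif_neg hk).trans e.symm

theorem Prog.haltList_machine [Fintype K] (p : Prog K) (i o : K) (l : List Bool) :
    Turing.haltList (p.machine i o) l =
      (⟨none, none, update (fun _ => []) o l⟩ :
        Turing.TM2.Cfg (fun _ : K => Bool) (Option p.Label) (Option Bool)) := by
  unfold Turing.haltList
  congr 1
  refine funext fun k : K => ?_
  by_cases hk : k = o
  · subst hk
    exact (dif_pos rfl).trans (update_self k l (fun _ : K => ([] : List Bool))).symm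
  · have e : update (fun _ : K => ([] : List Bool)) o l k = [] := update_of_ne hk _ _
    exact (dif_neg hk).trans e.symm

/-- A program that runs in polynomial time and leaves nothing but its output on the stacks gives
a function computable in polynomial time. -/
theorem Prog.nonempty_computable [Fintype K] (p : Prog K) (i o : K) {α β : Type}
    {ea : α → List Bool} {eb : β → List Bool} {f : α → β} (T : Polynomial ℕ)
    (h : ∀ a, ∃ n ≤ T.eval (ea a).length,
      Exec p (update (fun _ => []) i (ea a)) (update (fun _ => []) o (eb (f a))) n) :
    Nonempty (Turing.TM2ComputableInPolyTime ea eb f) := by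
  choose n hn hexec using h
  refine ⟨⟨⟨p.machine i o, Equiv.refl Bool, Equiv.refl Bool⟩, T + 1, fun a => ⟨⟨n a + 1, ?_⟩, ?_⟩⟩⟩
  · obtain ⟨v, hv⟩ := (hexec a).stepsTo (m := p.program) some none (fun l => rfl) none
    have h1 := (congrArg (Turing.initList (p.machine i o)) (List.map_id (ea a))).trans
      (p.initList_machine i o (ea a))
    have h2 := (congrArg (Turing.haltList (p.machine i o)) (List.map_id (eb (f a)))).trans
      (p.haltList_machine i o (eb (f a)))
    have h3 : (flip Bind.bind (Turing.TM2.step p.program))^[n a + 1]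
        (some ⟨some (some p.entry), none, update (fun _ => []) i (ea a)⟩) =
        some (⟨none, none, update (fun _ => []) o (eb (f a))⟩ :
          Turing.TM2.Cfg (fun _ : K => Bool) (Option p.Label) (Option Bool)) := by
      rw [Function.iterate_succ_apply', hv]
      rfl
    exact (congrArg (fun c => (flip Bind.bind (Turing.TM2.step p.program))^[n a + 1]
      (some c)) h1).trans (h3.trans (congrArg some h2.symm))
  · rw [Polynomial.eval_add, Polynomial.eval_one]
    exact Nat.add_le_add_right (hn a) 1

end Semantics

/-! ### Registers and basic routines -/

/-- The stacks of the machine that computes the reduction. -/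
inductive Reg : Type
  | i | e | o | r | t | l | d | w | n | j | a | h | f | q | c | p | b | x | y
  deriving DecidableEq

instance : Fintype Reg :=
  ⟨{.i, .e, .o, .r, .t, .l, .d, .w, .n, .j, .a, .h, .f, .q, .c, .p, .b, .x, .y},
    fun k => by cases k <;> decide⟩

/-- The contents of the stacks: the input `i`, the output `o` and its reversal `r`, the table `e` of
prices, the scratch stack `t`, and working registers. -/
@[ext]
structure Regs : Type where
  /-- the rest of the input -/
  i : List Bool
  /-- a copy of the input, reduced to the prices -/
  e : List Bool
  /-- the output -/
  o : List Bool
  /-- the reversal of the output written so far -/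
  r : List Bool
  /-- scratch stack, empty between routines -/
  t : List Bool
  /-- the length of the input, in unary -/
  l : List Bool
  /-- the number of stack costs below the top, in unary -/
  d : List Bool
  /-- the number of stack costs, in unary -/
  w : List Bool
  /-- number of iterations left -/
  n : List Bool
  /-- number of iterations done -/
  j : List Bool
  /-- a number in unary -/
  a : List Bool
  /-- half of a number -/
  h : List Bool
  /-- parity of a number -/
  f : List Bool
  /-- offset of the source state of a transition -/
  q : List Bool
  /-- price of the popped symbol -/
  c : List Bool
  /-- offset of the target state of a transition -/
  p : List Bool
  /-- price of the pushed word -/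
  b : List Bool
  /-- reversed code of the popped symbol -/
  x : List Bool
  /-- reversed code of the pushed word -/
  y : List Bool

/-- The content of a stack. -/
def Regs.get (s : Regs) : Reg → List Bool
  | .i => s.i | .e => s.e | .o => s.o | .r => s.r | .t => s.t | .l => s.l | .d => s.d | .w => s.w
  | .n => s.n | .j => s.j | .a => s.a | .h => s.h | .f => s.f | .q => s.q | .c => s.c | .p => s.p
  | .b => s.b | .x => s.x | .y => s.y

/-- Changing the content of a stack. -/
def Regs.set (s : Regs) (k : Reg) (v : List Bool) : Regs :=
  match k with
  | .i => { s with i := v } | .e => { s with e := v } | .o => { s with o := v }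
  | .r => { s with r := v } | .t => { s with t := v } | .l => { s with l := v }
  | .d => { s with d := v } | .w => { s with w := v } | .n => { s with n := v }
  | .j => { s with j := v } | .a => { s with a := v } | .h => { s with h := v }
  | .f => { s with f := v } | .q => { s with q := v } | .c => { s with c := v }
  | .p => { s with p := v } | .b => { s with b := v } | .x => { s with x := v }
  | .y => { s with y := v }

theorem Regs.get_injective : Function.Injective Regs.get := fun _ _ h =>
  Regs.ext (congrFun h .i) (congrFun h .e) (congrFun h .o) (congrFun h .r) (congrFun h .t)
    (congrFun h .l) (congrFun h .d) (congrFun h .w) (congrFun h .n) (congrFun h .j) (congrFun h .a)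
    (congrFun h .h) (congrFun h .f) (congrFun h .q) (congrFun h .c) (congrFun h .p) (congrFun h .b)
    (congrFun h .x) (congrFun h .y)

theorem Regs.get_set (s : Regs) (k : Reg) (v : List Bool) :
    (s.set k v).get = Function.update s.get k v := by
  funext k'
  cases k <;> cases k' <;> rfl

theorem Regs.get_set_self (s : Regs) (k : Reg) (v : List Bool) : (s.set k v).get k = v := by
  rw [get_set, Function.update_self]

theorem Regs.get_set_of_ne (s : Regs) {k k' : Reg} (h : k' ≠ k) (v : List Bool) :
    (s.set k v).get k' = s.get k' := by
  rw [get_set, Function.update_of_ne h]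

theorem Regs.set_set (s : Regs) (k : Reg) (v v' : List Bool) :
    (s.set k v).set k v' = s.set k v' :=
  get_injective (by simp [get_set])

theorem Regs.set_comm (s : Regs) {k k' : Reg} (h : k ≠ k') (v v' : List Bool) :
    (s.set k v).set k' v' = (s.set k' v').set k v :=
  get_injective (by rw [get_set, get_set, get_set, get_set, Function.update_comm h.symm])

theorem Regs.set_eq_self {s : Regs} {k : Reg} {v : List Bool} (h : s.get k = v) :
    s.set k v = s :=
  get_injective (by rw [get_set, Function.update_eq_self_iff, h])

/-- Sequential composition. -/
infixr:60 " ;; " => Prog.seq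

/-- `Runs p s s' t`: the program `p` leads from `s` to `s'` in at most `t` steps. -/
def Runs (p : Prog Reg) (s s' : Regs) (t : ℕ) : Prop :=
  ∃ n ≤ t, Exec p s.get s'.get n

section Rules

variable {p p' : Prog Reg} {s s' s₁ s₂ : Regs} {m n : ℕ} {k : Reg} {l : List Bool}

theorem Runs.mono (h : Runs p s s' m) (hmn : m ≤ n) : Runs p s s' n := by
  obtain ⟨t, ht, h⟩ := h
  exact ⟨t, ht.trans hmn, h⟩

theorem Runs.to (h : Runs p s s₁ m) (hs : s₁ = s') (hmn : m ≤ n) : Runs p s s' n :=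
  hs ▸ h.mono hmn

theorem Runs.skip : Runs .skip s s 1 :=
  ⟨1, le_rfl, .skip _⟩

theorem Runs.push (k : Reg) (b : Bool) : Runs (.push k b) s (s.set k (b :: s.get k)) 1 :=
  ⟨1, le_rfl, by rw [Regs.get_set]; exact .push _ _ _⟩

theorem Runs.seq (h : Runs p s s₁ m) (h' : Runs p' s₁ s₂ n) : Runs (p ;; p') s s₂ (m + n) := by
  obtain ⟨t, ht, h⟩ := h
  obtain ⟨t', ht', h'⟩ := h'
  exact ⟨t + t', by omega, .seq h h'⟩

theorem Runs.ifTrue_true (hk : s.get k = true :: l) (h : Runs p (s.set k l) s' n) :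
    Runs (.ifTrue k p p') s s' (1 + n) := by
  obtain ⟨t, ht, h⟩ := h
  rw [Regs.get_set] at h
  exact ⟨1 + t, by omega, .ifTrue_true hk h⟩

theorem Runs.ifTrue_false (hk : s.get k = false :: l) (h : Runs p' (s.set k l) s' n) :
    Runs (.ifTrue k p p') s s' (1 + n) := by
  obtain ⟨t, ht, h⟩ := h
  rw [Regs.get_set] at h
  exact ⟨1 + t, by omega, .ifTrue_false hk h⟩

theorem Runs.ifTrue_nil (hk : s.get k = []) (h : Runs p' s s' n) :
    Runs (.ifTrue k p p') s s' (1 + n) := by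
  obtain ⟨t, ht, h⟩ := h
  exact ⟨1 + t, by omega, .ifTrue_nil hk h⟩

theorem Runs.whileTrue_true (hk : s.get k = true :: l) (h : Runs p (s.set k l) s₁ m)
    (h' : Runs (.whileTrue k p) s₁ s₂ n) : Runs (.whileTrue k p) s s₂ (1 + m + n) := by
  obtain ⟨t, ht, h⟩ := h
  obtain ⟨t', ht', h'⟩ := h'
  rw [Regs.get_set] at h
  exact ⟨1 + t + t', by omega, .whileTrue_true hk h h'⟩

theorem Runs.whileTrue_false (hk : s.get k = false :: l) :
    Runs (.whileTrue k p) s (s.set k l) 1 :=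
  ⟨1, le_rfl, by rw [Regs.get_set]; exact .whileTrue_false hk⟩

theorem Runs.whileTrue_nil (hk : s.get k = []) : Runs (.whileTrue k p) s s 1 :=
  ⟨1, le_rfl, .whileTrue_nil hk⟩

theorem Runs.drain_true (hk : s.get k = true :: l) (h : Runs p (s.set k l) s₁ m)
    (h' : Runs (.drain k p p') s₁ s₂ n) : Runs (.drain k p p') s s₂ (1 + m + n) := by
  obtain ⟨t, ht, h⟩ := h
  obtain ⟨t', ht', h'⟩ := h'
  rw [Regs.get_set] at h
  exact ⟨1 + t + t', by omega, .drain_true hk h h'⟩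

theorem Runs.drain_false (hk : s.get k = false :: l) (h : Runs p' (s.set k l) s₁ m)
    (h' : Runs (.drain k p p') s₁ s₂ n) : Runs (.drain k p p') s s₂ (1 + m + n) := by
  obtain ⟨t, ht, h⟩ := h
  obtain ⟨t', ht', h'⟩ := h'
  rw [Regs.get_set] at h
  exact ⟨1 + t + t', by omega, .drain_false hk h h'⟩

theorem Runs.drain_nil (hk : s.get k = []) : Runs (.drain k p p') s s 1 :=
  ⟨1, le_rfl, .drain_nil hk⟩

/-- Draining `k`, where `F u` are the other stacks when `u` has been read. -/
theorem Runs.drain (F : List Bool → Regs) (b : ℕ) (l : List Bool)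
    (h1 : ∀ u v, Runs p ((F u).set k v) ((F (u ++ [true])).set k v) b)
    (h2 : ∀ u v, Runs p' ((F u).set k v) ((F (u ++ [false])).set k v) b) :
    Runs (.drain k p p') ((F []).set k l) ((F l).set k []) (l.length * (b + 1) + 1) := by
  suffices H : ∀ u, Runs (.drain k p p') ((F u).set k l) ((F (u ++ l)).set k [])
      (l.length * (b + 1) + 1) from H []
  induction l with
  | nil =>
    intro u
    rw [List.append_nil]
    exact (Runs.drain_nil (Regs.get_set_self _ _ _)).mono (by simp)
  | cons a l ih =>
    intro u
    have h3 := ih (u ++ [a])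
    rw [List.append_assoc] at h3
    have hget := (F u).get_set_self k (a :: l)
    cases a
    · exact (Runs.drain_false hget (by rw [Regs.set_set]; exact h2 u l) h3).mono
        (by rw [List.length_cons, add_mul]; omega)
    · exact (Runs.drain_true hget (by rw [Regs.set_set]; exact h1 u l) h3).mono
        (by rw [List.length_cons, add_mul]; omega)

end Rules

/-- The number `n` in unary. -/
def ones (n : ℕ) : List Bool :=
  List.replicate n true

theorem ones_succ (n : ℕ) : ones (n + 1) = true :: ones n := rfl

theorem ones_add (m n : ℕ) : ones (m + n) = ones m ++ ones n :=
  List.replicate_add ..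

theorem length_ones (n : ℕ) : (ones n).length = n :=
  List.length_replicate

theorem encUnary_append (n : ℕ) (u : List Bool) : encUnary n ++ u = ones n ++ false :: u := by
  simp [encUnary, ones]

theorem reverse_encUnary (n : ℕ) : (encUnary n).reverse = false :: ones n := by
  simp [encUnary, ones]

section Loops

variable {p : Prog Reg} {s s' : Regs} {k : Reg}

/-- A loop over a number in unary, where `F m` are the other stacks after `m` iterations. The number
ends with `false` or with the stack. -/
theorem Runs.whileTrue_ones (F : ℕ → Regs) (b n : ℕ) {tl rest : List Bool}
    (htl : tl = false :: rest ∨ tl = [] ∧ rest = [])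
    (h : ∀ m < n, ∀ u, Runs p ((F m).set k u) ((F (m + 1)).set k u) b) :
    Runs (.whileTrue k p) ((F 0).set k (ones n ++ tl)) ((F n).set k rest) (n * (b + 1) + 1) := by
  induction n generalizing F with
  | zero =>
    rw [Nat.zero_mul, Nat.zero_add]
    rcases htl with rfl | ⟨rfl, rfl⟩
    · have := Runs.whileTrue_false (p := p) ((F 0).get_set_self k (false :: rest))
      rwa [Regs.set_set] at this
    · exact Runs.whileTrue_nil (Regs.get_set_self _ _ _)
  | succ n ih =>
    have h1 := ih (fun m => F (m + 1)) fun m hm => h (m + 1) (by omega)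
    exact (Runs.whileTrue_true ((F 0).get_set_self k (ones (n + 1) ++ tl))
      (by rw [Regs.set_set]; exact h 0 (by omega) _) h1).mono (by rw [add_mul n 1]; omega)

/-- A loop over a coded list, where `F l` are the other stacks when the entries of `l` have been
read. -/
theorem Runs.whileTrue_list {α : Type} {e : α → List Bool} (F : List α → Regs) (b : ℕ)
    (l : List α) (rest : List Bool)
    (h : ∀ pre, ∀ x ∈ l, ∀ u, Runs p ((F pre).set k (e x ++ u)) ((F (pre ++ [x])).set k u) b) :
    Runs (.whileTrue k p) ((F []).set k (encList e l ++ rest)) ((F l).set k rest)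
      (l.length * (b + 1) + 1) := by
  suffices H : ∀ pre, Runs (.whileTrue k p) ((F pre).set k (encList e l ++ rest))
      ((F (pre ++ l)).set k rest) (l.length * (b + 1) + 1) from H []
  induction l with
  | nil =>
    intro pre
    rw [List.append_nil]
    have := Runs.whileTrue_false (p := p) ((F pre).get_set_self k (false :: rest))
    rw [Regs.set_set] at this
    exact this.mono (by simp)
  | cons x l ih =>
    intro pre
    have h3 := ih (fun pre x hx => h pre x (List.mem_cons_of_mem _ hx)) (pre ++ [x])
    rw [List.append_assoc] at h3
    have hget := (F pre).get_set_self k (true :: (e x ++ (encList e l ++ rest)))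
    have hcons : encList e (x :: l) ++ rest = true :: (e x ++ (encList e l ++ rest)) := by
      simp [encList]
    rw [hcons]
    exact (Runs.whileTrue_true hget
      (by rw [Regs.set_set]; exact h pre x List.mem_cons_self _) h3).mono
        (by rw [List.length_cons, add_mul]; omega)

end Loops

/-! ### Routines -/

/-- Empty the stack `k`. -/
def clear (k : Reg) : Prog Reg :=
  .drain k .skip .skip

/-- Remove a number in unary from the stack `k`. -/
def skipUnary (k : Reg) : Prog Reg :=
  .whileTrue k .skip

/-- Reverse the stack `k` onto `k'`. -/
def reverseOnto (k k' : Reg) : Prog Reg :=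
  .drain k (.push k' true) (.push k' false)

/-- Reverse the stack `k` onto both `k₁` and `k₂`. -/
def reverseOnto₂ (k k₁ k₂ : Reg) : Prog Reg :=
  .drain k (.push k₁ true ;; .push k₂ true) (.push k₁ false ;; .push k₂ false)

/-- Put a copy of the stack `k` on top of `k'`. -/
def copy (k k' : Reg) : Prog Reg :=
  reverseOnto k .t ;; reverseOnto₂ .t k k'

section Routines

variable {s : Regs}

theorem runs_clear (k : Reg) : Runs (clear k) s (s.set k []) (2 * (s.get k).length + 1) := by
  have := Runs.drain (p := .skip) (p' := .skip) (k := k) (fun _ => s) 1 (s.get k)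
    (fun _ _ => Runs.skip) (fun _ _ => Runs.skip)
  rw [Regs.set_eq_self rfl] at this
  exact this.mono (by omega)

theorem runs_skipUnary (k : Reg) {n : ℕ} {rest : List Bool}
    (h : s.get k = encUnary n ++ rest) :
    Runs (skipUnary k) s (s.set k rest) (2 * n + 1) := by
  rw [encUnary_append] at h
  have := Runs.whileTrue_ones (p := .skip) (k := k) (fun _ => s) 1 n (Or.inl rfl : _ ∨ _ ∧ rest = _)
    (fun _ _ _ => Runs.skip)
  rw [Regs.set_eq_self h] at this
  exact this.mono (by omega)

theorem runs_reverseOnto {k k' : Reg} (hk : k ≠ k') {l : List Bool} (h : s.get k = l) :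
    Runs (reverseOnto k k') s ((s.set k' (l.reverse ++ s.get k')).set k [])
      (2 * l.length + 1) := by
  have hb : ∀ b u v, Runs (.push k' b) ((s.set k' (u.reverse ++ s.get k')).set k v)
      ((s.set k' ((u ++ [b]).reverse ++ s.get k')).set k v) 1 := fun b u v => by
    have := Runs.push (s := (s.set k' (u.reverse ++ s.get k')).set k v) k' b
    rw [Regs.get_set_of_ne _ hk.symm, Regs.get_set_self, Regs.set_comm _ hk, Regs.set_set] at this
    simpa using this
  have := Runs.drain (k := k) (fun u => s.set k' (u.reverse ++ s.get k')) 1 l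
    (hb true) (hb false)
  simp only [List.reverse_nil, List.nil_append] at this
  rw [Regs.set_eq_self (s := s) rfl, Regs.set_eq_self h] at this
  exact this.mono (by omega)

theorem runs_reverseOnto₂ {k k₁ k₂ : Reg} (h1 : k ≠ k₁) (h2 : k ≠ k₂) (h12 : k₁ ≠ k₂)
    {l : List Bool} (h : s.get k = l) :
    Runs (reverseOnto₂ k k₁ k₂) s
      (((s.set k₁ (l.reverse ++ s.get k₁)).set k₂ (l.reverse ++ s.get k₂)).set k [])
      (3 * l.length + 1) := by
  have hb : ∀ b u v, Runs (.push k₁ b ;; .push k₂ b)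
      (((s.set k₁ (u.reverse ++ s.get k₁)).set k₂ (u.reverse ++ s.get k₂)).set k v)
      (((s.set k₁ ((u ++ [b]).reverse ++ s.get k₁)).set k₂
        ((u ++ [b]).reverse ++ s.get k₂)).set k v) 2 := fun b u v => by
    refine ((Runs.push k₁ b).seq (Runs.push k₂ b)).to ?_ le_rfl
    refine Regs.get_injective ?_
    funext k'
    simp only [Regs.get_set, Function.update_apply]
    split_ifs <;> simp_all
  have := Runs.drain (k := k)
    (fun u => (s.set k₁ (u.reverse ++ s.get k₁)).set k₂ (u.reverse ++ s.get k₂)) 2 l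
    (hb true) (hb false)
  simp only [List.reverse_nil, List.nil_append] at this
  rw [Regs.set_eq_self (s := s) rfl, Regs.set_eq_self (s := s) rfl, Regs.set_eq_self h] at this
  exact this.mono (by omega)

theorem runs_copy {k k' : Reg} (h1 : k ≠ .t) (h2 : k' ≠ .t) (h12 : k ≠ k') (ht : s.t = [])
    {l : List Bool} (h : s.get k = l) :
    Runs (copy k k') s (s.set k' (l ++ s.get k')) (5 * l.length + 2) := by
  have ht' : s.get .t = [] := ht
  have r1 := runs_reverseOnto h1 h
  have r2 := runs_reverseOnto₂ (s := (s.set .t (l.reverse ++ s.get .t)).set k []) (k := .t)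
    (l := l.reverse) h1.symm h2.symm h12
    (by rw [Regs.get_set_of_ne _ h1.symm, Regs.get_set_self, ht', List.append_nil])
  refine (r1.seq r2).to ?_ (by rw [List.length_reverse]; omega)
  refine Regs.get_injective ?_
  funext k''
  simp only [Regs.get_set, Function.update_apply]
  split_ifs <;> simp_all

end Routines

section Arithmetic

variable {s : Regs}

/-- Move a number in unary from `k` to `k'`. -/
def moveUnary (k k' : Reg) : Prog Reg :=
  .whileTrue k (.push k' true)

/-- Add to `k₂` the product of the numbers in `k` and `k₁`; the former is removed. -/
def mulOnto (k k₁ k₂ : Reg) : Prog Reg :=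
  .whileTrue k (copy k₁ k₂)

theorem runs_moveUnary {k k' : Reg} (hk : k ≠ k') {n : ℕ} {tl rest : List Bool}
    (htl : tl = false :: rest ∨ tl = [] ∧ rest = []) (h : s.get k = ones n ++ tl) :
    Runs (moveUnary k k') s ((s.set k' (ones n ++ s.get k')).set k rest) (2 * n + 1) := by
  have := Runs.whileTrue_ones (p := .push k' true) (k := k)
    (fun m => s.set k' (ones m ++ s.get k')) 1 n htl fun m _ u => by
      refine (Runs.push k' true).to ?_ le_rfl
      rw [Regs.get_set_of_ne _ hk.symm, Regs.get_set_self, Regs.set_comm _ hk, Regs.set_set]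
      rfl
  rw [show ones 0 ++ s.get k' = s.get k' from rfl, Regs.set_eq_self (s := s) rfl,
    Regs.set_eq_self h] at this
  exact this.mono (by omega)

theorem runs_mulOnto {k k₁ k₂ : Reg} (h1 : k ≠ k₁) (h2 : k ≠ k₂) (h12 : k₁ ≠ k₂)
    (hkt : k ≠ .t) (hkt1 : k₁ ≠ .t) (hkt2 : k₂ ≠ .t) (ht : s.t = []) {m n : ℕ}
    {tl rest : List Bool} (htl : tl = false :: rest ∨ tl = [] ∧ rest = [])
    (hk : s.get k = ones m ++ tl) (hk1 : s.get k₁ = ones n) :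
    Runs (mulOnto k k₁ k₂) s ((s.set k₂ (ones (m * n) ++ s.get k₂)).set k rest)
      (m * (5 * n + 3) + 1) := by
  have := Runs.whileTrue_ones (p := copy k₁ k₂) (k := k)
    (fun i => s.set k₂ (ones (i * n) ++ s.get k₂)) (5 * n + 2) m htl fun i _ u => by
      refine (runs_copy (l := ones n) hkt1 hkt2 h12 ?_ ?_).to ?_ (by rw [length_ones])
      · have : ((s.set k₂ (ones (i * n) ++ s.get k₂)).set k u).get .t = s.get .t := by
          rw [Regs.get_set_of_ne _ hkt.symm, Regs.get_set_of_ne _ hkt2.symm]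
        exact this.trans ht
      · rw [Regs.get_set_of_ne _ h1.symm, Regs.get_set_of_ne _ h12, hk1]
      · rw [Regs.get_set_of_ne _ h2.symm, Regs.get_set_self, Regs.set_comm _ h2, Regs.set_set,
          ← List.append_assoc, ← ones_add, add_mul, one_mul, add_comm n]
  simp only [Nat.zero_mul] at this
  rw [show ones 0 ++ s.get k₂ = s.get k₂ from rfl, Regs.set_eq_self (s := s) rfl,
    Regs.set_eq_self hk] at this
  exact this.mono (by rw [show 5 * n + 2 + 1 = 5 * n + 3 from rfl])

/-- Multiply the number in `d` by the number in `l`. -/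
def mulStep : Prog Reg :=
  mulOnto .d .l .a ;; moveUnary .a .d

theorem runs_mulStep {m n : ℕ} (ht : s.t = []) (ha : s.a = []) (hd : s.d = ones m)
    (hl : s.l = ones n) :
    Runs mulStep s { s with d := ones (m * n) } (m * (5 * n + 3) + 2 * (m * n) + 2) := by
  have r1 := runs_mulOnto (s := s) (k := .d) (k₁ := .l) (k₂ := .a) (by decide) (by decide)
    (by decide) (by decide) (by decide) (by decide) ht (tl := []) (rest := []) (Or.inr ⟨rfl, rfl⟩)
    (m := m) (hd.trans (List.append_nil _).symm) hl
  have r2 := runs_moveUnary (s := (s.set .a (ones (m * n) ++ s.get .a)).set .d []) (k := .a)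
    (k' := .d) (by decide) (tl := []) (rest := []) (Or.inr ⟨rfl, rfl⟩) (n := m * n)
    (by change ones (m * n) ++ s.a = _; rw [ha])
  refine (r1.seq r2).to ?_ (by omega)
  change ({ s with d := ones (m * n) ++ [], a := [] } : Regs) = _
  rw [List.append_nil, ← ha]

end Arithmetic

/-! ### Conversion from unary to binary -/

/-- Write half of the number in `a` to `h` and its parity to `f`. -/
def halve : Prog Reg :=
  .whileTrue .a (.ifTrue .a (.push .h true) (.push .f true))

/-- Write the binary code of the number in `a`, which is removed. Since the loop has already taken
one unit off the number `n`, its bit is the negated parity of `n - 1`. -/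
def writeBinary : Prog Reg :=
  .whileTrue .a (halve ;;
    .ifTrue .f (.push .r true ;; .push .r false ;; .push .h true)
      (.push .r true ;; .push .r true) ;;
    moveUnary .h .a) ;;
  .push .r false

section Binary

variable {s : Regs}

theorem runs_halve (n : ℕ) : ∀ {s : Regs}, s.a = ones n → s.f = [] →
    Runs halve s { s with a := [], h := ones (n / 2) ++ s.h, f := ones (n % 2) } (3 * n + 1) := by
  induction n using Nat.strong_induction_on with
  | _ n ih =>
    intro s ha hf
    match n with
    | 0 =>
      refine (Runs.whileTrue_nil (k := .a) ha).to ?_ (by omega)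
      exact (Regs.set_eq_self (k := .f) hf).symm.trans
        (congrArg (Regs.set · .f []) (Regs.set_eq_self (k := .a) ha).symm)
    | 1 =>
      refine (Runs.whileTrue_true (k := .a) ha (Runs.ifTrue_nil (k := .a) rfl (Runs.push .f true))
        (Runs.whileTrue_nil (k := .a) rfl)).to ?_ (by omega)
      change { s with a := [], h := s.h, f := true :: s.f } = _
      rw [hf]
      rfl
    | n + 2 =>
      refine (Runs.whileTrue_true (k := .a) ha
        (Runs.ifTrue_true (l := ones n) rfl (Runs.push .h true))
        (ih n (by omega) rfl hf)).to ?_ (by omega)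
      change ({ s with a := [], h := ones (n / 2) ++ true :: s.h, f := ones (n % 2) } : Regs) = _
      have h1 : (n + 2) / 2 = n / 2 + 1 := by omega
      have h2 : (n + 2) % 2 = n % 2 := by omega
      rw [h1, h2, ones_add, List.append_assoc]
      rfl

theorem encList_eq {α : Type} (e : α → List Bool) (l : List α) :
    encList e l = l.flatMap (fun a => true :: e a) ++ [false] := by
  induction l with
  | nil => rfl
  | cons a l ih => simp [encList, ih]

theorem bits_even (n : ℕ) : (2 * (n + 1)).bits = false :: (n + 1).bits :=
  Nat.bit0_bits (n + 1) (Nat.succ_ne_zero n)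

theorem runs_writeBinary (n : ℕ) (ha : s.a = ones n) (hh : s.h = []) (hf : s.f = []) :
    Runs writeBinary s { s with a := [], r := (encBinary n).reverse ++ s.r }
      (n * (4 * n + 10) + 2) := by
  suffices H : ∀ n, ∀ {s : Regs}, s.a = ones n → s.h = [] → s.f = [] →
      Runs (.whileTrue .a (halve ;; .ifTrue .f (.push .r true ;; .push .r false ;; .push .h true)
        (.push .r true ;; .push .r true) ;; moveUnary .h .a)) s
        { s with a := [], r := (n.bits.flatMap fun b => [true, b]).reverse ++ s.r }
        (n * (4 * n + 10) + 1) by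
    refine ((H n ha hh hf).seq (Runs.push .r false)).to ?_ (by omega)
    rw [encBinary, encList_eq]
    simp [Regs.set, Regs.get]
  clear ha hh hf
  intro n
  induction n using Nat.strong_induction_on with
  | _ n ih =>
    intro s ha hh hf
    match n with
    | 0 =>
      refine (Runs.whileTrue_nil (k := .a) ha).to ?_ (by omega)
      exact (Regs.set_eq_self (k := .a) ha).symm
    | n + 1 =>
      have r1 := runs_halve n (s := s.set .a (ones n)) rfl hf
      obtain ⟨k, rfl | rfl⟩ : ∃ k, n = 2 * k ∨ n = 2 * k + 1 := ⟨n / 2, by omega⟩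
      · rw [show 2 * k / 2 = k by omega, show 2 * k % 2 = 0 by omega] at r1
        have r2 := Runs.ifTrue_nil (p := (.push .r true ;; .push .r false ;; .push .h true))
          (k := .f) (s := { s with a := [], h := ones k ++ s.h, f := [] }) rfl
          ((Runs.push .r true).seq (Runs.push .r true))
        have r3 := runs_moveUnary
          (s := { s with a := [], h := ones k ++ s.h, f := [], r := true :: true :: s.r }) (k := .h)
          (k' := .a) (by decide) (tl := []) (rest := []) (Or.inr ⟨rfl, rfl⟩) (n := k)
          (by change ones k ++ s.h = _; rw [hh])
        have r4 := ih k (by omega)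
          (s := { s with a := ones k ++ [], h := [], f := [], r := true :: true :: s.r })
          (List.append_nil _) rfl rfl
        refine (Runs.whileTrue_true (k := .a) ha (r1.seq (r2.seq r3)) r4).to ?_ ?_
        · simp [hh, hf]
        · nlinarith
      · rw [show (2 * k + 1) / 2 = k by omega, show (2 * k + 1) % 2 = 1 by omega] at r1
        have r2 := Runs.ifTrue_true (p' := (.push .r true ;; .push .r true)) (k := .f) (l := [])
          (s := { s with a := [], h := ones k ++ s.h, f := ones 1 }) rfl
          ((Runs.push .r true).seq ((Runs.push .r false).seq (Runs.push .h true)))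
        have r3 := runs_moveUnary
          (s := { s with
            a := []
            h := true :: (ones k ++ s.h)
            f := []
            r := false :: true :: s.r })
          (k := .h) (k' := .a) (by decide) (tl := []) (rest := []) (Or.inr ⟨rfl, rfl⟩) (n := k + 1)
          (by change true :: (ones k ++ s.h) = _; rw [hh, ones_succ]; rfl)
        have r4 := ih (k + 1) (by omega)
          (s := { s with a := ones (k + 1) ++ [], h := [], f := [], r := false :: true :: s.r })
          (List.append_nil _) rfl rfl
        refine (Runs.whileTrue_true (k := .a) ha (r1.seq (r2.seq r3)) r4).to ?_ ?_
        · rw [show 2 * k + 1 + 1 = 2 * (k + 1) by ring, bits_even]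
          simp [hh, hf]
        · nlinarith

end Binary

/-! ### Looking up prices -/

/-- Read the code of a stack symbol from the input, copy it in reverse to `k`, and add the price of
the symbol to `k'`. -/
def lookup (k k' : Reg) : Prog Reg :=
  .whileTrue .i (.push k true ;; moveUnary .e .t ;; .push .t false) ;;
  .push k false ;;
  .ifTrue .e (.push .t true ;; .whileTrue .e (.push .t true ;; .push k' true) ;; .push .t false)
    .skip ;;
  reverseOnto .t .e

section Lookup

variable {s : Regs}

theorem flatMap_length_le {ps : List ℕ} {E : ℕ} (hE : ∀ p ∈ ps, p ≤ E) :
    (ps.flatMap fun p => true :: encUnary p).length ≤ ps.length * (E + 2) := by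
  induction ps with
  | nil => simp
  | cons p ps ih =>
    have h1 := hE p List.mem_cons_self
    have h2 := ih fun p hp => hE p (List.mem_cons_of_mem _ hp)
    rw [List.flatMap_cons, List.length_append, List.length_cons, List.length_cons, add_mul,
      length_encUnary]
    omega

theorem runs_lookup {k k' : Reg} (hk : (k = .x ∧ k' = .c) ∨ (k = .y ∧ k' = .b)) {ps : List ℕ}
    {g E : ℕ} {u v : List Bool} (hg : g < ps.length) (hE : ∀ p ∈ ps, p ≤ E) (ht : s.t = [])
    (he : s.e = encList encUnary ps ++ v) (hi : s.i = encUnary g ++ u) :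
    Runs (lookup k k') s (((s.set .i u).set k ((encUnary g).reverse ++ s.get k)).set k'
      (ones ps[g] ++ s.get k')) (17 * ((g + 1) * (E + 1))) := by
  rw [encUnary_append] at hi
  set en : ℕ → List Bool := fun p => true :: encUnary p with hen
  have hen' : ∀ p w, en p ++ w = ones (p + 1) ++ false :: w := fun p w => by
    simp only [hen, List.cons_append, encUnary_append, ones_succ]
  have hrev : ∀ p w, false :: (ones (p + 1) ++ w) = (en p).reverse ++ w := fun p w => by
    simp only [hen, List.reverse_cons, reverse_encUnary, List.cons_append, List.append_assoc,
      List.nil_append]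
    rw [show p + 1 = p + 1 from rfl, ones_add]
    simp [ones]
  have he' : s.e = ps.flatMap en ++ false :: v := by
    rw [he, encList_eq, List.append_assoc]; rfl
  -- pass over the entries before the one sought
  let F : ℕ → Regs := fun m =>
    ({ s with e := (ps.drop m).flatMap en ++ false :: v,
              t := ((ps.take m).flatMap en).reverse ++ s.t } : Regs).set k (ones m ++ s.get k)
  have r1 : Runs (.whileTrue .i (.push k true ;; moveUnary .e .t ;; .push .t false))
      ((F 0).set .i (ones g ++ false :: u)) ((F g).set .i u) (g * (2 * E + 5 + 1) + 1) := by
    refine Runs.whileTrue_ones F _ g (Or.inl rfl) fun m hm w => ?_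
    have hmps : m < ps.length := hm.trans hg
    have hdrop : (ps.drop m).flatMap en ++ false :: v =
        ones (ps[m] + 1) ++ false :: ((ps.drop (m + 1)).flatMap en ++ false :: v) := by
      rw [List.drop_eq_getElem_cons hmps, List.flatMap_cons, List.append_assoc, hen']
    have htake : false :: (ones (ps[m] + 1) ++ (((ps.take m).flatMap en).reverse ++ s.t)) =
        ((ps.take (m + 1)).flatMap en).reverse ++ s.t := by
      rw [hrev, List.take_add_one, List.flatMap_append, List.reverse_append,
        List.getElem?_eq_getElem hmps, Option.toList_some, List.flatMap_singleton,
        List.append_assoc]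
    have hle := hE _ (List.getElem_mem hmps)
    have ra := Runs.push (s := (F m).set .i w) k true
    have rb := runs_moveUnary (s := ((F m).set .i w).set k (true :: ((F m).set .i w).get k))
      (k := .e) (k' := .t) (by decide) (Or.inl rfl) (n := ps[m] + 1)
      (by obtain ⟨rfl, rfl⟩ | ⟨rfl, rfl⟩ := hk <;> exact hdrop)
    refine (ra.seq (rb.seq (Runs.push .t false))).to ?_ (by omega)
    obtain ⟨rfl, rfl⟩ | ⟨rfl, rfl⟩ := hk
    all_goals
      simp only [F]
      rw [← htake]
      rfl
  -- read the entry
  have hdrop : (ps.drop g).flatMap en ++ false :: v =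
      true :: (ones ps[g] ++ false :: ((ps.drop (g + 1)).flatMap en ++ false :: v)) := by
    rw [List.drop_eq_getElem_cons hg, List.flatMap_cons, List.append_assoc, hen']
    rfl
  let t₀ : List Bool := ((ps.take g).flatMap en).reverse ++ s.t
  let e₁ : List Bool := (ps.drop (g + 1)).flatMap en ++ false :: v
  let G : ℕ → Regs := fun m =>
    (({ s with i := u, e := e₁, t := ones m ++ (true :: t₀) } : Regs).set k
      (false :: (ones g ++ s.get k))).set k' (ones m ++ s.get k')
  have r2 : Runs (.whileTrue .e (.push .t true ;; .push k' true))
      ((G 0).set .e (ones ps[g] ++ false :: e₁)) ((G ps[g]).set .e e₁) (ps[g] * (2 + 1) + 1) := by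
    refine Runs.whileTrue_ones G _ _ (Or.inl rfl) fun m hm w => ?_
    refine ((Runs.push .t true).seq (Runs.push k' true)).to ?_ le_rfl
    obtain ⟨rfl, rfl⟩ | ⟨rfl, rfl⟩ := hk <;> rfl
  have r3 : Runs (.ifTrue .e (.push .t true ;; .whileTrue .e (.push .t true ;; .push k' true) ;;
      .push .t false) .skip) (((F g).set .i u).set k (false :: ((F g).set .i u).get k))
      (((G ps[g]).set .e e₁).set .t (false :: ((G ps[g]).set .e e₁).get .t))
      (3 * ps[g] + 4) := by
    refine (Runs.ifTrue_true (l := ones ps[g] ++ false :: e₁) ?_ (((Runs.push .t true).to ?_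
      le_rfl).seq (r2.seq (Runs.push .t false)))).mono (by omega)
    · obtain ⟨rfl, rfl⟩ | ⟨rfl, rfl⟩ := hk <;> exact hdrop
    · obtain ⟨rfl, rfl⟩ | ⟨rfl, rfl⟩ := hk <;> rfl
  -- restore the table
  have hle := hE _ (List.getElem_mem hg)
  have htl : false :: (ones ps[g] ++ (true :: t₀)) = ((ps.take (g + 1)).flatMap en).reverse := by
    have h1 : false :: (ones ps[g] ++ (true :: t₀)) = false :: (ones (ps[g] + 1) ++ t₀) := by
      rw [ones_add, List.append_assoc]; rfl
    rw [h1, hrev, List.take_add_one, List.flatMap_append, List.reverse_append,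
      List.getElem?_eq_getElem hg, Option.toList_some, List.flatMap_singleton]
    simp only [t₀, ht, List.append_nil]
  have r4 := runs_reverseOnto (k := .t) (k' := .e) (l := ((ps.take (g + 1)).flatMap en).reverse)
    (s := (((G ps[g]).set .e e₁).set .t (false :: ((G ps[g]).set .e e₁).get .t)))
    (by decide) (by
      rw [← htl]
      obtain ⟨rfl, rfl⟩ | ⟨rfl, rfl⟩ := hk <;> rfl)
  have hF : s = (F 0).set .i (ones g ++ false :: u) := by
    rw [← hi]
    simp only [F, List.drop_zero, List.take_zero, ← he']
    obtain ⟨rfl, rfl⟩ | ⟨rfl, rfl⟩ := hk <;> rfl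
  have hlen : ((ps.take (g + 1)).flatMap en).reverse.length ≤ (g + 1) * (E + 2) := by
    rw [List.length_reverse]
    refine (flatMap_length_le fun p hp => hE p (List.mem_of_mem_take hp)).trans ?_
    exact Nat.mul_le_mul_right _ (by simp)
  have hfinal := r1.seq ((Runs.push k false).seq (r3.seq r4))
  rw [← hF] at hfinal
  refine hfinal.to ?_ ?_
  · rw [List.reverse_reverse, reverse_encUnary]
    have h5 : (ps.take (g + 1)).flatMap en ++ e₁ = s.e := by
      simp only [e₁]
      rw [he', ← List.append_assoc, ← List.flatMap_append, List.take_append_drop]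
    obtain ⟨rfl, rfl⟩ | ⟨rfl, rfl⟩ := hk
    · change ({ s with
        i := u
        e := (ps.take (g + 1)).flatMap en ++ e₁
        t := []
        x := false :: (ones g ++ s.x)
        c := ones ps[g] ++ s.c } : Regs) = _
      rw [h5, ← ht]
      rfl
    · change ({ s with
        i := u
        e := (ps.take (g + 1)).flatMap en ++ e₁
        t := []
        y := false :: (ones g ++ s.y)
        b := ones ps[g] ++ s.b } : Regs) = _
      rw [h5, ← ht]
      rfl
  · have : (g + 1) * (E + 2) = (g + 1) * (E + 1) + (g + 1) := by ring
    have h6 : g * (2 * E + 5 + 1) = 2 * (g * (E + 1)) + 4 * g := by ring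
    have h7 : (g + 1) * (E + 1) = g * (E + 1) + (E + 1) := by ring
    have h8 : g ≤ g * (E + 1) := Nat.le_mul_of_pos_right _ (by omega)
    omega

end Lookup

/-! ### Preparing the input -/

/-- Copy the input to `e` and count its length in `l`. -/
def scan : Prog Reg :=
  .drain .i (.push .t true ;; .push .l true) (.push .t false ;; .push .l true) ;;
  reverseOnto₂ .t .i .e

/-- Compute the sixth and seventh power of the number in `l`, which is removed. -/
def powers : Prog Reg :=
  copy .l .d ;; mulStep ;; mulStep ;; mulStep ;; mulStep ;; mulStep ;;
  copy .d .a ;; mulOnto .a .l .w ;; clear .l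

/-- Remove a coded list of numbers in unary from `k`. -/
def skipList (k : Reg) : Prog Reg :=
  .whileTrue k (skipUnary k)

/-- Remove a coded transition from `e`. -/
def skipTransition : Prog Reg :=
  skipUnary .e ;; skipUnary .e ;; .ifTrue .e (skipUnary .e) .skip ;; skipUnary .e ;; skipList .e

/-- Remove a coded automaton from `e`. -/
def skipPDA : Prog Reg :=
  skipUnary .e ;; skipUnary .e ;; skipUnary .e ;; skipList .e ;; skipList .e ;;
  .whileTrue .e skipTransition

/-- All stacks are empty. -/
def blank : Regs :=
  ⟨[], [], [], [], [], [], [], [], [], [], [], [], [], [], [], [], [], [], []⟩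

/-- The stacks between the main parts of the program. -/
def idle (i e r : List Bool) (D W : ℕ) : Regs :=
  { blank with i := i, e := e, r := r, d := ones D, w := ones W }

section Prepare

theorem runs_scan (u : List Bool) :
    Runs scan { blank with i := u } { blank with i := u, e := u, l := ones u.length }
      (6 * u.length + 2) := by
  have r1 := Runs.drain (k := .i) (p := (.push .t true ;; .push .l true))
    (p' := (.push .t false ;; .push .l true))
    (fun v => { blank with t := v.reverse, l := ones v.length }) 2 u
    (fun v w => ((Runs.push .t true).seq (Runs.push .l true)).to
      (by rw [List.reverse_append, List.length_append]; rfl) le_rfl)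
    (fun v w => ((Runs.push .t false).seq (Runs.push .l true)).to
      (by rw [List.reverse_append, List.length_append]; rfl) le_rfl)
  have r2 := runs_reverseOnto₂ (s := { blank with t := u.reverse, l := ones u.length }) (k := .t)
    (k₁ := .i) (k₂ := .e) (by decide) (by decide) (by decide) (l := u.reverse) rfl
  refine (r1.seq r2).to ?_ (by rw [List.length_reverse]; omega)
  rw [List.reverse_reverse]
  change ({ blank with i := u ++ [], e := u ++ [], l := ones u.length } : Regs) = _
  rw [List.append_nil]

theorem runs_powers (u e : List Bool) {L V : ℕ} (hV : L ^ 7 ≤ V) (hL : 1 ≤ L) :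
    Runs powers { blank with i := u, e := e, l := ones L } (idle u e [] (L ^ 6) (L ^ 7))
      (100 * V) := by
  let st : ℕ → Regs := fun m => { blank with i := u, e := e, l := ones L, d := ones m }
  have hle : ∀ k ≤ 7, L ^ k ≤ V := fun k hk => (Nat.pow_le_pow_right hL hk).trans hV
  have hs : ∀ k ≤ 6, Runs mulStep (st (L ^ k)) (st (L ^ (k + 1))) (12 * V) := fun k hk => by
    refine (runs_mulStep (s := st (L ^ k)) (m := L ^ k) (n := L) rfl rfl rfl rfl).to ?_ ?_
    · rw [← pow_succ]
    · have h1 := hle k (by omega)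
      have h2 := hle (k + 1) (by omega)
      have h3 := hle 0 (by omega)
      rw [pow_succ] at h2
      rw [pow_zero] at h3
      nlinarith
  have r0 := runs_copy (s := { blank with i := u, e := e, l := ones L }) (k := .l) (k' := .d)
    (by decide) (by decide) (by decide) rfl (l := ones L) rfl
  have r6 := runs_copy (s := st (L ^ 6)) (k := .d) (k' := .a) (by decide) (by decide) (by decide)
    rfl (l := ones (L ^ 6)) rfl
  have r7 := runs_mulOnto (s := (st (L ^ 6)).set .a (ones (L ^ 6) ++ [])) (k := .a) (k₁ := .l)
    (k₂ := .w) (by decide) (by decide) (by decide) (by decide) (by decide) (by decide) rfl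
    (Or.inr ⟨rfl, rfl⟩) (m := L ^ 6) (n := L) rfl rfl
  have r8 := runs_clear
    (s := { st (L ^ 6) with w := ones (L ^ 6 * L) ++ [] }) .l
  have h1 := hs 1 (by omega)
  rw [pow_one] at h1
  replace r0 : Runs (copy .l .d) { blank with i := u, e := e, l := ones L } (st L) (5 * L + 2) :=
    r0.to (by
      change ({ blank with i := u, e := e, l := ones L, d := ones L ++ [] } : Regs) = _
      rw [List.append_nil]) (by rw [length_ones])
  refine (r0.seq (h1.seq ((hs 2 (by omega)).seq ((hs 3 (by omega)).seq ((hs 4 (by omega)).seq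
    ((hs 5 (by omega)).seq (r6.seq (r7.seq r8)))))))).to ?_ ?_
  · rw [← pow_succ]
    change ({ blank with i := u, e := e, d := ones (L ^ 6), w := ones (L ^ 7) ++ [] } : Regs) = _
    rw [List.append_nil]
    rfl
  · change _ + (_ + (_ + (_ + (_ + (_ + (5 * (ones (L ^ 6)).length + 2 + (_ +
      (2 * (ones L).length + 1)))))))) ≤ _
    rw [length_ones, length_ones]
    have h2 := hle 1 (by omega)
    have h3 := hle 6 (by omega)
    have h4 := hle 7 (by omega)
    rw [pow_one] at h2
    have h5 : L ^ 6 * (5 * L + 3) = 5 * L ^ 7 + 3 * L ^ 6 := by ring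
    omega

theorem runs_skipList {s : Regs} {α : Type} (val : α → ℕ) (k : Reg) (l : List α)
    {rest : List Bool} {E : ℕ} (hE : ∀ x ∈ l, val x ≤ E)
    (h : s.get k = encList (fun x => encUnary (val x)) l ++ rest) :
    Runs (skipList k) s (s.set k rest) (l.length * (2 * E + 2) + 1) := by
  have := Runs.whileTrue_list (p := skipUnary k) (k := k) (e := fun x => encUnary (val x))
    (fun _ => s) (2 * E + 1) l rest fun _ x hx u =>
      (runs_skipUnary k (Regs.get_set_self _ _ _)).to (Regs.set_set _ _ _ _)
        (by have := hE x hx; omega)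
  rwa [Regs.set_eq_self h] at this

theorem runs_skipUnary_set (s : Regs) (k : Reg) (n : ℕ) (rest : List Bool) :
    Runs (skipUnary k) (s.set k (encUnary n ++ rest)) (s.set k rest) (2 * n + 1) :=
  (runs_skipUnary k (Regs.get_set_self _ _ _)).to (Regs.set_set _ _ _ _) le_rfl

theorem encTrans_append {a g q : ℕ} (t : Fin q × Fin a × Option (Fin g) × Fin q × List (Fin g))
    (u : List Bool) : encTrans t ++ u = encUnary t.1 ++ (encUnary t.2.1 ++
      (encOption encFin t.2.2.1 ++ (encUnary t.2.2.2.1 ++ (encList encFin t.2.2.2.2 ++ u)))) := by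
  simp only [encTrans, encFin, List.append_assoc]

theorem runs_skipTransition {s : Regs} {a g q V : ℕ}
    (t : Fin q × Fin a × Option (Fin g) × Fin q × List (Fin g)) {u : List Bool}
    (hq : q ≤ V) (ha : a ≤ V) (hg : g ≤ V) (hy : t.2.2.2.2.length ≤ V) (hV : 1 ≤ V)
    (h : s.e = encTrans t ++ u) :
    Runs skipTransition s (s.set .e u) (30 * V ^ 2) := by
  rw [encTrans_append] at h
  have r1 := runs_skipUnary (s := s) .e h
  have r3 : Runs (.ifTrue .e (skipUnary .e) .skip) (s.set .e (encOption encFin t.2.2.1 ++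
      (encUnary t.2.2.2.1 ++ (encList encFin t.2.2.2.2 ++ u))))
      (s.set .e (encUnary t.2.2.2.1 ++ (encList encFin t.2.2.2.2 ++ u))) (2 * V + 2) := by
    cases hx : t.2.2.1 with
    | none => exact (Runs.ifTrue_false (k := .e) rfl Runs.skip).mono (by omega)
    | some x =>
      exact (Runs.ifTrue_true (k := .e) rfl (runs_skipUnary (n := x) .e rfl)).mono (by omega)
  have r5 := runs_skipList (s := s.set .e (encList encFin t.2.2.2.2 ++ u))
    (fun x : Fin g => (x : ℕ)) .e t.2.2.2.2 (E := V) (fun x _ => by omega)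
    (Regs.get_set_self s _ _)
  rw [Regs.set_set] at r5
  refine (r1.seq ((runs_skipUnary_set s .e _ _).seq (r3.seq
    ((runs_skipUnary_set s .e _ _).seq r5)))).mono ?_
  have h1 : t.2.2.2.2.length * (2 * V + 2) ≤ V * (2 * V + 2) := Nat.mul_le_mul_right _ hy
  have := t.1.2
  have := t.2.1.2
  have := t.2.2.2.1.2
  nlinarith

/-- Bounds on the parts of an automaton. -/
structure PDACode.SizeLE (M : PDACode) (V : ℕ) : Prop where
  letters : M.numLetters ≤ V
  symbols : M.numSymbols ≤ V
  states : M.numStates ≤ V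
  init : M.init.length ≤ V
  acc : M.acc.length ≤ V
  trans : M.trans.length ≤ V
  word : ∀ t ∈ M.trans, t.2.2.2.2.length ≤ V

theorem runs_skipPDA {s : Regs} {M : PDACode} {u : List Bool} {V : ℕ} (hM : M.SizeLE V)
    (hV : 1 ≤ V) (h : s.e = encPDA M ++ u) :
    Runs skipPDA s (s.set .e u) (70 * V ^ 3) := by
  have h' : s.e = encUnary M.numLetters ++ (encUnary M.numSymbols ++ (encUnary M.numStates ++
      (encList encFin M.init ++ (encList encFin M.acc ++ (encList encTrans M.trans ++ u))))) := by
    rw [h]; simp only [encPDA, List.append_assoc]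
  have r1 := runs_skipUnary (s := s) .e h'
  have r4 := runs_skipList (s := s.set .e (encList encFin M.init ++ (encList encFin M.acc ++
    (encList encTrans M.trans ++ u)))) (fun x : Fin M.numStates => (x : ℕ)) .e M.init (E := V)
    (fun x _ => by have := hM.states; omega) (Regs.get_set_self s _ _)
  have r5 := runs_skipList (s := s.set .e (encList encFin M.acc ++ (encList encTrans M.trans ++ u)))
    (fun x : Fin M.numStates => (x : ℕ)) .e M.acc (E := V)
    (fun x _ => by have := hM.states; omega) (Regs.get_set_self s _ _)
  rw [Regs.set_set] at r4 r5
  have r6 := Runs.whileTrue_list (p := skipTransition) (k := .e) (e := encTrans) (fun _ => s)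
    (30 * V ^ 2) M.trans u fun _ t ht v =>
      (runs_skipTransition (s := s.set .e (encTrans t ++ v)) t hM.states hM.letters hM.symbols
        (hM.word t ht) hV rfl).to (Regs.set_set _ _ _ _) le_rfl
  refine (r1.seq ((runs_skipUnary_set s .e _ _).seq ((runs_skipUnary_set s .e _ _).seq
    (r4.seq (r5.seq r6))))).mono ?_
  have h1 : M.init.length * (2 * V + 2) ≤ V * (2 * V + 2) := Nat.mul_le_mul_right _ hM.init
  have h2 : M.acc.length * (2 * V + 2) ≤ V * (2 * V + 2) := Nat.mul_le_mul_right _ hM.acc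
  have h3 : M.trans.length * (30 * V ^ 2 + 1) ≤ V * (30 * V ^ 2 + 1) :=
    Nat.mul_le_mul_right _ hM.trans
  have h4 := hM.letters
  have h5 := hM.symbols
  have h6 := hM.states
  have h7 : V ≤ V ^ 3 := Nat.le_self_pow (by omega) V
  have h8 : V ^ 2 ≤ V ^ 3 := Nat.pow_le_pow_right hV (by omega)
  have h9 : V * (2 * V + 2) = 2 * V ^ 2 + 2 * V := by ring
  have h10 : V * (30 * V ^ 2 + 1) = 30 * V ^ 3 + V := by ring
  omega

end Prepare

/-! ### Writing the automaton -/

/-- Write the numbers of letters, stack symbols and states. -/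
def writeHeader : Prog Reg :=
  copy .w .r ;; .push .r false ;; skipUnary .i ;; moveUnary .i .r ;; .push .r false ;;
  mulOnto .i .w .r ;; .push .r false

/-- Write the initial states. -/
def writeInit : Prog Reg :=
  .whileTrue .i (.push .r true ;; mulOnto .i .w .r ;; .push .r false) ;; .push .r false

/-- Write the accepting states. -/
def writeAcc : Prog Reg :=
  .whileTrue .i (mulOnto .i .w .a ;; copy .w .n ;;
    .whileTrue .n (.push .r true ;; copy .a .r ;; copy .j .r ;; .push .r false ;; .push .j true) ;;
    clear .a ;; clear .j) ;;
  .push .r false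

section Write

theorem ones_append_ones_append (m n : ℕ) (u : List Bool) :
    ones m ++ (ones n ++ u) = ones (m + n) ++ u := by
  rw [ones_add, List.append_assoc]

variable {e r u : List Bool} {D W V : ℕ}

theorem runs_writeHeader {nL nS nQ : ℕ} (hW : W ≤ V) (hL : nL ≤ V) (hS : nS ≤ V) (hQ : nQ ≤ V)
    (hV : 1 ≤ V) :
    Runs writeHeader (idle (encUnary nL ++ (encUnary nS ++ (encUnary nQ ++ u))) e r D W)
      (idle u e ((encUnary W ++ (encUnary nS ++ encUnary (nQ * W))).reverse ++ r) D W)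
      (30 * V ^ 2) := by
  have r1 := runs_copy (s := idle (encUnary nL ++ (encUnary nS ++ (encUnary nQ ++ u))) e r D W)
    (k := .w) (k' := .r) (by decide) (by decide) (by decide) rfl (l := ones W) rfl
  have r2 := runs_skipUnary (s := idle (encUnary nL ++ (encUnary nS ++ (encUnary nQ ++ u))) e
    (false :: (ones W ++ r)) D W) .i rfl
  have r3 := runs_moveUnary (s := idle (encUnary nS ++ (encUnary nQ ++ u)) e
    (false :: (ones W ++ r)) D W) (k := .i) (k' := .r) (by decide) (Or.inl rfl) (n := nS)
    (encUnary_append _ _)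
  have r4 := runs_mulOnto (s := idle (encUnary nQ ++ u) e
    (false :: (ones nS ++ (false :: (ones W ++ r)))) D W) (k := .i) (k₁ := .w) (k₂ := .r)
    (by decide) (by decide) (by decide) (by decide) (by decide) (by decide) rfl
    (Or.inl rfl) (m := nQ) (n := W) (encUnary_append _ _) rfl
  refine (r1.seq ((Runs.push .r false).seq (r2.seq (r3.seq ((Runs.push .r false).seq (r4.seq
    (Runs.push .r false))))))).to ?_ ?_
  · change idle u e
      (false :: (ones (nQ * W) ++ (false :: (ones nS ++ (false :: (ones W ++ r)))))) D W = _
    simp [reverse_encUnary]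
  · rw [length_ones]
    have h1 : nQ * (5 * W + 3) ≤ V * (5 * V + 3) := Nat.mul_le_mul hQ (by omega)
    have h2 : V ≤ V ^ 2 := Nat.le_self_pow (by omega) V
    have h3 : V * (5 * V + 3) = 5 * V ^ 2 + 3 * V := by ring
    omega

theorem runs_writeInit {nQ : ℕ} (l : List (Fin nQ)) (hl : l.length ≤ V) (hW : W ≤ V)
    (hQ : nQ ≤ V) (hV : 1 ≤ V) :
    Runs writeInit (idle (encList encFin l ++ u) e r D W)
      (idle u e ((encList (fun q : Fin nQ => encUnary (q * W)) l).reverse ++ r) D W)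
      (20 * V ^ 3) := by
  have r1 := Runs.whileTrue_list (p := (.push .r true ;; mulOnto .i .w .r ;; .push .r false))
    (k := .i) (e := encFin (n := nQ))
    (fun l => idle [] e ((l.flatMap fun q : Fin nQ => true :: encUnary (q * W)).reverse ++ r) D W)
    (5 * V ^ 2 + 3 * V + 3) l u fun pre x hx v => by
      have r2 := runs_mulOnto (s := idle (encFin x ++ v) e (true ::
        ((pre.flatMap fun q : Fin nQ => true :: encUnary (q * W)).reverse ++ r)) D W)
        (k := .i) (k₁ := .w) (k₂ := .r)
        (by decide) (by decide) (by decide) (by decide) (by decide) (by decide) rfl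
        (Or.inl rfl) (m := x) (n := W) (encUnary_append _ _) rfl
      refine ((Runs.push .r true).seq (r2.seq (Runs.push .r false))).to ?_ ?_
      · change idle v e (false :: (ones (x * W) ++ (true ::
          ((pre.flatMap fun q : Fin nQ => true :: encUnary (q * W)).reverse ++ r)))) D W =
          idle v e (((pre ++ [x]).flatMap fun q : Fin nQ => true :: encUnary (q * W)).reverse ++ r)
            D W
        simp [reverse_encUnary]
      · have h1 : (x : ℕ) * (5 * W + 3) ≤ V * (5 * V + 3) := Nat.mul_le_mul (by omega) (by omega)
        have h3 : V * (5 * V + 3) = 5 * V ^ 2 + 3 * V := by ring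
        omega
  refine (r1.seq (Runs.push .r false)).to ?_ ?_
  · rw [encList_eq]
    simp [Regs.set, Regs.get, idle]
  · have h1 : l.length * (5 * V ^ 2 + 3 * V + 3 + 1) ≤ V * (5 * V ^ 2 + 3 * V + 3 + 1) :=
      Nat.mul_le_mul_right _ hl
    have h2 : V * (5 * V ^ 2 + 3 * V + 3 + 1) = 5 * V ^ 3 + 3 * V ^ 2 + 4 * V := by ring
    have h3 : V ≤ V ^ 3 := Nat.le_self_pow (by omega) V
    have h4 : V ^ 2 ≤ V ^ 3 := Nat.pow_le_pow_right hV (by omega)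
    omega

theorem runs_writeAcc {nQ : ℕ} (l : List (Fin nQ)) (hl : l.length ≤ V) (hW : W ≤ V)
    (hQ : nQ * W ≤ V) (hQ' : nQ ≤ V) (hV : 1 ≤ V) :
    Runs writeAcc (idle (encList encFin l ++ u) e r D W)
      (idle u e ((encList encUnary (l.flatMap fun q : Fin nQ =>
        (List.range W).map fun m => q * W + m)).reverse ++ r) D W)
      (60 * V ^ 3) := by
  let out : Fin nQ → ℕ → List Bool := fun q m => true :: encUnary (q * W + m)
  have r1 := Runs.whileTrue_list (p := (mulOnto .i .w .a ;; copy .w .n ;;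
    .whileTrue .n (.push .r true ;; copy .a .r ;; copy .j .r ;; .push .r false ;; .push .j true) ;;
    clear .a ;; clear .j)) (k := .i) (e := encFin (n := nQ)) (rest := u)
    (fun l => idle [] e ((l.flatMap fun q => (List.range W).flatMap (out q)).reverse ++ r) D W)
    (50 * V ^ 2) l fun pre x hx v => by
      set r' : List Bool := (pre.flatMap fun q => (List.range W).flatMap (out q)).reverse ++ r
      have r2 := runs_mulOnto (s := idle (encFin x ++ v) e r' D W)
        (k := .i) (k₁ := .w) (k₂ := .a)
        (by decide) (by decide) (by decide) (by decide) (by decide) (by decide) rfl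
        (Or.inl rfl) (m := x) (n := W) (encUnary_append _ _) rfl
      have r3 := runs_copy (s := { idle v e r' D W with a := ones (x * W) ++ [] })
        (k := .w) (k' := .n) (by decide) (by decide) (by decide) rfl (l := ones W) rfl
      have hxW : (x : ℕ) * W ≤ V := (Nat.mul_le_mul_right W x.2.le).trans hQ
      have r4 := Runs.whileTrue_ones (k := .n)
        (p := (.push .r true ;; copy .a .r ;; copy .j .r ;; .push .r false ;; .push .j true))
        (fun m => { idle v e (((List.range m).flatMap (out x)).reverse ++ r') D W with
          a := ones (x * W) ++ [], j := ones m }) (10 * V + 7) W (Or.inr ⟨rfl, rfl⟩)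
        fun m hm w => by
          have ra := runs_copy (s := { idle v e (true :: (((List.range m).flatMap (out x)).reverse
            ++ r')) D W with a := ones (x * W) ++ [], j := ones m, n := w }) (k := .a) (k' := .r)
            (by decide) (by decide) (by decide) rfl (l := ones (x * W)) (List.append_nil _)
          have rb := runs_copy (s := { idle v e (ones (x * W) ++ true ::
            (((List.range m).flatMap (out x)).reverse ++ r')) D W with
              a := ones (x * W) ++ [], j := ones m, n := w })
            (k := .j) (k' := .r) (by decide) (by decide) (by decide) rfl (l := ones m) rfl
          refine ((Runs.push .r true).seq (ra.seq (rb.seq ((Runs.push .r false).seq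
            (Runs.push .j true))))).to ?_ ?_
          · change ({ idle v e (false :: (ones m ++ (ones (x * W) ++ true ::
              (((List.range m).flatMap (out x)).reverse ++ r')))) D W with
              a := ones (x * W) ++ [], j := ones (m + 1), n := w } : Regs) =
              { idle v e (((List.range (m + 1)).flatMap (out x)).reverse ++ r') D W with
                a := ones (x * W) ++ [], j := ones (m + 1), n := w }
            rw [List.range_succ, List.flatMap_append, List.reverse_append, List.flatMap_singleton]
            simp only [out, List.reverse_cons, reverse_encUnary, ones_append_ones_append]
            rw [add_comm m]
            simp
          · rw [length_ones, length_ones]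
            omega
      have r5 := runs_clear (s := { idle v e (((List.range W).flatMap (out x)).reverse ++ r') D W
        with a := ones (x * W) ++ [], j := ones W }) .a
      have r6 := runs_clear (s := { idle v e (((List.range W).flatMap (out x)).reverse ++ r') D W
        with j := ones W }) .j
      refine (r2.seq (r3.seq (r4.seq (r5.seq r6)))).to ?_ ?_
      · change idle v e (((List.range W).flatMap (out x)).reverse ++ r') D W = idle v e
          (((pre ++ [x]).flatMap fun q => (List.range W).flatMap (out q)).reverse ++ r) D W
        simp only [r', List.flatMap_append, List.reverse_append, List.flatMap_singleton,
          List.append_assoc]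
      · change _ + (_ + (_ + (2 * (ones (x * W) ++ []).length + 1 +
          (2 * (ones W).length + 1)))) ≤ _
        rw [List.append_nil, length_ones, length_ones]
        have h1 : (x : ℕ) * (5 * W + 3) ≤ V * (5 * V + 3) := Nat.mul_le_mul (by omega) (by omega)
        have h2 : W * (10 * V + 7 + 1) ≤ V * (10 * V + 7 + 1) := Nat.mul_le_mul_right _ hW
        have h3 : V * (5 * V + 3) = 5 * V ^ 2 + 3 * V := by ring
        have h4 : V * (10 * V + 7 + 1) = 10 * V ^ 2 + 8 * V := by ring
        have h5 : V ≤ V ^ 2 := Nat.le_self_pow (by omega) V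
        omega
  refine (r1.seq (Runs.push .r false)).to ?_ ?_
  · rw [encList_eq]
    simp [Regs.set, Regs.get, idle, List.flatMap_assoc, List.flatMap_map, out]
  · have h1 : l.length * (50 * V ^ 2 + 1) ≤ V * (50 * V ^ 2 + 1) := Nat.mul_le_mul_right _ hl
    have h2 : V * (50 * V ^ 2 + 1) = 50 * V ^ 3 + V := by ring
    have h3 : V ≤ V ^ 3 := Nat.le_self_pow (by omega) V
    omega

end Write

/-! ### Writing the transitions -/

/-- Write one transition of the cost-tracking automaton. -/
def emit : Prog Reg :=
  .push .r true ;; copy .q .r ;; copy .c .r ;; copy .j .r ;; .push .r false ;;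
  copy .c .r ;; copy .j .r ;; .push .r false ;; copy .x .r ;;
  copy .p .r ;; copy .b .r ;; copy .j .r ;; .push .r false ;; copy .y .r ;; .push .j true

/-- Read a stack symbol or `⊥`. -/
def readTop : Prog Reg :=
  .ifTrue .i (.push .x true ;; lookup .x .c) (.push .x false)

/-- Read a word of stack symbols. -/
def readWord : Prog Reg :=
  .whileTrue .i (.push .y true ;; lookup .y .b) ;; .push .y false

/-- Read a transition and write its variants in the cost-tracking automaton. -/
def record : Prog Reg :=
  mulOnto .i .w .q ;; skipUnary .i ;; readTop ;; mulOnto .i .w .p ;; readWord ;;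
  copy .d .n ;; .whileTrue .n emit ;;
  clear .q ;; clear .c ;; clear .x ;; clear .p ;; clear .b ;; clear .y ;; clear .j

/-- Write the transitions. -/
def writeTrans : Prog Reg :=
  .whileTrue .i record ;; .push .r false

/-- The code, with `true` in front, of a transition of the cost-tracking automaton; `A` and `B` are
the offsets of the source and target states, `C` and `E` the costs of the popped symbol and the
pushed word, coded by `X` and `Y`, and `m` is the cost of the stack below the top. -/
def transString (A C B E : ℕ) (X Y : List Bool) (m : ℕ) : List Bool :=
  true :: (encUnary (A + (C + m)) ++ (encUnary (C + m) ++ (X ++ (encUnary (B + (E + m)) ++ Y))))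

section Transitions

variable {V : ℕ}

theorem runs_copy_output {s : Regs} {k : Reg} (hk : k ≠ .t) (hk' : k ≠ .r) (ht : s.t = [])
    {l : List Bool} (h : s.get k = l) (hl : l.length ≤ V) (v : List Bool) :
    Runs (copy k .r) (s.set .r v) (s.set .r (l ++ v)) (5 * V + 2) :=
  (runs_copy hk (by decide) hk' (s := s.set .r v) ht
    ((Regs.get_set_of_ne _ hk' _).trans h)).to
    (by rw [Regs.get_set_self, Regs.set_set]) (by omega)

theorem runs_push_output (s : Regs) (b : Bool) (v : List Bool) :
    Runs (.push .r b) (s.set .r v) (s.set .r (b :: v)) 1 :=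
  Runs.push .r b

theorem runs_emit {s : Regs} {A C B E m : ℕ} {X Y : List Bool} (ht : s.t = [])
    (hq : s.q = ones A) (hc : s.c = ones C) (hp : s.p = ones B) (hb : s.b = ones E)
    (hx : s.x = X.reverse) (hy : s.y = Y.reverse) (hj : s.j = ones m)
    (hA : A ≤ V) (hC : C ≤ V) (hB : B ≤ V) (hE : E ≤ V) (hX : X.length ≤ V) (hY : Y.length ≤ V)
    (hm : m ≤ V) :
    Runs emit s ((s.set .r ((transString A C B E X Y m).reverse ++ s.r)).set .j (ones (m + 1)))
      (50 * V + 25) := by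
  have rq := fun v => runs_copy_output (k := .q) (by decide) (by decide) ht hq
    ((length_ones A).trans_le hA) v
  have rc := fun v => runs_copy_output (k := .c) (by decide) (by decide) ht hc
    ((length_ones C).trans_le hC) v
  have rj := fun v => runs_copy_output (k := .j) (by decide) (by decide) ht hj
    ((length_ones m).trans_le hm) v
  have rp := fun v => runs_copy_output (k := .p) (by decide) (by decide) ht hp
    ((length_ones B).trans_le hB) v
  have rb := fun v => runs_copy_output (k := .b) (by decide) (by decide) ht hb
    ((length_ones E).trans_le hE) v
  have rx := fun v => runs_copy_output (k := .x) (by decide) (by decide) ht hx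
    (List.length_reverse.trans_le hX) v
  have ry := fun v => runs_copy_output (k := .y) (by decide) (by decide) ht hy
    (List.length_reverse.trans_le hY) v
  refine (((Runs.push .r true).seq ((rq _).seq ((rc _).seq ((rj _).seq ((runs_push_output s _ _).seq
    ((rc _).seq ((rj _).seq ((runs_push_output s _ _).seq ((rx _).seq ((rp _).seq ((rb _).seq
    ((rj _).seq ((runs_push_output s _ _).seq ((ry _).seq
    (Runs.push .j true))))))))))))))).to ?_ (by omega))
  rw [Regs.get_set_of_ne _ (by decide), show s.get .j = ones m from hj, ← ones_succ]
  congr 2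
  simp only [transString, List.reverse_cons, List.reverse_append, reverse_encUnary,
    ones_append_ones_append, List.append_assoc, List.cons_append, List.nil_append]
  rw [show m + (E + B) = B + (E + m) by omega, show m + (C + A) = A + (C + m) by omega,
    add_comm m C]
  rfl

variable {nS : ℕ} {price : Fin nS → ℕ} {rest : List Bool}

theorem runs_readTop {s : Regs} {u : List Bool} (x : Option (Fin nS)) (hS : nS ≤ V)
    (hE : ∀ g, price g < V) (hV : 1 ≤ V) (ht : s.t = []) (hx : s.x = []) (hc : s.c = [])
    (he : s.e = encList encUnary (List.ofFn price) ++ rest) (hi : s.i = encOption encFin x ++ u) :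
    Runs readTop s { s with i := u, x := (encOption encFin x).reverse,
                            c := ones (topCost price x) } (20 * V ^ 2) := by
  have h1 : V ≤ V ^ 2 := Nat.le_self_pow (by omega) V
  cases x with
  | none =>
    refine (Runs.ifTrue_false (k := .i) hi (Runs.push .x false)).to ?_ (by omega)
    change ({ s with i := u, x := false :: s.x } : Regs) =
      { s with i := u, x := [false], c := ones 0 }
    rw [hx]
    exact Regs.ext rfl rfl rfl rfl rfl rfl rfl rfl rfl rfl rfl rfl rfl rfl hc rfl rfl rfl rfl
  | some g =>
    have r := runs_lookup (s := { s with i := encUnary g ++ u, x := true :: s.x }) (k := .x)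
      (k' := .c) (Or.inl ⟨rfl, rfl⟩) (ps := List.ofFn price) (g := g) (E := V - 1) (u := u)
      (v := rest) (by simp) (fun p hp => by
        obtain ⟨g, rfl⟩ := List.mem_ofFn.1 hp
        have := hE g
        omega) ht he rfl
    refine (Runs.ifTrue_true (k := .i) hi ((Runs.push .x true).seq r)).to ?_ ?_
    · change ({ s with
        i := u
        x := (encUnary g).reverse ++ true :: s.x
        c := ones (List.ofFn price)[(g : ℕ)] ++ s.c } : Regs) = _
      simp [hx, hc, encOption, encFin, topCost]
    · have h2 : ((g : ℕ) + 1) * (V - 1 + 1) ≤ V * V :=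
        Nat.mul_le_mul (by omega) (by omega)
      have h3 : V * V = V ^ 2 := by ring
      omega

theorem runs_readWord {s : Regs} {u : List Bool} (y : List (Fin nS)) (hS : nS ≤ V)
    (hE : ∀ g, price g < V) (hV : 1 ≤ V) (hl : y.length ≤ V) (ht : s.t = []) (hy : s.y = [])
    (hb : s.b = []) (he : s.e = encList encUnary (List.ofFn price) ++ rest)
    (hi : s.i = encList encFin y ++ u) :
    Runs readWord s { s with i := u, y := (encList encFin y).reverse,
                             b := ones (wordCost price y) } (22 * V ^ 3) := by
  let st : List (Fin nS) → Regs := fun y =>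
    { s with y := (y.flatMap fun g => true :: encFin g).reverse, b := ones (wordCost price y) }
  have r := Runs.whileTrue_list (p := (.push .y true ;; lookup .y .b)) (k := .i)
    (e := encFin (n := nS)) st (17 * V ^ 2 + 1) y u fun pre g _ v => by
      have r := runs_lookup (s := { st pre with
          i := encUnary g ++ v, y := true :: (st pre).y }) (k := .y)
        (k' := .b) (Or.inr ⟨rfl, rfl⟩) (ps := List.ofFn price) (g := g) (E := V - 1) (u := v)
        (v := rest) (by simp) (fun p hp => by
          obtain ⟨g, rfl⟩ := List.mem_ofFn.1 hp
          have := hE g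
          omega) ht he rfl
      refine ((Runs.push .y true).seq r).to ?_ ?_
      · change ({ s with
          i := v
          y := (encUnary g).reverse ++
            true :: (pre.flatMap fun g => true :: encFin g).reverse
          b := ones (List.ofFn price)[(g : ℕ)] ++ ones (wordCost price pre) } : Regs) =
          { s with
            i := v
            y := ((pre ++ [g]).flatMap fun g => true :: encFin g).reverse
            b := ones (wordCost price (pre ++ [g])) }
        rw [← ones_add, wordCost_append, wordCost_singleton, add_comm (wordCost price pre)]
        simp [encFin]
      · have h2 : ((g : ℕ) + 1) * (V - 1 + 1) ≤ V * V :=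
          Nat.mul_le_mul (by omega) (by omega)
        have h3 : V * V = V ^ 2 := by ring
        omega
  have hst : (st []).set .i (encList encFin y ++ u) = s :=
    Regs.ext hi.symm rfl rfl rfl rfl rfl rfl rfl rfl rfl rfl rfl rfl rfl rfl rfl hb.symm rfl
      hy.symm
  rw [hst] at r
  refine (r.seq (Runs.push .y false)).to ?_ ?_
  · change ({ s with
      i := u
      y := false :: (y.flatMap fun g => true :: encFin g).reverse
      b := ones (wordCost price y) } : Regs) = _
    simp [encList_eq]
  · have h1 : y.length * (17 * V ^ 2 + 1 + 1) ≤ V * (17 * V ^ 2 + 1 + 1) :=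
      Nat.mul_le_mul_right _ hl
    have h2 : V * (17 * V ^ 2 + 1 + 1) = 17 * V ^ 3 + 2 * V := by ring
    have h3 : V ≤ V ^ 3 := Nat.le_self_pow (by omega) V
    omega

theorem runs_clear_le {s : Regs} (k : Reg) (h : (s.get k).length ≤ V) :
    Runs (clear k) s (s.set k []) (2 * V + 1) :=
  (runs_clear k).mono (by omega)

variable {D W : ℕ}

theorem runs_record {nQ nL : ℕ}
    (t : Fin nQ × Fin nL × Option (Fin nS) × Fin nQ × List (Fin nS)) {r u : List Bool}
    (hS : nS ≤ V) (hE : ∀ g, price g < V) (hV : 1 ≤ V) (hT : (encTrans t).length ≤ V)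
    (hQ : nQ ≤ V) (hL : nL ≤ V) (hW : W ≤ V) (hD : D ≤ V) (hQW : nQ * W ≤ V)
    (hx : topCost price t.2.2.1 ≤ V) (hy : wordCost price t.2.2.2.2 ≤ V) :
    Runs record (idle (encTrans t ++ u) (encList encUnary (List.ofFn price) ++ rest) r D W)
      (idle u (encList encUnary (List.ofFn price) ++ rest)
        (((List.range D).flatMap (transString (t.1 * W) (topCost price t.2.2.1) (t.2.2.2.1 * W)
          (wordCost price t.2.2.2.2) (encOption encFin t.2.2.1)
          (encList encFin t.2.2.2.2))).reverse ++ r) D W) (220 * V ^ 3) := by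
  rw [encTrans_append]
  simp only [encTrans, List.length_append] at hT
  obtain ⟨q, a, x, q', y⟩ := t
  simp only at *
  have hy' := length_le_length_encList encFin y
  have hqW : (q : ℕ) * W ≤ V := (Nat.mul_le_mul_right W q.2.le).trans hQW
  have hqW' : (q' : ℕ) * W ≤ V := (Nat.mul_le_mul_right W q'.2.le).trans hQW
  set e := encList encUnary (List.ofFn price) ++ rest with he
  have r1 := runs_mulOnto (s := idle (encUnary q ++ (encUnary a ++ (encOption encFin x ++
    (encUnary q' ++ (encList encFin y ++ u))))) e r D W) (k := .i) (k₁ := .w) (k₂ := .q)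
    (by decide) (by decide) (by decide) (by decide) (by decide) (by decide) rfl
    (Or.inl rfl) (m := q) (n := W) (encUnary_append _ _) rfl
  have r2 := runs_skipUnary (s := { idle (encUnary a ++ (encOption encFin x ++
    (encUnary q' ++ (encList encFin y ++ u)))) e r D W with q := ones (q * W) ++ [] }) .i rfl
  have r3 := runs_readTop (s := { idle (encOption encFin x ++
    (encUnary q' ++ (encList encFin y ++ u))) e r D W with q := ones (q * W) ++ [] }) x hS hE hV
    rfl rfl rfl rfl rfl
  have r4 := runs_mulOnto (s := { idle (encUnary q' ++ (encList encFin y ++ u)) e r D W with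
      q := ones (q * W) ++ [], x := (encOption encFin x).reverse, c := ones (topCost price x) })
    (k := .i) (k₁ := .w) (k₂ := .p)
    (by decide) (by decide) (by decide) (by decide) (by decide) (by decide) rfl
    (Or.inl rfl) (m := q') (n := W) (encUnary_append _ _) rfl
  have r5 := runs_readWord (s := { idle (encList encFin y ++ u) e r D W with
      q := ones (q * W) ++ [], x := (encOption encFin x).reverse, c := ones (topCost price x),
      p := ones (q' * W) ++ [] }) y hS hE hV (by omega) rfl rfl rfl rfl rfl
  let st : ℕ → Regs := fun m => { idle u e (((List.range m).flatMap (transString (q * W)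
      (topCost price x) (q' * W) (wordCost price y) (encOption encFin x)
      (encList encFin y))).reverse ++ r) D W with
    q := ones (q * W) ++ [], x := (encOption encFin x).reverse, c := ones (topCost price x),
    p := ones (q' * W) ++ [], y := (encList encFin y).reverse, b := ones (wordCost price y),
    j := ones m }
  have r6 := runs_copy (s := st 0) (k := .d) (k' := .n) (by decide) (by decide) (by decide) rfl
    (l := ones D) rfl
  have r7 := Runs.whileTrue_ones (p := emit) (k := .n) st (50 * V + 25) D (Or.inr ⟨rfl, rfl⟩)
    fun m hm w => by
      refine (runs_emit (s := (st m).set .n w) rfl (List.append_nil _) rfl (List.append_nil _) rfl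
        rfl rfl rfl hqW hx hqW' hy (by omega) (by omega) (by omega)).to ?_ le_rfl
      simp only [st, List.range_succ, List.flatMap_append, List.reverse_append,
        List.flatMap_singleton, List.append_assoc]
      rfl
  have r8 := runs_clear_le (s := st D) (V := V) .q (by
    change (ones (q * W) ++ []).length ≤ V
    rwa [List.append_nil, length_ones])
  have r9 := runs_clear_le (s := { st D with q := [] }) (V := V) .c ((length_ones _).trans_le hx)
  have r10 := runs_clear_le (s := { st D with q := [], c := [] }) (V := V) .x
    (List.length_reverse.trans_le (by omega))
  have r11 := runs_clear_le (s := { st D with q := [], c := [], x := [] }) (V := V) .p (by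
    change (ones (q' * W) ++ []).length ≤ V
    rwa [List.append_nil, length_ones])
  have r12 := runs_clear_le (s := { st D with q := [], c := [], x := [], p := [] }) (V := V) .b
    ((length_ones _).trans_le hy)
  have r13 := runs_clear_le (s := { st D with q := [], c := [], x := [], p := [], b := [] })
    (V := V) .y (List.length_reverse.trans_le (by omega))
  have r14 := runs_clear_le
    (s := { st D with q := [], c := [], x := [], p := [], b := [], y := [] }) (V := V) .j
    ((length_ones _).trans_le hD)
  refine (r1.seq (r2.seq (r3.seq (r4.seq (r5.seq (r6.seq (r7.seq (r8.seq (r9.seq (r10.seq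
    (r11.seq (r12.seq (r13.seq r14))))))))))))).to rfl ?_
  rw [length_ones]
  have h1 : (q : ℕ) * (5 * W + 3) ≤ V * (5 * V + 3) := Nat.mul_le_mul (by omega) (by omega)
  have h2 : (q' : ℕ) * (5 * W + 3) ≤ V * (5 * V + 3) := Nat.mul_le_mul (by omega) (by omega)
  have h3 : D * (50 * V + 25 + 1) ≤ V * (50 * V + 25 + 1) := Nat.mul_le_mul_right _ hD
  have h4 : V * (5 * V + 3) = 5 * V ^ 2 + 3 * V := by ring
  have h5 : V * (50 * V + 25 + 1) = 50 * V ^ 2 + 26 * V := by ring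
  have h6 : V ≤ V ^ 3 := Nat.le_self_pow (by omega) V
  have h7 : V ^ 2 ≤ V ^ 3 := Nat.pow_le_pow_right hV (by omega)
  have h8 := a.2
  omega

theorem runs_writeTrans {nQ nL : ℕ}
    (l : List (Fin nQ × Fin nL × Option (Fin nS) × Fin nQ × List (Fin nS))) {r u : List Bool}
    (hS : nS ≤ V) (hE : ∀ g, price g < V) (hV : 1 ≤ V) (hT : ∀ t ∈ l, (encTrans t).length ≤ V)
    (hQ : nQ ≤ V) (hL : nL ≤ V) (hW : W ≤ V) (hD : D ≤ V) (hQW : nQ * W ≤ V)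
    (hx : ∀ x, topCost price x ≤ V) (hy : ∀ t ∈ l, wordCost price t.2.2.2.2 ≤ V)
    (hl : l.length ≤ V) :
    Runs writeTrans (idle (encList encTrans l ++ u) (encList encUnary (List.ofFn price) ++ rest)
        r D W)
      (idle u (encList encUnary (List.ofFn price) ++ rest)
        ((l.flatMap (fun t => (List.range D).flatMap (transString (t.1 * W)
          (topCost price t.2.2.1) (t.2.2.2.1 * W) (wordCost price t.2.2.2.2)
          (encOption encFin t.2.2.1) (encList encFin t.2.2.2.2))) ++ [false]).reverse ++ r) D W)
      (230 * V ^ 4) := by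
  have r1 := Runs.whileTrue_list (p := record) (k := .i) (e := encTrans)
    (fun l => idle [] (encList encUnary (List.ofFn price) ++ rest)
      ((l.flatMap (fun t => (List.range D).flatMap (transString (t.1 * W)
          (topCost price t.2.2.1) (t.2.2.2.1 * W) (wordCost price t.2.2.2.2)
          (encOption encFin t.2.2.1) (encList encFin t.2.2.2.2)))).reverse ++ r) D W)
    (220 * V ^ 3) l u fun pre t ht v => by
      refine (runs_record t (u := v) hS hE hV (hT t ht) hQ hL hW hD hQW (hx _) (hy t ht)).to ?_
        le_rfl
      simp only [List.flatMap_append, List.reverse_append, List.flatMap_singleton,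
        List.append_assoc]
      rfl
  refine (r1.seq (Runs.push .r false)).to ?_ ?_
  · simp only [List.reverse_append]
    rfl
  · have h1 : l.length * (220 * V ^ 3 + 1) ≤ V * (220 * V ^ 3 + 1) := Nat.mul_le_mul_right _ hl
    have h2 : V * (220 * V ^ 3 + 1) = 220 * V ^ 4 + V := by ring
    have h3 : V ≤ V ^ 4 := Nat.le_self_pow (by omega) V
    omega

end Transitions

/-! ### Writing the letter costs and the threshold -/

/-- Write the letter costs and clear all registers but the rest of the input and the output. -/
def writeCosts : Prog Reg :=
  skipList .i ;; clear .e ;; copy .w .n ;;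
  .whileTrue .n (.push .r true ;; .push .r false ;; copy .j .a ;; writeBinary ;;
    .push .r true ;; .push .r true ;; .push .r false ;; .push .j true) ;;
  .push .r false ;; clear .j ;; clear .d ;; clear .w

/-- Rewrite the threshold from unary to binary. -/
def writeThreshold : Prog Reg :=
  .ifTrue .i (.push .r true) (.push .r false) ;;
  moveUnary .i .a ;; writeBinary ;; moveUnary .i .a ;; writeBinary

section Costs

variable {V : ℕ}

theorem encRat_natCast (n : ℕ) :
    encRat encBinary (n : ℚ) = false :: (encBinary n ++ [true, true, false]) := by
  have h : ¬ (n : ℤ) < 0 := by omega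
  simp [encRat, encBinary, encList, h]

theorem runs_writeCosts {ps : List ℕ} {e r u : List Bool} {D W E : ℕ} (hE : ∀ p ∈ ps, p ≤ E)
    (hEV : E ≤ V) (hps : ps.length ≤ V) (he : e.length ≤ V) (hW : W ≤ V) (hD : D ≤ V)
    (hV : 1 ≤ V) :
    Runs writeCosts (idle (encList encUnary ps ++ u) e r D W)
      { blank with
        i := u
        r := (encList (encRat encBinary)
          ((List.range W).map fun j => ((j : ℕ) : ℚ))).reverse ++ r } (70 * V ^ 3) := by
  have r1 := runs_skipList (s := idle (encList encUnary ps ++ u) e r D W) id .i ps (rest := u) hE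
    rfl
  have r2 := runs_clear_le (s := idle u e r D W) (V := V) .e he
  have r3 := runs_copy (s := idle u [] r D W) (k := .w) (k' := .n) (by decide) (by decide)
    (by decide) rfl (l := ones W) rfl
  let out : ℕ → List Bool := fun j => true :: encRat encBinary (j : ℚ)
  let st : ℕ → Regs := fun m =>
    { idle u [] (((List.range m).flatMap out).reverse ++ r) D W with j := ones m }
  have r4 := Runs.whileTrue_ones (p := (.push .r true ;; .push .r false ;; copy .j .a ;;
    writeBinary ;; .push .r true ;; .push .r true ;; .push .r false ;; .push .j true)) (k := .n)
    st (4 * V ^ 2 + 15 * V + 10) W (Or.inr ⟨rfl, rfl⟩) fun m hm w => by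
      have ra := runs_copy (s := ((st m).set .n w).set .r
          (false :: true :: (((List.range m).flatMap out).reverse ++ r)))
        (k := .j) (k' := .a) (by decide) (by decide) (by decide) rfl (l := ones m) rfl
      have rb := runs_writeBinary m (s := { (st m).set .n w with
          r := false :: true :: (((List.range m).flatMap out).reverse ++ r)
          a := ones m ++ [] }) (List.append_nil _) rfl rfl
      refine ((Runs.push .r true).seq ((Runs.push .r false).seq (ra.seq (rb.seq
        ((Runs.push .r true).seq ((Runs.push .r true).seq ((Runs.push .r false).seq
        (Runs.push .j true)))))))).to ?_ ?_
      · change ({ idle u [] (false :: true :: true :: ((encBinary m).reverse ++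
          false :: true :: (((List.range m).flatMap out).reverse ++ r))) D W with
          n := w, j := ones (m + 1) } : Regs) =
          { idle u [] (((List.range (m + 1)).flatMap out).reverse ++ r) D W with
            n := w, j := ones (m + 1) }
        rw [List.range_succ, List.flatMap_append, List.reverse_append, List.flatMap_singleton]
        simp [out, encRat_natCast]
      · rw [length_ones]
        have h1 : m * (4 * m + 10) ≤ V * (4 * V + 10) := Nat.mul_le_mul (by omega) (by omega)
        have h2 : V * (4 * V + 10) = 4 * V ^ 2 + 10 * V := by ring
        omega
  have r5 := runs_clear_le
    (s := (st W).set .r (false :: (((List.range W).flatMap out).reverse ++ r)))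
    (V := V) .j ((length_ones _).trans_le hW)
  have r6 := runs_clear_le
    (s := idle u [] (false :: (((List.range W).flatMap out).reverse ++ r)) D W)
    (V := V) .d ((length_ones _).trans_le hD)
  have r7 := runs_clear_le (s := { blank with
    i := u
    r := false :: (((List.range W).flatMap out).reverse ++ r)
    w := ones W }) (V := V) .w ((length_ones _).trans_le hW)
  refine (r1.seq (r2.seq (r3.seq (r4.seq ((Runs.push .r false).seq
    (r5.seq (r6.seq r7))))))).to ?_ ?_
  · change ({ blank with
      i := u
      r := false :: (((List.range W).flatMap out).reverse ++ r) } : Regs) = _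
    simp [encList_eq, out, List.flatMap_map]
  · rw [length_ones]
    have h1 : ps.length * (2 * E + 2) ≤ V * (2 * V + 2) := Nat.mul_le_mul hps (by omega)
    have h2 : W * (4 * V ^ 2 + 15 * V + 10 + 1) ≤ V * (4 * V ^ 2 + 15 * V + 10 + 1) :=
      Nat.mul_le_mul_right _ hW
    have h3 : V * (2 * V + 2) = 2 * V ^ 2 + 2 * V := by ring
    have h4 : V * (4 * V ^ 2 + 15 * V + 10 + 1) = 4 * V ^ 3 + 15 * V ^ 2 + 11 * V := by ring
    have h6 : V ≤ V ^ 3 := Nat.le_self_pow (by omega) V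
    have h7 : V ^ 2 ≤ V ^ 3 := Nat.pow_le_pow_right hV (by omega)
    omega

theorem runs_writeThreshold {q : ℚ} {r : List Bool} (hnum : q.num.natAbs ≤ V) (hden : q.den ≤ V)
    (hV : 1 ≤ V) :
    Runs writeThreshold { blank with i := encRat encUnary q, r := r }
      { blank with r := (encRat encBinary q).reverse ++ r } (50 * V ^ 2) := by
  let b := decide (q.num < 0)
  have r1 : Runs (.ifTrue .i (.push .r true) (.push .r false))
      { blank with i := encRat encUnary q, r := r }
      { blank with i := encUnary q.num.natAbs ++ encUnary q.den, r := b :: r } 2 := by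
    rcases hb : b
    · exact Runs.ifTrue_false (k := .i) (by change b :: _ = _; rw [hb]) (Runs.push .r false)
    · exact Runs.ifTrue_true (k := .i) (by change b :: _ = _; rw [hb]) (Runs.push .r true)
  have r2 := runs_moveUnary (s := { blank with
      i := encUnary q.num.natAbs ++ encUnary q.den, r := b :: r }) (k := .i) (k' := .a) (by decide)
    (Or.inl rfl) (n := q.num.natAbs) (encUnary_append _ _)
  have r3 := runs_writeBinary q.num.natAbs (s := { blank with
      i := encUnary q.den, r := b :: r, a := ones q.num.natAbs ++ [] }) (List.append_nil _) rfl rfl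
  have r4 := runs_moveUnary (s := { blank with
      i := encUnary q.den, r := (encBinary q.num.natAbs).reverse ++ b :: r }) (k := .i) (k' := .a)
    (by decide) (Or.inl rfl) (n := q.den) (rest := []) rfl
  have r5 := runs_writeBinary q.den (s := { blank with
      r := (encBinary q.num.natAbs).reverse ++ b :: r, a := ones q.den ++ [] })
    (List.append_nil _) rfl rfl
  refine (r1.seq (r2.seq (r3.seq (r4.seq r5)))).to ?_ ?_
  · change ({ blank with
      r := (encBinary q.den).reverse ++ ((encBinary q.num.natAbs).reverse ++ b :: r) } : Regs) = _
    simp [encRat, b]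
  · have h1 : q.num.natAbs * (4 * q.num.natAbs + 10) ≤ V * (4 * V + 10) :=
      Nat.mul_le_mul hnum (by omega)
    have h2 : q.den * (4 * q.den + 10) ≤ V * (4 * V + 10) := Nat.mul_le_mul hden (by omega)
    have h3 : V * (4 * V + 10) = 4 * V ^ 2 + 10 * V := by ring
    have h4 : V ≤ V ^ 2 := Nat.le_self_pow (by omega) V
    have h5 : 1 ≤ V ^ 2 := Nat.one_le_pow _ _ hV
    omega

end Costs

/-! ### The program that computes the reduction -/

/-- Write the reversed code of the letter cost instance to `r`. -/
def reduceReversed : Prog Reg :=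
  scan ;; powers ;; skipPDA ;; writeHeader ;; writeInit ;; writeAcc ;; writeTrans ;; writeCosts ;;
  writeThreshold

/-- The reduction. -/
def reduce : Prog Reg :=
  reduceReversed ;; reverseOnto .r .o

section Program

/-- The length of a stack is bounded by the running time, since a step pushes at most one bit. -/
theorem Exec.length_le {K : Type} [DecidableEq K] {p : Prog K} {S S' : K → List Bool} {n : ℕ}
    (h : Exec p S S' n) (k : K) : (S' k).length ≤ (S k).length + n := by
  have pop : ∀ {S : K → List Bool} {k' b l}, S k' = b :: l →
      (Function.update S k' l k).length ≤ (S k).length := fun {S k' b l} hS => by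
    rw [Function.update_apply]
    split_ifs with hk
    · rw [hk, hS]; simp
    · rfl
  induction h with
  | skip => omega
  | push S k' b =>
    rw [Function.update_apply]
    split_ifs with hk
    · rw [hk]; simp
    · omega
  | seq _ _ ih1 ih2 => omega
  | ifTrue_true hS _ ih => have := pop hS; omega
  | ifTrue_false hS _ ih => have := pop hS; omega
  | ifTrue_nil _ _ ih => omega
  | whileTrue_true hS _ _ ih1 ih2 => have := pop hS; omega
  | whileTrue_false hS => have := pop hS; omega
  | whileTrue_nil => omega
  | drain_true hS _ _ ih1 ih2 => have := pop hS; omega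
  | drain_false hS _ _ ih1 ih2 => have := pop hS; omega
  | drain_nil => omega

theorem encList_map {α β : Type} (e : β → List Bool) (f : α → β) (l : List α) :
    encList e (l.map f) = encList (fun a => e (f a)) l := by
  rw [encList_eq, encList_eq, List.flatMap_map]

variable (I : StackCostInstance)

theorem encList_track_init : encList encFin I.toLetterCost.pda.init =
    encList (fun q : Fin I.pda.numStates => encUnary (q * I.width)) I.pda.init := by
  simp only [StackCostInstance.toLetterCost, PDACode.track]
  rw [encList_map]
  simp only [encFin, val_costState I.width_pos _ I.width_pos, Nat.add_zero]

theorem encList_track_acc : encList encFin I.toLetterCost.pda.acc =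
    encList encUnary (I.pda.acc.flatMap fun q : Fin I.pda.numStates =>
        (List.range I.width).map fun m => q * I.width + m) := by
  simp only [StackCostInstance.toLetterCost, PDACode.track]
  simp only [encList_eq, List.flatMap_assoc, List.flatMap_map]
  congr 1
  refine List.flatMap_congr fun q _ => List.flatMap_congr fun m hm => ?_
  rw [encFin, val_costState I.width_pos _ (List.mem_range.1 hm)]

theorem encList_track_trans : encList encTrans I.toLetterCost.pda.trans =
    (I.pda.trans.flatMap fun t => (List.range I.depth).flatMap (transString (t.1 * I.width)
      (topCost I.price t.2.2.1) (t.2.2.2.1 * I.width) (wordCost I.price t.2.2.2.2)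
      (encOption encFin t.2.2.1) (encList encFin t.2.2.2.2))) ++ [false] := by
  simp only [StackCostInstance.toLetterCost, PDACode.track]
  simp only [encList_eq encTrans, List.flatMap_assoc, List.flatMap_map]
  congr 1
  refine List.flatMap_congr fun t ht => List.flatMap_congr fun m hm => ?_
  have hm' := List.mem_range.1 hm
  have h := I.add_depth_le_width
  have h1 : topCost I.price t.2.2.1 + m < I.width := by have := I.topCost_le t.2.2.1; omega
  have h2 : wordCost I.price t.2.2.2.2 + m < I.width := by have := I.wordCost_le ht; omega
  simp only [encTrans, costTransition, transString, encFin, val_costState I.width_pos _ h1,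
    val_costState I.width_pos _ h2, val_clip I.width_pos h1]

theorem ofFn_lc : List.ofFn I.toLetterCost.lc =
    (List.range I.width).map fun j => ((j : ℕ) : ℚ) := by
  refine List.ext_getElem ?_ fun i h1 h2 => ?_
  · rw [List.length_ofFn, List.length_map, List.length_range]
    rfl
  · rw [List.getElem_ofFn, List.getElem_map, List.getElem_range]
    rfl

theorem runs_reduceReversed :
    Runs reduceReversed { blank with i := I.encode }
      { blank with r := I.toLetterCost.encode.reverse } (700 * (I.encode.length ^ 8) ^ 4) := by
  have hsize := I.size_bounds
  have hlen := I.length_encode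
  simp only [length_encUnary] at hlen
  have hinit := length_le_length_encList encFin I.pda.init
  have hacc := length_le_length_encList encFin I.pda.acc
  have htrans := length_le_length_encList encTrans I.pda.trans
  have hpow : ∀ k, 1 ≤ k → k ≤ 8 → I.encode.length ^ k ≤ I.encode.length ^ 8 := fun k _ hk =>
    Nat.pow_le_pow_right (by omega) hk
  have hV1 : I.encode.length ≤ I.encode.length ^ 8 := by
    simpa using hpow 1 le_rfl (by omega)
  have hV2 := hpow 2 (by omega) (by omega)
  have hW : I.width ≤ I.encode.length ^ 8 := hpow 7 (by omega) (by omega)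
  have hD : I.depth ≤ I.encode.length ^ 8 := hpow 6 (by omega) (by omega)
  have hQW : I.pda.numStates * I.width ≤ I.encode.length ^ 8 := by
    rw [StackCostInstance.width, pow_succ' _ 7]
    exact Nat.mul_le_mul_right _ (by omega)
  have hT : ∀ t ∈ I.pda.trans, (encTrans t).length ≤ I.encode.length := fun t ht => by
    have := length_lt_length_encList_of_mem encTrans ht
    omega
  have hprice := I.price_le
  have hx := I.topCost_le
  have hy : ∀ t ∈ I.pda.trans, _ := fun t ht => I.wordCost_le ht
  have hprices := length_le_length_encList encUnary (List.ofFn I.price)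
  have hcode : I.encode = encUnary I.pda.numLetters ++ (encUnary I.pda.numSymbols ++
      (encUnary I.pda.numStates ++ (encList encFin I.pda.init ++ (encList encFin I.pda.acc ++
      (encList encTrans I.pda.trans ++ (encList encUnary (List.ofFn I.price) ++
      encRat encUnary I.threshold)))))) := by
    simp only [StackCostInstance.encode, encPDA, List.append_assoc]
  have hlt : I.encode.length < I.encode.length ^ 8 := by
    calc I.encode.length < I.encode.length * I.encode.length :=
          Nat.lt_mul_self_iff.2 (by omega)
      _ ≤ I.encode.length ^ 8 := by rw [← sq]; exact hV2
  have r1 := runs_scan I.encode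
  have r2 := runs_powers I.encode I.encode (L := I.encode.length) (V := I.encode.length ^ 8) hW
    (by omega)
  have hM : I.pda.SizeLE (I.encode.length ^ 8) :=
    ⟨by omega, by omega, by omega, by omega, by omega, by omega, fun t ht => by
      have h1 := hT t ht
      have h2 := length_le_length_encList encFin t.2.2.2.2
      simp only [encTrans, List.length_append] at h1
      omega⟩
  have r3 := runs_skipPDA (s := idle I.encode I.encode [] I.depth I.width) hM (by omega) rfl
  have ht : (encList encUnary (List.ofFn I.price) ++ encRat encUnary I.threshold).length ≤
      I.encode.length := by
    rw [hcode]
    simp only [List.length_append]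
    omega
  set V := I.encode.length ^ 8 with hV
  set e := encList encUnary (List.ofFn I.price) ++ encRat encUnary I.threshold with he
  have r4 := fun u r => runs_writeHeader (u := u) (e := e) (r := r) (D := I.depth)
    (W := I.width) (V := V) (nL := I.pda.numLetters) (nS := I.pda.numSymbols)
    (nQ := I.pda.numStates) hW hM.letters hM.symbols hM.states (by omega)
  have r5 := fun u r => runs_writeInit (u := u) (e := e) (r := r) (D := I.depth)
    (W := I.width) (V := V) I.pda.init hM.init hW hM.states (by omega)
  have r6 := fun u r => runs_writeAcc (u := u) (e := e) (r := r) (D := I.depth)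
    (W := I.width) (V := V) I.pda.acc hM.acc hW hQW hM.states (by omega)
  have r7 := fun u r => runs_writeTrans (u := u) (rest := encRat encUnary I.threshold) (r := r)
    (D := I.depth) (price := I.price)
    (W := I.width) (V := V) I.pda.trans hM.symbols (fun g => (hprice g).trans_lt hlt) (by omega)
    (fun t ht => (hT t ht).trans hV1) hM.states hM.letters hW hD hQW
    (fun x => (hx x).trans hV2) (fun t ht => (hy t ht).trans hV2) hM.trans
  have r8 := fun u r => runs_writeCosts (u := u) (e := e) (r := r) (D := I.depth)
    (W := I.width) (V := V) (ps := List.ofFn I.price) (E := V) (fun p hp => by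
      obtain ⟨g, rfl⟩ := List.mem_ofFn.1 hp
      exact (hprice g).trans hV1) le_rfl (by omega) (by omega) hW hD (by omega)
  have r9 := fun r => runs_writeThreshold (V := V) (q := I.threshold) (r := r) (by omega)
    (by omega) (by omega)
  have r3' : Runs skipPDA (idle I.encode I.encode [] I.depth I.width)
      (idle (encUnary I.pda.numLetters ++ (encUnary I.pda.numSymbols ++
      (encUnary I.pda.numStates ++ (encList encFin I.pda.init ++ (encList encFin I.pda.acc ++
      (encList encTrans I.pda.trans ++ e)))))) e [] I.depth I.width) (70 * V ^ 3) := by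
    rw [← hcode]
    exact r3
  refine (r1.seq (r2.seq (r3'.seq ((r4 _ _).seq ((r5 _ _).seq ((r6 _ _).seq ((r7 _ _).seq
    ((r8 _ _).seq (r9 _))))))))).to ?_ ?_
  · simp only [LetterCostInstance.encode, encPDA, encList_track_init, encList_track_acc,
      encList_track_trans, ofFn_lc, List.reverse_append, List.append_assoc, List.append_nil]
    rfl
  · have h1 : V ≤ V ^ 4 := Nat.le_self_pow (by omega) V
    have h2 : V ^ 2 ≤ V ^ 4 := Nat.pow_le_pow_right (by omega) (by omega)
    have h3 : V ^ 3 ≤ V ^ 4 := Nat.pow_le_pow_right (by omega) (by omega)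
    omega

/-- The map from stack cost instances to letter cost instances is computable in polynomial time. -/
theorem nonempty_computable_toLetterCost : Nonempty (Turing.TM2ComputableInPolyTime
    StackCostInstance.encode LetterCostInstance.encode StackCostInstance.toLetterCost) := by
  refine reduce.nonempty_computable .i .o (Polynomial.C 2101 * Polynomial.X ^ 32) fun I => ?_
  obtain ⟨n, hn, h1⟩ := runs_reduceReversed I
  have hlen : I.toLetterCost.encode.length ≤ n := by
    have := h1.length_le .r
    simpa [blank, Regs.get] using this
  obtain ⟨n', hn', h2⟩ := runs_reverseOnto (k := .r) (k' := .o)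
    (s := { blank with r := I.toLetterCost.encode.reverse }) (by decide) rfl
  have hblank : blank.get = fun _ => [] := by funext k; cases k <;> rfl
  have e1 : Regs.get { blank with i := I.encode } =
      Function.update (fun _ => []) .i I.encode := by
    rw [← hblank, ← Regs.get_set]
    rfl
  have e2 : Regs.get { blank with o := I.toLetterCost.encode } =
      Function.update (fun _ => []) .o I.toLetterCost.encode := by
    rw [← hblank, ← Regs.get_set]
    rfl
  refine ⟨n + n', ?_, ?_⟩
  · simp only [Polynomial.eval_mul, Polynomial.eval_C, Polynomial.eval_pow, Polynomial.eval_X]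
    rw [← pow_mul, show 8 * 4 = 32 from rfl] at hn
    have : 1 ≤ I.encode.length ^ 32 := Nat.one_le_pow _ _ (by have := I.size_bounds; omega)
    change n' ≤ 2 * I.toLetterCost.encode.reverse.length + 1 at hn'
    rw [List.length_reverse] at hn'
    omega
  · rw [← e1, ← e2]
    refine h1.seq ?_
    convert h2 using 1
    change _ = Regs.get { blank with o := I.toLetterCost.encode.reverse.reverse ++ [] }
    rw [List.reverse_reverse, List.append_nil]

end Program

end StackCost

theorem mainTheorem2 :
    (∀ r : StackCost.Comparison,
      StackCost.PolyTimeReducible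
        StackCost.StackCostInstance.encode StackCost.LetterCostInstance.encode
        (StackCost.IASCProblem r) (StackCost.AvgInfLCProblem r)) ∧
    (∀ r : StackCost.Comparison,
      StackCost.PolyTimeReducible
        StackCost.StackCostInstance.encode StackCost.LetterCostInstance.encode
        (StackCost.SASCProblem r) (StackCost.AvgSupLCProblem r)) :=
  ⟨fun r => ⟨StackCost.StackCostInstance.toLetterCost,
      StackCost.nonempty_computable_toLetterCost, fun I => StackCost.IASCProblem_iff I r⟩,
    fun r => ⟨StackCost.StackCostInstance.toLetterCost,
      StackCost.nonempty_computable_toLetterCost, fun I => StackCost.SASCProblem_iff I r⟩⟩
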